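/- **Setting.** Let $L\ge 1$, let $w_0,\dots,w_L$ be layer widths, and write $d_1^l=w_l$, $d_2^l=w_{l-1}$ for $1\le l\le L$ and $d_1^0=w_0$. A network $\mathbf M$ consists of matrices $\mathbf A^l\in\mathbb R^{d_1^l\times d_2^l}$ and activation functions $\phi_l:\mathbb R^{w_l}\to\mathbb R^{w_l}$ ($1\le l<L$) with $\phi_l(0)=0$ that are $L_l$-Lipschitz in the Euclidean norm; it computes $\mathbf M(x)=\mathbf A^L\phi_{L-1}(\mathbf A^{L-1}\phi_{L-2}(\cdots\phi_1(\mathbf A^1x)))$. The output layer carries no activation, so $L_L:=1$. For a classifier $f:\mathbb R^{w_0}\to\mathbb R^{w_L}$, a probability measure $\mathcal D$ on $\mathbb R^{w_0}\times\{1,\dots,w_L\}$ and a sample $\mathcal S=((x_i,y_i))_{i\le n}$, $n\ge1$, put $$R_\gamma(f)=\mathbb P_{(x,y)\sim\mathcal D}\Big[f(x)[y]\le\gamma+\max_{j\ne y}f(x)[j]\Big],\qquad \hat R_\gamma(f)=\frac1n\,\Big|\Big\{i: f(x_i)[y_i]\le\gamma+\max_{j\neq y_i}f(x_i)[j]\Big\}\Big|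 .$$ The inputs satisfy $\|x\|_2\le d_1^0$ for $\mathcal D$-almost every $(x,y)$, and $\mathcal S$ is drawn i.i.d. from $\mathcal D$. The trained weights $\mathbf A^l$ may depend on $\mathcal S$ in any way, but within each layer the entries are i.i.d. $\mathcal N(0,\Psi)$, where $\Psi>0$. Fix $d>0$, $\epsilon_l>0$, $\rho_l>0$. *Pruning*: independently of everything else, each off-diagonal entry $\mathbf A^l_{ij}$ ($i\neq j$) is set to $0$ with probability $\exp(-(\mathbf A^l_{ij})^2/(d\Psi))$, independently over entries and layers; all other entries are kept. The result is $\hat{\mathbf A}^l$, and $J_l$ is the number of its nonzero entries. *Discretization*: every entry of $\hat{\mathbf A}^l$ is rounded to the nearest multiple of $\rho_l$. The resulting network is $g_A$; the original network is $f=\mathbf M$. For a constant $C_0$ let $$\Gamma_l=C_0\left[\sqrt{\tfrac{d^{3/2}\Psi}{(d+2)^{3/2}}}\left(\sqrt{d_1^l}+\sqrt{d_2^l}\right)+\left(\tfrac{3d_1^ld_2^ld^{5/2}\Psi^2}{(d+2)^{5/2}}\right)^{1/4}\right].$$ **Lemma.** There is a universal constant $C_0>0$ such that for all $B>0$ and $\rho_0\in(0,1)$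 there is a constant $C>0$, depending only on $B$ and $\rho_0$, with the following property. In the setting above, with $\rho_l\le\rho_0$, with integers $0\le\alpha_l\le d_1^ld_2^l$, and with $\delta\in(0,1)$, the following holds with probability (over the sample, the training and the pruning) at least $$1-\delta-\sum_{l=1}^L\epsilon_l^{-1}-2\Big(\sum_{l=1}^Ld_1^ld_2^l\Big)e^{-B^2/(2\Psi)}:$$ if $J_l\le\alpha_l$ and $\epsilon_l\Gamma_l+\rho_lJ_l\le\frac1L\|\mathbf A^l\|_2$ for all $l$, then for every $$\gamma\ \ge\ e\,d_1^0\Big(\prod_{l=1}^LL_l\|\mathbf A^l\|_2\Big)\sum_{l=1}^L\frac{\epsilon_l\Gamma_l+\rho_lJ_l}{\|\mathbf A^l\|_2}$$ we have $$R_0(g_A)\le\hat R_\gamma(f)+C\sqrt{\frac{\sum_{l=1}^L\left[\log\binom{d_1^ld_2^l}{\alpha_l}+\alpha_l\log\frac1{\rho_l}\right]}{n}}+\sqrt{\frac{\log(1/\delta)}{2n}} .$$ -/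

import Mathlib

open scoped Matrix.Norms.L2Operator

noncomputable section

namespace PrunedNet

/-- Weights of a feed-forward network with layer widths `w 0, w 1, w 2, …`: the entry with index `l`
is the matrix of layer `l + 1`, mapping vectors of length `w l` to vectors of length `w (l + 1)`.
A network with `L` layers uses the entries with index `l < L` only. -/
abbrev Weights (w : ℕ → ℕ) : Type :=
  (l : ℕ) → Matrix (Fin (w (l + 1))) (Fin (w l)) ℝ

/-- Activation functions; `φ l` acts on the output of layer `l` (used for `1 ≤ l < L` only). -/
abbrev Activations (w : ℕ → ℕ) : Type :=
  (l : ℕ) → EuclideanSpace ℝ (Fin (w l)) → EuclideanSpace ℝ (Fin (w l))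

/-- The outputs of the layers: `x⁰ = x`, `x¹ = A₁ x`, `x² = A₂ φ₁(A₁ x)`, and so on.
The network with `L` layers is the map `forward φ A L`. -/
def forward {w : ℕ → ℕ} (φ : Activations w) (A : Weights w) :
    (l : ℕ) → EuclideanSpace ℝ (Fin (w 0)) → EuclideanSpace ℝ (Fin (w l))
  | 0, x => x
  | 1, x => Matrix.toEuclideanLin (A 0) x
  | l + 2, x => Matrix.toEuclideanLin (A (l + 1)) (φ (l + 1) (forward φ A (l + 1) x))

section Risk

variable {p k n : ℕ}

/-- `f` errs at margin `γ` on the labelled example `z = (x, y)`: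
`f(x)[y] ≤ γ + max_{j ≠ y} f(x)[j]` (a maximum over no classes at all being `-∞`). -/
def MarginError (γ : ℝ) (f : EuclideanSpace ℝ (Fin p) → EuclideanSpace ℝ (Fin k))
    (z : EuclideanSpace ℝ (Fin p) × Fin k) : Prop :=
  ∃ j, j ≠ z.2 ∧ f z.1 z.2 ≤ γ + f z.1 j

/-- With at least two classes `MarginError` is the inequality with the maximum. -/
theorem marginError_iff (γ : ℝ) (f : EuclideanSpace ℝ (Fin p) → EuclideanSpace ℝ (Fin k))
    (z : EuclideanSpace ℝ (Fin p) × Fin k) (h : (Finset.univ.erase z.2).Nonempty) :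
    MarginError γ f z ↔
      f z.1 z.2 ≤ γ + (Finset.univ.erase z.2).sup' h (fun j => f z.1 j) := by
  have h1 : f z.1 z.2 ≤ γ + (Finset.univ.erase z.2).sup' h (fun j => f z.1 j) ↔
      f z.1 z.2 - γ ≤ (Finset.univ.erase z.2).sup' h (fun j => f z.1 j) := by
    constructor <;> intro h <;> linarith
  rw [h1, Finset.le_sup'_iff]
  constructor
  · rintro ⟨j, hj, hle⟩
    exact ⟨j, by simp [hj], by linarith⟩
  · rintro ⟨j, hj, hle⟩
    exact ⟨j, by simpa using hj, by linarith⟩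

/-- Expected margin loss `R_γ(f)` under the data distribution `D`. -/
def risk (D : MeasureTheory.Measure (EuclideanSpace ℝ (Fin p) × Fin k)) (γ : ℝ)
    (f : EuclideanSpace ℝ (Fin p) → EuclideanSpace ℝ (Fin k)) : ℝ :=
  D.real {z | MarginError γ f z}

/-- Empirical margin loss of `f` on the sample `s`: the fraction of the `n` examples on which `f`
errs at margin `γ`. -/
def empRisk (s : Fin n → EuclideanSpace ℝ (Fin p) × Fin k) (γ : ℝ)
    (f : EuclideanSpace ℝ (Fin p) → EuclideanSpace ℝ (Fin k)) : ℝ :=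
  (1 / (n : ℝ)) * ∑ i, Set.indicator {z | MarginError γ f z} (fun _ => (1 : ℝ)) (s i)

end Risk

/-- Magnitude-based pruning of one matrix. An off-diagonal entry `a` is set to `0` with probability
`exp (-a² / (d Ψ))`, otherwise kept; diagonal entries are always kept. The coin of the entry
`(i, j)` is the event `u i j ≤ exp (-a² / (d Ψ))`, where `u i j` is uniform on `[0, 1]`. -/
def prune {m n : ℕ} (d Ψ : ℝ) (u A : Matrix (Fin m) (Fin n) ℝ) : Matrix (Fin m) (Fin n) ℝ :=
  Matrix.of fun i j =>
    if (i : ℕ) ≠ (j : ℕ) ∧ u i j ≤ Real.exp (-(A i j) ^ 2 / (d * Ψ)) then 0 else A i j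

/-- Rounding every entry to the nearest multiple of `ρ`. -/
def discretize {m n : ℕ} (ρ : ℝ) (A : Matrix (Fin m) (Fin n) ℝ) : Matrix (Fin m) (Fin n) ℝ :=
  Matrix.of fun i j => ρ * (round (A i j / ρ) : ℝ)

/-- Number of nonzero entries. -/
def numNonzero {m n : ℕ} (A : Matrix (Fin m) (Fin n) ℝ) : ℕ :=
  (Finset.univ.filter fun q : Fin m × Fin n => A q.1 q.2 ≠ 0).card

/-- The pruned network. -/
def pruned {w : ℕ → ℕ} (d Ψ : ℝ) (u A : Weights w) : Weights w :=
  fun l => prune d Ψ (u l) (A l)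

/-- The pruned and discretized network. -/
def compressed {w : ℕ → ℕ} (d Ψ : ℝ) (ρ : ℕ → ℝ) (u A : Weights w) : Weights w :=
  fun l => discretize (ρ l) (pruned d Ψ u A l)

/-- The scale `Γ` of the pruning error of a `d₁ × d₂` layer, with constant `C₀`. -/
def pruneScale (C₀ d Ψ : ℝ) (d₁ d₂ : ℕ) : ℝ :=
  C₀ * (Real.sqrt (d ^ (3 / 2 : ℝ) * Ψ / (d + 2) ^ (3 / 2 : ℝ)) *
      (Real.sqrt d₁ + Real.sqrt d₂) +
    (3 * d₁ * d₂ * d ^ (5 / 2 : ℝ) * Ψ ^ 2 / (d + 2) ^ (5 / 2 : ℝ)) ^ (1 / 4 : ℝ))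

/-- The error level of layer `l + 1`, `ε Γ + ρ J`, where `J` counts the nonzero entries of the pruned
matrix. -/
def layerError {w : ℕ → ℕ} (C₀ d Ψ : ℝ) (ε ρ : ℕ → ℝ) (u A : Weights w) (l : ℕ) : ℝ :=
  ε l * pruneScale C₀ d Ψ (w (l + 1)) (w l) + ρ l * (numNonzero (pruned d Ψ u A l) : ℝ)

/-- The margin threshold `e d₁⁰ (∏ Lₗ ‖Aˡ‖₂) ∑ₗ (εₗ Γₗ + ρₗ Jₗ) / ‖Aˡ‖₂`. There are `L` matrices and
`L - 1` activation functions (the output layer has none). -/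
def marginThreshold {w : ℕ → ℕ} (C₀ d Ψ : ℝ) (L : ℕ) (lip : ℕ → NNReal) (ε ρ : ℕ → ℝ)
    (u A : Weights w) : ℝ :=
  Real.exp 1 * (w 0 : ℝ) *
    ((∏ l ∈ Finset.Ico 1 L, (lip l : ℝ)) * ∏ l ∈ Finset.range L, ‖A l‖) *
    ∑ l ∈ Finset.range L, layerError C₀ d Ψ ε ρ u A l / ‖A l‖

/-- The counting complexity `∑ₗ (log (d₁ˡ d₂ˡ choose αₗ) + αₗ log (1 / ρₗ))`. -/
def complexity (w : ℕ → ℕ) (L : ℕ) (α : ℕ → ℕ) (ρ : ℕ → ℝ) : ℝ :=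
  ∑ l ∈ Finset.range L,
    (Real.log ((w (l + 1) * w l).choose (α l) : ℝ) + (α l : ℝ) * Real.log (1 / ρ l))

end PrunedNet

end

open PrunedNet MeasureTheory ProbabilityTheory

namespace PrunedNet

/-! ### Product measures and Gaussian exponential moments -/

/-! The bound combines a finite class with a perturbation estimate. On the event that all weights
lie in `[-B, B]`, a compressed layer is determined by at most `α l` positions and by integers of
size `O(B / ρ l)` there, so the compressed network lies in a finite class that does not depend on
the sample (`exists_finite_class`). Hoeffding's inequality and a union bound over this class
(`measure_exists_risk_gt_le`) compare risk and empirical risk however the trained weights depend on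
the sample. If moreover the outputs of the two networks differ by at most `γ / 2`, a margin-zero
error of the compressed network is a margin-`γ` error of the original one. Relative layer errors add
up through the network, at the cost of `(1 + 1/L)^L ≤ e` (`norm_forward_le`).

A layer error is the sum of a rounding error, at most `ρ J / 2`, and the pruning error `A - prune
A`, whose operator norm must be at most `ε Γ / 2` outside an event of probability `1 / ε`. This is
the hard part. Removing a Gaussian entry `a` with probability `exp (-a² / (d Ψ))` tilts its density
into `p = √(d/(d+2))` times a Gaussian density of variance `Ψ p²` (`lintegral_gaussianReal_tilt`).
Off the diagonal the pruning error is therefore `√Ψ p` times a standard Gaussian matrix with an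
independent Bernoulli(`p`) mask (`map_pruneGap`); on the diagonal it is zero.

For an `m × n` masked Gaussian matrix with `m ≤ n`, which suffices by transposition,
`measure_masked_le` bounds the norm by a multiple of `ε √Q`, where `Q = p n + √(m n p)`. If `m n p ≤
1`, Markov's inequality for the Frobenius norm is enough. Otherwise the columns are split according
to whether they have at most `D = 7 p n` mask entries. On light columns the image of a fixed vector
has a good exponential moment conditionally on the mask, and the unit ball is covered by nets for
large, medium and small coordinates: sparse vectors have small nets, while flat vectors have small
variance in every light column (`measure_lightPart_le`). On heavy columns the Gram matrix of the
rows is compared with its diagonal in Hilbert–Schmidt norm; its second moment is small because heavy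
columns are exponentially rare (`lintegral_heavyStat_le`). -/

theorem lintegral_pi_prod {T : Type*} [Fintype T] {E : T → Type*} [∀ t, MeasurableSpace (E t)]
    (ν : ∀ t, Measure (E t)) [∀ t, IsProbabilityMeasure (ν t)] (f : ∀ t, E t → ENNReal)
    (hf : ∀ t, Measurable (f t)) :
    ∫⁻ x, ∏ t, f t (x t) ∂Measure.pi ν = ∏ t, ∫⁻ y, f t y ∂ν t := by
  have h := lintegral_prod_eq_prod_lintegral_of_indepFun (μ := Measure.pi ν) Finset.univ
    (fun t x => f t (x t)) (iIndepFun_pi fun t => (hf t).aemeasurable)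
    (fun t => (hf t).comp (measurable_pi_apply t))
  rw [h]
  refine Finset.prod_congr rfl fun t _ => ?_
  conv_rhs => rw [← (measurePreserving_eval ν t).map_eq]
  rw [lintegral_map (hf t) (measurable_pi_apply t)]

/-- Tilting a centred Gaussian by `exp (-c x²)` gives a multiple of another centred Gaussian. -/
theorem lintegral_gaussianReal_tilt {v v' : NNReal} (hv : v ≠ 0) (hv' : v' ≠ 0) {c : ℝ}
    (hc : (v' : ℝ)⁻¹ = (v : ℝ)⁻¹ + 2 * c) {f : ℝ → ENNReal} (hf : Measurable f) :
    ∫⁻ x, ENNReal.ofReal (Real.exp (-c * x ^ 2)) * f x ∂gaussianReal 0 v =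
      ENNReal.ofReal (Real.sqrt (v' / v)) * ∫⁻ x, f x ∂gaussianReal 0 v' := by
  have hvp : (0 : ℝ) < v := by positivity
  have hvp' : (0 : ℝ) < v' := by positivity
  rw [gaussianReal_of_var_ne_zero _ hv, gaussianReal_of_var_ne_zero _ hv',
    lintegral_withDensity_eq_lintegral_mul _ (measurable_gaussianPDF _ _) (by fun_prop),
    lintegral_withDensity_eq_lintegral_mul _ (measurable_gaussianPDF _ _) hf,
    ← lintegral_const_mul _ (by fun_prop)]
  refine lintegral_congr fun x => ?_
  simp only [Pi.mul_apply, gaussianPDF]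
  rw [← mul_assoc, ← mul_assoc, ← ENNReal.ofReal_mul (gaussianPDFReal_nonneg _ _ _),
    ← ENNReal.ofReal_mul (Real.sqrt_nonneg _)]
  congr 2
  simp only [gaussianPDFReal, sub_zero]
  rw [mul_assoc, ← Real.exp_add, ← mul_assoc]
  congr 1
  · rw [Real.sqrt_div' _ hvp.le, Real.sqrt_mul' _ hvp.le, Real.sqrt_mul' _ hvp'.le]
    have := Real.sqrt_pos.2 hvp
    have := Real.sqrt_pos.2 hvp'
    have := Real.sqrt_pos.2 (show (0 : ℝ) < 2 * Real.pi by positivity)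
    field_simp
  · congr 1
    have : c = ((v' : ℝ)⁻¹ - (v : ℝ)⁻¹) / 2 := by linarith
    rw [this]; field_simp; ring

theorem lintegral_exp_mul_gaussian (a : ℝ) :
    ∫⁻ x, ENNReal.ofReal (Real.exp (a * x)) ∂gaussianReal 0 1 =
      ENNReal.ofReal (Real.exp (a ^ 2 / 2)) := by
  rw [← ofReal_integral_eq_lintegral_ofReal (integrable_exp_mul_gaussianReal a)
    (ae_of_all _ fun x => (Real.exp_pos _).le)]
  congr 1
  have h := congrFun (mgf_id_gaussianReal (μ := 0) (v := 1)) a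
  simpa [mgf] using h

/-- Tilting with `c = -a` gives the exact value `(1 - 2a)^(-1/2)`. The restriction `a ≤ 1/4` is what
makes `(1 - 2a)(1 + 4a) ≥ 1`, hence the value at most `e^(2a)`. -/
theorem lintegral_exp_mul_sq_gaussian {a : ℝ} (ha0 : 0 ≤ a) (ha : a ≤ 1 / 4) :
    ∫⁻ x, ENNReal.ofReal (Real.exp (a * x ^ 2)) ∂gaussianReal 0 1 ≤
      ENNReal.ofReal (Real.exp (2 * a)) := by
  have h1 : 0 < 1 - 2 * a := by linarith
  obtain ⟨w, hw⟩ : ∃ w : NNReal, (w : ℝ) = (1 - 2 * a)⁻¹ := ⟨⟨_, (inv_pos.2 h1).le⟩, rfl⟩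
  have hw0 : w ≠ 0 := by
    intro h
    rw [h, NNReal.coe_zero] at hw
    exact (inv_pos.2 h1).ne hw
  have h := lintegral_gaussianReal_tilt (v := 1) (v' := w) (c := -a)
    one_ne_zero hw0 (by rw [hw, inv_inv, NNReal.coe_one]; ring) (f := fun _ => 1)
    measurable_const
  simp only [neg_neg, mul_one, lintegral_const, measure_univ, NNReal.coe_one, div_one] at h
  rw [h, hw]
  refine ENNReal.ofReal_le_ofReal ?_
  rw [Real.sqrt_le_left (Real.exp_pos _).le, ← Real.exp_nat_mul, inv_le_comm₀ h1 (Real.exp_pos _),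
    ← Real.exp_neg]
  have h3 : 1 + 4 * a ≤ Real.exp (4 * a) := by linarith [Real.add_one_le_exp (4 * a)]
  have h4 : Real.exp (-((2 : ℕ) * (2 * a))) = (Real.exp (4 * a))⁻¹ := by
    rw [← Real.exp_neg]; congr 1; push_cast; ring
  rw [h4]
  have h5 : (Real.exp (4 * a))⁻¹ ≤ (1 + 4 * a)⁻¹ := inv_anti₀ (by linarith) h3
  refine h5.trans ?_
  rw [inv_le_iff_one_le_mul₀ (by linarith)]
  nlinarith

theorem lintegral_exp_linear_gaussian {T : Type*} [Fintype T] (a : T → ℝ) :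
    ∫⁻ g, ENNReal.ofReal (Real.exp (∑ t, a t * g t)) ∂Measure.pi (fun _ : T => gaussianReal 0 1) =
      ENNReal.ofReal (Real.exp (∑ t, a t ^ 2 / 2)) := by
  simp_rw [Real.exp_sum]
  simp_rw [ENNReal.ofReal_prod_of_nonneg (fun t _ => (Real.exp_pos _).le)]
  rw [lintegral_pi_prod (fun _ : T => gaussianReal 0 1)
    (fun t x => ENNReal.ofReal (Real.exp (a t * x))) (fun t => by fun_prop)]
  simp_rw [lintegral_exp_mul_gaussian]

/-- Exponential moment of the squared norm of a vector of independent Gaussian linear forms. -/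
theorem lintegral_exp_sum_sq_gaussian {ι κ : Type*} [Fintype ι] [Fintype κ] (c : ι → κ → ℝ)
    {lam : ℝ} (hlam : 0 ≤ lam) (hs : ∀ j, lam * ∑ i, c i j ^ 2 ≤ 1 / 4) :
    ∫⁻ g, ENNReal.ofReal (Real.exp (lam * ∑ j, (∑ i, c i j * g (i, j)) ^ 2))
        ∂Measure.pi (fun _ : ι × κ => gaussianReal 0 1) ≤
      ENNReal.ofReal (Real.exp (2 * lam * ∑ j, ∑ i, c i j ^ 2)) := by
  have hsq : Real.sqrt (2 * lam) ^ 2 = 2 * lam := Real.sq_sqrt (by linarith)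
  -- Linearization of the squares: `exp (lam X²)` is the expectation of `exp (√(2 lam) X θ)` over an
  -- independent standard Gaussian `θ`. After exchanging the integrals, integrating out `g` leaves
  -- Gaussian squares in `θ` alone.
  have h1 : ∀ g : ι × κ → ℝ,
      ENNReal.ofReal (Real.exp (lam * ∑ j, (∑ i, c i j * g (i, j)) ^ 2)) =
      ∫⁻ θ, ENNReal.ofReal (Real.exp (∑ j, (Real.sqrt (2 * lam) * ∑ i, c i j * g (i, j)) * θ j))
        ∂Measure.pi (fun _ : κ => gaussianReal 0 1) := by
    intro g
    rw [lintegral_exp_linear_gaussian]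
    congr 2
    rw [Finset.mul_sum]
    refine Finset.sum_congr rfl fun j _ => ?_
    rw [mul_pow, hsq]; ring
  simp_rw [h1]
  rw [lintegral_lintegral_swap (by fun_prop)]
  have h2 : ∀ θ : κ → ℝ,
      ∫⁻ g, ENNReal.ofReal (Real.exp (∑ j, (Real.sqrt (2 * lam) * ∑ i, c i j * g (i, j)) * θ j))
        ∂Measure.pi (fun _ : ι × κ => gaussianReal 0 1) =
      ∏ j, ENNReal.ofReal (Real.exp ((lam * ∑ i, c i j ^ 2) * θ j ^ 2)) := by
    intro θ
    have h3 : ∀ g : ι × κ → ℝ, ∑ j, (Real.sqrt (2 * lam) * ∑ i, c i j * g (i, j)) * θ j =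
        ∑ t : ι × κ, (Real.sqrt (2 * lam) * θ t.2 * c t.1 t.2) * g t := by
      intro g
      rw [Fintype.sum_prod_type_right]
      refine Finset.sum_congr rfl fun j _ => ?_
      rw [Finset.mul_sum, Finset.sum_mul]
      exact Finset.sum_congr rfl fun i _ => by ring
    simp_rw [h3]
    rw [lintegral_exp_linear_gaussian, ← ENNReal.ofReal_prod_of_nonneg
      (fun t _ => (Real.exp_pos _).le), ← Real.exp_sum, Fintype.sum_prod_type_right]
    congr 2
    refine Finset.sum_congr rfl fun j _ => ?_
    rw [Finset.mul_sum, Finset.sum_mul]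
    refine Finset.sum_congr rfl fun i _ => ?_
    simp only [mul_pow, hsq]; ring
  simp_rw [h2]
  rw [lintegral_pi_prod (fun _ : κ => gaussianReal 0 1)
    (fun j x => ENNReal.ofReal (Real.exp ((lam * ∑ i, c i j ^ 2) * x ^ 2))) (fun t => by fun_prop)]
  calc _ ≤ ∏ j, ENNReal.ofReal (Real.exp (2 * (lam * ∑ i, c i j ^ 2))) :=
        Finset.prod_le_prod' fun j _ => lintegral_exp_mul_sq_gaussian
          (mul_nonneg hlam (Finset.sum_nonneg fun i _ => sq_nonneg _)) (hs j)
    _ = _ := by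
        rw [← ENNReal.ofReal_prod_of_nonneg (fun t _ => (Real.exp_pos _).le), ← Real.exp_sum]
        congr 2
        rw [Finset.mul_sum]
        exact Finset.sum_congr rfl fun i _ => by ring

end PrunedNet

namespace PrunedNet

/-! ### Nets of sparse vectors with bounded coordinates -/

/-- Vectors in the unit ball with at most `k` nonzero coordinates, all of square at most `b`. -/
def sparseFlat (ι : Type*) [Fintype ι] (k b : ℝ) : Set (ι → ℝ) :=
  {w | ∑ i, w i ^ 2 ≤ 1 ∧ (∀ i, w i ^ 2 ≤ b) ∧ ((Finset.univ.filter fun i => w i ≠ 0).card : ℝ) ≤ k}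

/-- Total mass of the weight that counts net points in `card_le_of_sparse_int`: nonzero integers
cost a factor `q` and decay geometrically, so the mass stays below `1 + 2q ≤ e^(2q)`. -/
theorem sum_netWeight_le {q : ℝ} (M : ℕ) :
    ∑ z ∈ Finset.Icc (-(M : ℤ)) M, (if z = 0 then 1 else q * (1 / 2 : ℝ) ^ z.natAbs) =
      1 + 2 * q * (1 - (1 / 2 : ℝ) ^ M) := by
  induction M with
  | zero => simp
  | succ M ih =>
    have h : Finset.Icc (-((M + 1 : ℕ) : ℤ)) ((M + 1 : ℕ) : ℤ) =
        insert ((M + 1 : ℕ) : ℤ) (insert (-((M + 1 : ℕ) : ℤ)) (Finset.Icc (-(M : ℤ)) M)) := by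
      ext z; simp only [Finset.mem_Icc, Finset.mem_insert]; push_cast; omega
    rw [h, Finset.sum_insert, Finset.sum_insert, ih, if_neg (by omega), if_neg (by omega),
      Int.natAbs_neg, Int.natAbs_natCast, pow_succ]
    · ring
    · simp
    · simp only [Finset.mem_Icc, Finset.mem_insert]; push_cast; omega

/-- Rounding towards zero rather than to the nearest integer keeps the norm, the size of the
coordinates and the support from growing, so rounded vectors stay in `sparseFlat`. -/
theorem exists_int_round_toward_zero (x : ℝ) :
    ∃ z : ℤ, (z : ℝ) ^ 2 ≤ x ^ 2 ∧ (x - z) ^ 2 ≤ 1 ∧ (x = 0 → z = 0) := by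
  rcases le_total 0 x with h | h
  · refine ⟨⌊x⌋, ?_, ?_, fun h => by simp [h]⟩
    · exact pow_le_pow_left₀ (by exact_mod_cast Int.floor_nonneg.2 h) (Int.floor_le x) 2
    · nlinarith [Int.floor_le x, Int.lt_floor_add_one x]
  · have h0 : ((⌈x⌉ : ℤ) : ℝ) ≤ 0 := by exact_mod_cast Int.ceil_le.2 (by simpa using h)
    refine ⟨⌈x⌉, ?_, ?_, fun h => by simp [h]⟩
    · nlinarith [Int.le_ceil x]
    · nlinarith [Int.le_ceil x, Int.ceil_lt_add_one x]

/-- Counting by a generating function: under the product weight each admissible vector has weight at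
least `q^k e^(-4k)`, while all vectors together have weight at most `(1 + 2q)^m`, where `m` is the
number of coordinates. The choice `q = k / m` makes the total at most `e^(2k)` and produces the
entropy `k log (m / k)`. -/
theorem card_le_of_sparse_int {ι : Type*} [Fintype ι] {k : ℝ} (hk : 0 < k)
    (hkm : k ≤ Fintype.card ι) (N : Finset (ι → ℤ))
    (hN : ∀ z ∈ N, ∑ i, (z i : ℝ) ^ 2 ≤ 4 * k ∧
      ((Finset.univ.filter fun i => z i ≠ 0).card : ℝ) ≤ k) :
    (N.card : ℝ) ≤ Real.exp (k * (6 + Real.log (Fintype.card ι / k))) := by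
  classical
  set m : ℝ := (Fintype.card ι : ℝ) with hm
  have hm0 : 0 < m := hk.trans_le hkm
  set q : ℝ := k / m with hq
  have hq0 : 0 < q := by positivity
  have hq1 : q ≤ 1 := (div_le_one hm0).2 hkm
  set wt : ℤ → ℝ := fun z => if z = 0 then 1 else q * (1 / 2 : ℝ) ^ z.natAbs with hwt
  have hwt0 : ∀ z, 0 ≤ wt z := fun z => by simp only [hwt]; split_ifs <;> positivity
  obtain ⟨M, hM⟩ : ∃ M : ℕ, 4 * k ≤ M := exists_nat_ge _
  have hnat : ∀ a : ℤ, ((a.natAbs : ℕ) : ℝ) ≤ (a : ℝ) ^ 2 := by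
    intro a
    have : ((a.natAbs : ℕ) : ℤ) ≤ a ^ 2 := by
      rw [← Int.natAbs_sq]
      exact_mod_cast Nat.le_self_pow two_ne_zero _
    rw [Nat.cast_natAbs]
    rw [Int.natCast_natAbs] at this
    exact_mod_cast this
  have hsub : N ⊆ Fintype.piFinset fun _ : ι => Finset.Icc (-(M : ℤ)) M := by
    intro z hz
    rw [Fintype.mem_piFinset]
    intro i
    have h1 : ((z i).natAbs : ℝ) ≤ M := (hnat _).trans
      ((Finset.single_le_sum (fun i _ => sq_nonneg (z i : ℝ)) (Finset.mem_univ i)).trans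
        ((hN z hz).1.trans hM))
    have h2 : (z i).natAbs ≤ M := by exact_mod_cast h1
    rw [Finset.mem_Icc]; omega
  have hlow : ∀ z ∈ N, q ^ k * Real.exp (-(4 * k)) ≤ ∏ i, wt (z i) := by
    intro z hz
    obtain ⟨h1, h2⟩ := hN z hz
    have h3 : ∏ i, wt (z i) = q ^ (Finset.univ.filter fun i => z i ≠ 0).card *
        ∏ i, (1 / 2 : ℝ) ^ (z i).natAbs := by
      rw [← Finset.prod_const, Finset.prod_filter, ← Finset.prod_mul_distrib]
      refine Finset.prod_congr rfl fun i _ => ?_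
      simp only [hwt]
      by_cases h : z i = 0 <;> simp [h]
    rw [h3]
    refine mul_le_mul ?_ ?_ (Real.exp_pos _).le (by positivity)
    · rw [← Real.rpow_natCast]
      exact Real.rpow_le_rpow_of_exponent_ge hq0 hq1 h2
    · calc Real.exp (-(4 * k)) ≤ Real.exp (∑ i, -((z i).natAbs : ℝ)) := by
            rw [Real.exp_le_exp, Finset.sum_neg_distrib]
            exact neg_le_neg ((Finset.sum_le_sum fun i _ => hnat _).trans h1)
        _ = ∏ i, Real.exp (-1) ^ (z i).natAbs := by
            rw [Real.exp_sum]
            refine Finset.prod_congr rfl fun i _ => ?_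
            rw [← Real.exp_nat_mul]; congr 1; ring
        _ ≤ _ := by
            refine Finset.prod_le_prod (fun i _ => by positivity) fun i _ => ?_
            refine pow_le_pow_left₀ (Real.exp_pos _).le ?_ _
            rw [Real.exp_neg, one_div]
            exact inv_anti₀ two_pos (by linarith [Real.add_one_le_exp (1 : ℝ)])
  have hsum : (N.card : ℝ) * (q ^ k * Real.exp (-(4 * k))) ≤ Real.exp (2 * k) := by
    calc (N.card : ℝ) * (q ^ k * Real.exp (-(4 * k)))
        ≤ ∑ z ∈ N, ∏ i, wt (z i) := by
          rw [← nsmul_eq_mul]; exact Finset.card_nsmul_le_sum _ _ _ hlow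
      _ ≤ ∑ z ∈ Fintype.piFinset fun _ : ι => Finset.Icc (-(M : ℤ)) M, ∏ i, wt (z i) :=
          Finset.sum_le_sum_of_subset_of_nonneg hsub fun z _ _ =>
            Finset.prod_nonneg fun i _ => hwt0 _
      _ = ∏ _i : ι, ∑ a ∈ Finset.Icc (-(M : ℤ)) M, wt a := (Finset.prod_univ_sum _ _).symm
      _ ≤ ∏ _i : ι, Real.exp (2 * q) := by
          refine Finset.prod_le_prod (fun i _ => Finset.sum_nonneg fun a _ => hwt0 a) fun i _ => ?_
          rw [sum_netWeight_le]
          have : (0 : ℝ) ≤ (1 / 2) ^ M := by positivity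
          nlinarith [Real.add_one_le_exp (2 * q)]
      _ = Real.exp (2 * k) := by
          rw [Finset.prod_const, Finset.card_univ, ← Real.exp_nat_mul, ← hm]
          congr 1; rw [hq]; field_simp
  have hqk : q ^ k = Real.exp (-(k * Real.log (m / k))) := by
    rw [Real.rpow_def_of_pos hq0, hq, ← inv_div m k, Real.log_inv]; congr 1; ring
  rw [hqk, ← Real.exp_add, ← le_div_iff₀ (Real.exp_pos _), ← Real.exp_sub] at hsum
  refine hsum.trans (Real.exp_le_exp.2 (le_of_eq ?_))
  ring

/-- The net is a grid of mesh `h = 1 / (2 √k)`. After rounding, twice the error has squared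
coordinates at most `4 h² = 1 / k` on at most `k` places, so it lies in the same set again. This
self-similarity is what allows successive approximation. -/
theorem exists_net_sparseFlat {ι : Type*} [Fintype ι] {k b : ℝ} (hk : 0 < k)
    (hkm : k ≤ Fintype.card ι) (hb : 1 / k ≤ b) :
    ∃ N : Finset (ι → ℝ), (∀ u ∈ N, u ∈ sparseFlat ι k b) ∧
      (N.card : ℝ) ≤ Real.exp (k * (6 + Real.log (Fintype.card ι / k))) ∧
      ∀ w ∈ sparseFlat ι k b, ∃ u ∈ N, (2 : ℝ) • (w - u) ∈ sparseFlat ι k b := by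
  classical
  obtain ⟨M, hM⟩ : ∃ M : ℕ, 4 * k ≤ M := exists_nat_ge _
  set h : ℝ := 1 / (2 * Real.sqrt k) with hh
  have hh0 : 0 < h := by have := Real.sqrt_pos.2 hk; positivity
  have hh2 : h ^ 2 = 1 / (4 * k) := by
    rw [hh, div_pow, mul_pow, Real.sq_sqrt hk.le]; norm_num
  set N₀ : Finset (ι → ℤ) := (Fintype.piFinset fun _ : ι => Finset.Icc (-(M : ℤ)) M).filter
    fun z => ∑ i, (z i : ℝ) ^ 2 ≤ 4 * k ∧ (∀ i, (h * z i) ^ 2 ≤ b) ∧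
      ((Finset.univ.filter fun i => z i ≠ 0).card : ℝ) ≤ k with hN₀
  refine ⟨N₀.image fun z i => h * z i, ?_, ?_, ?_⟩
  · intro u hu
    obtain ⟨z, hz, rfl⟩ := Finset.mem_image.1 hu
    obtain ⟨-, h1, h2, h3⟩ := Finset.mem_filter.1 hz
    refine ⟨?_, h2, ?_⟩
    · simp only [mul_pow]
      rw [← Finset.mul_sum, hh2, one_div_mul_eq_div, div_le_one (by positivity)]
      exact h1
    · simpa [hh0.ne'] using h3
  · refine le_trans (by exact_mod_cast Finset.card_image_le) (card_le_of_sparse_int hk hkm N₀ ?_)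
    intro z hz
    obtain ⟨-, h1, h2, h3⟩ := Finset.mem_filter.1 hz
    exact ⟨h1, h3⟩
  · rintro w ⟨hw1, hw2, hw3⟩
    choose z hz1 hz2 hz3 using fun i => exists_int_round_toward_zero (w i / h)
    have hzw : ∀ i, (h * z i) ^ 2 ≤ w i ^ 2 := fun i => by
      have := mul_le_mul_of_nonneg_left (hz1 i) (sq_nonneg h)
      rwa [← mul_pow, ← mul_pow, mul_div_cancel₀ _ hh0.ne'] at this
    have hz0 : ∀ i, w i = 0 → z i = 0 := fun i hi => hz3 i (by rw [hi, zero_div])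
    have hdiff : ∀ i, (2 * (w i - h * z i)) ^ 2 ≤ 1 / k := fun i => by
      have h1 : (2 * (w i - h * z i)) ^ 2 = 4 * h ^ 2 * (w i / h - z i) ^ 2 := by
        field_simp; ring
      rw [h1, hh2]
      have h2 : 4 * (1 / (4 * k)) = 1 / k := by field_simp
      rw [h2]
      exact mul_le_of_le_one_right (by positivity) (hz2 i)
    have hcard : ((Finset.univ.filter fun i => z i ≠ 0).card : ℝ) ≤ k := by
      refine le_trans ?_ hw3
      exact_mod_cast Finset.card_le_card fun i => by
        simpa using fun hi hwi => hi (hz0 i hwi)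
    have hsumz : ∑ i, (z i : ℝ) ^ 2 ≤ 4 * k := by
      have h1 : h ^ 2 * ∑ i, (z i : ℝ) ^ 2 ≤ 1 := by
        rw [Finset.mul_sum]
        refine le_trans (Finset.sum_le_sum fun i _ => ?_) hw1
        rw [← mul_pow]; exact hzw i
      rw [hh2, one_div_mul_eq_div, div_le_one (by positivity)] at h1
      exact h1
    refine ⟨fun i => h * z i, Finset.mem_image.2 ⟨z, ?_, rfl⟩, ?_, ?_, ?_⟩
    · refine Finset.mem_filter.2 ⟨Fintype.mem_piFinset.2 fun i => ?_, hsumz,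
        fun i => (hzw i).trans (hw2 i), hcard⟩
      have h1 : (z i : ℝ) ^ 2 ≤ M :=
        (Finset.single_le_sum (fun i _ => sq_nonneg (z i : ℝ)) (Finset.mem_univ i)).trans
          (hsumz.trans hM)
      have h2 : (z i) ^ 2 ≤ (M : ℤ) := by exact_mod_cast h1
      rw [Finset.mem_Icc]
      constructor <;> nlinarith
    · have h1 : ∀ i, ((2 : ℝ) • (w - fun i => h * (z i : ℝ))) i ^ 2 ≤
          if w i ≠ 0 then 1 / k else 0 := by
        intro i
        simp only [Pi.smul_apply, Pi.sub_apply, smul_eq_mul]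
        by_cases hi : w i = 0
        · simp [hi, hz0 i hi]
        · rw [if_pos hi]; exact hdiff i
      refine (Finset.sum_le_sum fun i _ => h1 i).trans ?_
      rw [← Finset.sum_filter, Finset.sum_const, nsmul_eq_mul, mul_one_div, div_le_one hk]
      exact hw3
    · exact fun i => (hdiff i).trans hb
    · refine le_trans ?_ hw3
      exact_mod_cast Finset.card_le_card fun i => by
        simp only [Finset.mem_filter, Finset.mem_univ, true_and, Pi.smul_apply, Pi.sub_apply]
        intro hi hwi
        exact hi (by simp [hwi, hz0 i hwi])

/-- A bound on the net gives twice the bound on the whole set. -/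
theorem norm_le_two_mul_of_net {ι E : Type*} [Fintype ι] [SeminormedAddCommGroup E]
    [NormedSpace ℝ E] {k b : ℝ} {N : Finset (ι → ℝ)}
    (hN : ∀ w ∈ sparseFlat ι k b, ∃ u ∈ N, (2 : ℝ) • (w - u) ∈ sparseFlat ι k b)
    (f : (ι → ℝ) →ₗ[ℝ] E) {M : ℝ} (hM : ∀ u ∈ N, ‖f u‖ ≤ M) :
    ∀ w ∈ sparseFlat ι k b, ‖f w‖ ≤ 2 * M := by
  classical
  set R : ℝ := ∑ i, ‖f (Pi.single i 1)‖ with hR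
  have hR0 : ∀ w ∈ sparseFlat ι k b, ‖f w‖ ≤ R := by
    rintro w ⟨hw, -, -⟩
    have h1 : w = ∑ i, w i • (Pi.single i 1 : ι → ℝ) := by
      ext j; simp [Finset.sum_apply, Pi.single_apply]
    rw [h1, map_sum]
    refine (norm_sum_le _ _).trans (Finset.sum_le_sum fun i _ => ?_)
    rw [map_smul, norm_smul]
    have h2 : w i ^ 2 ≤ 1 :=
      (Finset.single_le_sum (fun i _ => sq_nonneg (w i)) (Finset.mem_univ i)).trans hw
    exact mul_le_of_le_one_left (norm_nonneg _) (by rwa [Real.norm_eq_abs, ← sq_le_one_iff_abs_le_one])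
  -- Writing `w = u + w' / 2` with `u` in the net and `w'` in the same set halves the excess over `2
  -- M` at each step, starting from the crude bound `R`.
  have key : ∀ n : ℕ, ∀ w ∈ sparseFlat ι k b, ‖f w‖ ≤ 2 * M + R / 2 ^ n - 2 * M / 2 ^ n := by
    intro n
    induction n with
    | zero => intro w hw; simpa using hR0 w hw
    | succ n ih =>
      intro w hw
      obtain ⟨u, hu, hwu⟩ := hN w hw
      have h1 : f w = f u + (1 / 2 : ℝ) • f ((2 : ℝ) • (w - u)) := by
        rw [← map_smul, ← map_add, smul_smul]; norm_num
      rw [h1]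
      refine (norm_add_le _ _).trans ?_
      rw [norm_smul]
      have h2 := ih _ hwu
      have h3 := hM u hu
      rw [pow_succ]
      have h4 : ‖(1 / 2 : ℝ)‖ = 1 / 2 := by norm_num
      rw [h4]
      have e1 : R / (2 ^ n * 2) = R / 2 ^ n / 2 := by field_simp
      have e2 : 2 * M / (2 ^ n * 2) = 2 * M / 2 ^ n / 2 := by field_simp
      rw [e1, e2]
      linarith
  intro w hw
  have hlim : Filter.Tendsto (fun n : ℕ => 2 * M + R / 2 ^ n - 2 * M / 2 ^ n) Filter.atTop
      (nhds (2 * M + 0 - 0)) := by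
    have h0 : ∀ a : ℝ, Filter.Tendsto (fun n : ℕ => a / (2 : ℝ) ^ n) Filter.atTop (nhds 0) :=
      fun a => (tendsto_pow_atTop_atTop_of_one_lt one_lt_two).const_div_atTop a
    exact (tendsto_const_nhds.add (h0 R)).sub (h0 _)
  have := ge_of_tendsto' hlim fun n => key n w hw
  simpa using this

end PrunedNet

namespace PrunedNet

/-! ### Masked Gaussian matrices -/

/-- A Boolean as the real number `0` or `1`. -/
noncomputable def bit (b : Bool) : ℝ := if b then 1 else 0

theorem bit_nonneg (b : Bool) : 0 ≤ bit b := by cases b <;> simp [bit]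

theorem bit_le_one (b : Bool) : bit b ≤ 1 := by cases b <;> simp [bit]

theorem bit_sq (b : Bool) : bit b ^ 2 = bit b := by cases b <;> simp [bit]

theorem lintegral_bool (ν : Measure Bool) [IsProbabilityMeasure ν] {F : Bool → ℝ}
    (hF : ∀ y, 0 ≤ F y) :
    ∫⁻ y, ENNReal.ofReal (F y) ∂ν =
      ENNReal.ofReal (ν.real {true} * F true + (1 - ν.real {true}) * F false) := by
  have h1 : ν.real {false} = 1 - ν.real {true} := by
    rw [← probReal_compl_eq_one_sub (measurableSet_singleton _)]
    congr 1; ext b; cases b <;> simp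
  have h2 : ν.real {true} ≤ 1 := measureReal_le_one
  rw [lintegral_fintype, Fintype.sum_bool, ← h1, ENNReal.ofReal_add
    (mul_nonneg measureReal_nonneg (hF _)) (mul_nonneg measureReal_nonneg (hF _)),
    mul_comm, mul_comm (ENNReal.ofReal (F false)), ENNReal.ofReal_mul measureReal_nonneg,
    ENNReal.ofReal_mul measureReal_nonneg, ofReal_measureReal, ofReal_measureReal]

theorem lintegral_exp_mul_bit_le (ν : Measure Bool) [IsProbabilityMeasure ν] {p a : ℝ}
    (hp : ν.real {true} ≤ p) (ha : 0 ≤ a) :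
    ∫⁻ y, ENNReal.ofReal (Real.exp (a * bit y)) ∂ν ≤
      ENNReal.ofReal (Real.exp (p * (Real.exp a - 1))) := by
  rw [lintegral_bool ν fun y => (Real.exp_pos _).le]
  refine ENNReal.ofReal_le_ofReal ?_
  simp only [bit, if_true, mul_one, Bool.false_eq_true, if_false, mul_zero, Real.exp_zero]
  have h1 := Real.add_one_le_exp (p * (Real.exp a - 1))
  have h2 : 0 ≤ Real.exp a - 1 := by linarith [Real.add_one_le_exp a]
  nlinarith [mul_le_mul_of_nonneg_right hp h2]

variable {ι κ : Type*} [Fintype ι] [Fintype κ]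

/-- A random mask with independent entries of laws `ν`, and an independent standard Gaussian
matrix. -/
noncomputable def maskGauss (ν : ι × κ → Measure Bool) : Measure ((ι × κ → Bool) × (ι × κ → ℝ)) :=
  (Measure.pi ν).prod (Measure.pi fun _ => gaussianReal 0 1)

instance (ν : ι × κ → Measure Bool) [∀ t, IsProbabilityMeasure (ν t)] :
    IsProbabilityMeasure (maskGauss ν) := by unfold maskGauss; infer_instance

/-- Number of entries of the mask in a column. -/
noncomputable def colDeg (b : ι × κ → Bool) (j : κ) : ℝ := ∑ i, bit (b (i, j))

/-- The masked Gaussian matrix, restricted to the columns satisfying `P`. -/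
noncomputable def maskedOn (P : κ → Prop) [DecidablePred P] (b : ι × κ → Bool) (g : ι × κ → ℝ) :
    Matrix ι κ ℝ :=
  Matrix.of fun i j => if P j then bit (b (i, j)) * g (i, j) else 0

/-- Row vectors times a matrix, with values in Euclidean space. -/
noncomputable def rowMul (X : Matrix ι κ ℝ) : (ι → ℝ) →ₗ[ℝ] EuclideanSpace ℝ κ :=
  (WithLp.linearEquiv 2 ℝ (κ → ℝ)).symm.toLinearMap ∘ₗ Matrix.vecMulLinear X

theorem norm_rowMul_sq (X : Matrix ι κ ℝ) (w : ι → ℝ) :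
    ‖rowMul X w‖ ^ 2 = ∑ j, (∑ i, X i j * w i) ^ 2 := by
  rw [EuclideanSpace.real_norm_sq_eq]
  refine Finset.sum_congr rfl fun j _ => ?_
  congr 1
  simp [rowMul, Matrix.vecMul, dotProduct, mul_comm]

theorem rowMul_add {ι κ : Type*} [Fintype ι] (X Y : Matrix ι κ ℝ) (w : ι → ℝ) :
    rowMul (X + Y) w = rowMul X w + rowMul Y w := by
  simp [rowMul]

/-- There are only finitely many masks, so measurability may be checked with the mask fixed. -/
theorem measurable_maskGauss {β : Type*} [MeasurableSpace β]
    {f : (ι × κ → Bool) × (ι × κ → ℝ) → β} (hf : ∀ b, Measurable fun g => f (b, g)) :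
    Measurable f :=
  measurable_from_prod_countable_right hf

open Classical in
/-- The columns of the masked Gaussian matrix with at most `D` entries of the mask. -/
noncomputable def lightPart (D : ℝ) (b : ι × κ → Bool) (g : ι × κ → ℝ) : Matrix ι κ ℝ :=
  maskedOn (fun j => colDeg b j ≤ D) b g

open Classical in
/-- The columns of the masked Gaussian matrix with more than `D` entries of the mask. -/
noncomputable def heavyPart (D : ℝ) (b : ι × κ → Bool) (g : ι × κ → ℝ) : Matrix ι κ ℝ :=
  maskedOn (fun j => ¬ colDeg b j ≤ D) b g

theorem measurable_norm_rowMul_lightPart (D : ℝ) (u : ι → ℝ) :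
    Measurable fun z : (ι × κ → Bool) × (ι × κ → ℝ) =>
      ‖rowMul (lightPart D z.1 z.2) u‖ ^ 2 := by
  refine measurable_maskGauss fun b => ?_
  simp only [norm_rowMul_sq, lightPart, maskedOn, Matrix.of_apply, ite_mul, zero_mul]
  refine Finset.measurable_sum _ fun j _ => Measurable.pow_const
    (Finset.measurable_sum _ fun i _ => ?_) 2
  split_ifs <;> fun_prop

/-- Given the mask, the coordinates of the image of `u` are independent Gaussians of variance at
most `s`, which makes `1 / (4 s)` an admissible parameter in `lintegral_exp_sum_sq_gaussian`. The
conditional bound is the exponential of a linear function of the mask, and so factorizes over its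
independent entries. -/
theorem lintegral_exp_lightPart_le (ν : ι × κ → Measure Bool) [∀ t, IsProbabilityMeasure (ν t)]
    {p D s : ℝ} (hp0 : 0 ≤ p) (hp : ∀ t, (ν t).real {true} ≤ p) (hs : 0 < s) {u : ι → ℝ}
    (hu : ∑ i, u i ^ 2 ≤ 1) (hus : ∀ i, u i ^ 2 ≤ s)
    (hD : ∀ (b : ι × κ → Bool) j, colDeg b j ≤ D → ∑ i, bit (b (i, j)) * u i ^ 2 ≤ s) :
    ∫⁻ z, ENNReal.ofReal (Real.exp (1 / (4 * s) * ‖rowMul (lightPart D z.1 z.2) u‖ ^ 2))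
        ∂maskGauss ν ≤
      ENNReal.ofReal (Real.exp (1 / s * (p * Fintype.card κ))) := by
  classical
  have hmeas : Measurable fun z : (ι × κ → Bool) × (ι × κ → ℝ) =>
      ENNReal.ofReal (Real.exp (1 / (4 * s) * ‖rowMul (lightPart D z.1 z.2) u‖ ^ 2)) :=
    ENNReal.measurable_ofReal.comp
      (Real.measurable_exp.comp ((measurable_norm_rowMul_lightPart D u).const_mul _))
  rw [maskGauss, lintegral_prod _ hmeas.aemeasurable]
  have hinner : ∀ b : ι × κ → Bool,
      ∫⁻ g, ENNReal.ofReal (Real.exp (1 / (4 * s) * ‖rowMul (lightPart D b g) u‖ ^ 2))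
        ∂Measure.pi (fun _ : ι × κ => gaussianReal 0 1) ≤
      ∏ t : ι × κ, ENNReal.ofReal (Real.exp ((1 / (2 * s) * u t.1 ^ 2) * bit (b t))) := by
    intro b
    set c : ι → κ → ℝ := fun i j => if colDeg b j ≤ D then bit (b (i, j)) * u i else 0 with hc
    have h1 : ∀ g, ‖rowMul (lightPart D b g) u‖ ^ 2 = ∑ j, (∑ i, c i j * g (i, j)) ^ 2 := by
      intro g
      rw [norm_rowMul_sq]
      refine Finset.sum_congr rfl fun j _ => ?_
      congr 1
      refine Finset.sum_congr rfl fun i _ => ?_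
      simp only [lightPart, maskedOn, Matrix.of_apply, hc]
      split_ifs <;> ring
    have hc2 : ∀ i j, c i j ^ 2 ≤ bit (b (i, j)) * u i ^ 2 := by
      intro i j
      simp only [hc]
      split_ifs
      · rw [mul_pow, bit_sq]
      · simpa using mul_nonneg (bit_nonneg _) (sq_nonneg _)
    simp_rw [h1]
    refine (lintegral_exp_sum_sq_gaussian c (by positivity) fun j => ?_).trans ?_
    · have h2 : ∑ i, c i j ^ 2 ≤ s := by
        by_cases hj : colDeg b j ≤ D
        · exact (Finset.sum_le_sum fun i _ => hc2 i j).trans (hD b j hj)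
        · simp only [hc, if_neg hj]; simpa using hs.le
      calc 1 / (4 * s) * ∑ i, c i j ^ 2 ≤ 1 / (4 * s) * s :=
            mul_le_mul_of_nonneg_left h2 (by positivity)
        _ = 1 / 4 := by field_simp
    · rw [← ENNReal.ofReal_prod_of_nonneg (fun t _ => (Real.exp_pos _).le), ← Real.exp_sum]
      refine ENNReal.ofReal_le_ofReal (Real.exp_le_exp.2 ?_)
      rw [Fintype.sum_prod_type_right, Finset.mul_sum]
      refine Finset.sum_le_sum fun j _ => ?_
      rw [Finset.mul_sum]
      refine Finset.sum_le_sum fun i _ => ?_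
      have h3 : 2 * (1 / (4 * s)) = 1 / (2 * s) := by field_simp; norm_num
      rw [h3]
      calc 1 / (2 * s) * c i j ^ 2 ≤ 1 / (2 * s) * (bit (b (i, j)) * u i ^ 2) :=
            mul_le_mul_of_nonneg_left (hc2 i j) (by positivity)
        _ = _ := by ring
  refine (lintegral_mono hinner).trans ?_
  rw [lintegral_pi_prod ν
    (fun t y => ENNReal.ofReal (Real.exp ((1 / (2 * s) * u t.1 ^ 2) * bit y)))
    (fun t => measurable_of_finite _)]
  calc _ ≤ ∏ t : ι × κ, ENNReal.ofReal (Real.exp (p * (1 / s * u t.1 ^ 2))) := by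
        refine Finset.prod_le_prod' fun t _ => ?_
        refine (lintegral_exp_mul_bit_le (ν t) (hp t) (by positivity)).trans ?_
        refine ENNReal.ofReal_le_ofReal (Real.exp_le_exp.2 (mul_le_mul_of_nonneg_left ?_ hp0))
        -- Since `u i ^ 2 ≤ s`, the exponent `a` is at most `1/2`, where `e^a - 1 ≤ 2a`.
        set a : ℝ := 1 / (2 * s) * u t.1 ^ 2 with ha
        have ha0 : 0 ≤ a := by positivity
        have ha1 : a ≤ 1 / 2 := by
          calc a ≤ 1 / (2 * s) * s := mul_le_mul_of_nonneg_left (hus _) (by positivity)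
            _ = 1 / 2 := by field_simp
        have ha2 : 1 / s * u t.1 ^ 2 = 2 * a := by rw [ha]; field_simp
        rw [ha2]
        have := Real.abs_exp_sub_one_le (x := a) (by rw [abs_of_nonneg ha0]; linarith)
        rw [abs_of_nonneg ha0] at this
        exact (le_abs_self _).trans this
    _ ≤ _ := by
        rw [← ENNReal.ofReal_prod_of_nonneg (fun t _ => (Real.exp_pos _).le), ← Real.exp_sum]
        refine ENNReal.ofReal_le_ofReal (Real.exp_le_exp.2 ?_)
        rw [Fintype.sum_prod_type_right]
        simp only [← Finset.mul_sum, Finset.sum_const, Finset.card_univ, nsmul_eq_mul]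
        calc _ = (1 / s * (p * Fintype.card κ)) * ∑ i, u i ^ 2 := by ring
          _ ≤ _ := mul_le_of_le_one_right (by positivity) hu

/-- Uniform bound for the light columns on sparse flat vectors. -/
theorem measure_lightPart_sparseFlat_le (ν : ι × κ → Measure Bool)
    [∀ t, IsProbabilityMeasure (ν t)] {p D k b : ℝ} {y : ℝ} (hy : 0 ≤ y) (hp0 : 0 ≤ p)
    (hp : ∀ t, (ν t).real {true} ≤ p) (hD : 1 ≤ D) (hk : 0 < k) (hkm : k ≤ Fintype.card ι)
    (hb : 1 / k ≤ b) :
    (maskGauss ν).real {z | ¬ ∀ w ∈ sparseFlat ι k b, ‖rowMul (lightPart D z.1 z.2) w‖ ≤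
      2 * Real.sqrt (4 * (p * Fintype.card κ) + 4 * (min 1 (D * b) *
        (k * (6 + Real.log (Fintype.card ι / k)))) + 4 * y)} ≤ Real.exp (-y) := by
  obtain ⟨N, hN1, hN2, hN3⟩ := exists_net_sparseFlat hk hkm hb
  -- Two bounds for the variance in a light column: `1` from the norm of the vector, and `D * b`
  -- from at most `D` coordinates of square at most `b`. `V` is the entropy of the net, and `t` is
  -- chosen so that the tail at one net point gains the factor `e^(-V)` lost in the union bound.
  set s : ℝ := min 1 (D * b) with hs
  set V : ℝ := k * (6 + Real.log (Fintype.card ι / k)) with hV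
  set t : ℝ := 4 * (p * Fintype.card κ) + 4 * (s * V) + 4 * y with ht
  have hb0 : 0 < b := (by positivity : 0 < 1 / k).trans_le hb
  have hs0 : 0 < s := lt_min one_pos (by positivity)
  have hs1 : s ≤ 1 := min_le_left _ _
  have hfix : ∀ u ∈ N, (maskGauss ν) {z | t ≤ ‖rowMul (lightPart D z.1 z.2) u‖ ^ 2} ≤
      ENNReal.ofReal (Real.exp (-V - y)) := by
    intro u hu
    obtain ⟨hu1, hu2, -⟩ := hN1 u hu
    have hui : ∀ i, u i ^ 2 ≤ 1 := fun i =>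
      (Finset.single_le_sum (fun i _ => sq_nonneg (u i)) (Finset.mem_univ i)).trans hu1
    have hus : ∀ i, u i ^ 2 ≤ s := fun i => le_min (hui i) ((hu2 i).trans
      (le_mul_of_one_le_left hb0.le hD))
    have hI := lintegral_exp_lightPart_le ν hp0 hp hs0 (D := D) hu1 hus fun c j hj => by
      refine le_min ?_ ?_
      · exact (Finset.sum_le_sum fun i _ => mul_le_of_le_one_left (sq_nonneg _)
          (bit_le_one _)).trans hu1
      · calc ∑ i, bit (c (i, j)) * u i ^ 2 ≤ ∑ i, bit (c (i, j)) * b :=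
              Finset.sum_le_sum fun i _ => mul_le_mul_of_nonneg_left (hu2 i) (bit_nonneg _)
          _ = colDeg c j * b := by rw [colDeg, Finset.sum_mul]
          _ ≤ D * b := mul_le_mul_of_nonneg_right hj hb0.le
    have hM := mul_meas_ge_le_lintegral₀ (μ := maskGauss ν)
      (f := fun z => ENNReal.ofReal (Real.exp (1 / (4 * s) *
        ‖rowMul (lightPart D z.1 z.2) u‖ ^ 2)))
      (ENNReal.measurable_ofReal.comp (Real.measurable_exp.comp
        ((measurable_norm_rowMul_lightPart D u).const_mul _))).aemeasurable
      (ENNReal.ofReal (Real.exp (1 / (4 * s) * t)))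
    have hsub : {z : (ι × κ → Bool) × (ι × κ → ℝ) | t ≤ ‖rowMul (lightPart D z.1 z.2) u‖ ^ 2} ⊆
        {z | ENNReal.ofReal (Real.exp (1 / (4 * s) * t)) ≤ ENNReal.ofReal (Real.exp (1 / (4 * s) *
        ‖rowMul (lightPart D z.1 z.2) u‖ ^ 2))} := fun z hz =>
      ENNReal.ofReal_le_ofReal (Real.exp_le_exp.2 (mul_le_mul_of_nonneg_left hz (by positivity)))
    refine (measure_mono hsub).trans ?_
    have h1 := hM.trans hI
    rw [mul_comm, ← ENNReal.le_div_iff_mul_le (Or.inl (by simp [Real.exp_pos])) (Or.inl (by simp)),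
      ← ENNReal.ofReal_div_of_pos (Real.exp_pos _), ← Real.exp_sub] at h1
    refine h1.trans (ENNReal.ofReal_le_ofReal (Real.exp_le_exp.2 ?_))
    have h2 : 1 / (4 * s) * t = 1 / s * (p * Fintype.card κ) + V + y / s := by
      rw [ht]; field_simp
    have h3 : y ≤ y / s := le_div_self hy hs0 hs1
    rw [h2]; linarith
  have hcover : {z : (ι × κ → Bool) × (ι × κ → ℝ) | ¬ ∀ w ∈ sparseFlat ι k b, ‖rowMul (lightPart D z.1 z.2) w‖ ≤
      2 * Real.sqrt t} ⊆ ⋃ u ∈ N, {z | t ≤ ‖rowMul (lightPart D z.1 z.2) u‖ ^ 2} := by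
    intro z hz
    by_contra hcon
    simp only [Set.mem_iUnion, Set.mem_ofPred_eq, not_exists, not_le] at hcon
    exact hz (norm_le_two_mul_of_net hN3 (rowMul (lightPart D z.1 z.2)) fun u hu =>
      Real.le_sqrt_of_sq_le (hcon u hu).le)
  refine ENNReal.toReal_le_of_le_ofReal (Real.exp_pos _).le ?_
  calc _ ≤ ∑ u ∈ N, (maskGauss ν) {z | t ≤ ‖rowMul (lightPart D z.1 z.2) u‖ ^ 2} :=
        (measure_mono hcover).trans (measure_biUnion_finset_le _ _)
    _ ≤ N.card • ENNReal.ofReal (Real.exp (-V - y)) := Finset.sum_le_card_nsmul _ _ _ hfix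
    _ = ENNReal.ofReal (N.card * Real.exp (-V - y)) := by
        rw [nsmul_eq_mul, ENNReal.ofReal_mul (by positivity), ENNReal.ofReal_natCast]
    _ ≤ _ := by
        refine ENNReal.ofReal_le_ofReal ?_
        calc _ ≤ Real.exp V * Real.exp (-V - y) :=
              mul_le_mul_of_nonneg_right hN2 (Real.exp_pos _).le
          _ = _ := by rw [← Real.exp_add]; congr 1; ring

end PrunedNet

/-! ### Large, medium and small coordinates: the norm on light columns -/

namespace PrunedNet

variable {ι κ : Type*} [Fintype ι] [Fintype κ]

/-- Restricting a vector of the unit ball to coordinates of square above `1 / k` leaves at most `k`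
nonzero coordinates. -/
theorem restrict_mem_sparseFlat {w : ι → ℝ} (hw : ∑ i, w i ^ 2 ≤ 1) {k b : ℝ} (hk : 0 < k)
    (hb : 0 ≤ b) (P : ι → Prop) [DecidablePred P] (hP : ∀ i, P i → 1 / k ≤ w i ^ 2)
    (hPb : ∀ i, P i → w i ^ 2 ≤ b) : (fun i => if P i then w i else 0) ∈ sparseFlat ι k b := by
  have hle : ∀ i, (if P i then w i else 0) ^ 2 ≤ w i ^ 2 := fun i => by
    split_ifs
    · exact le_rfl
    · simpa using sq_nonneg (w i)
  refine ⟨(Finset.sum_le_sum fun i _ => hle i).trans hw, fun i => ?_, ?_⟩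
  · dsimp only
    split_ifs with h
    · exact hPb i h
    · simpa using hb
  · have h1 : ((Finset.univ.filter fun i => (if P i then w i else 0) ≠ 0).card : ℝ) * (1 / k) ≤
        ∑ i ∈ Finset.univ.filter fun i => (if P i then w i else 0) ≠ 0, w i ^ 2 := by
      rw [← nsmul_eq_mul]
      refine Finset.card_nsmul_le_sum _ _ _ fun i hi => ?_
      simp only [Finset.mem_filter, Finset.mem_univ, true_and, ne_eq, ite_eq_right_iff,
        Classical.not_imp] at hi
      exact hP i hi.1
    have h2 := h1.trans ((Finset.sum_le_univ_sum_of_nonneg fun i => sq_nonneg (w i)).trans hw)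
    rwa [mul_one_div, div_le_one hk] at h2

/-- Coordinates are sorted by their squares at the levels `1 / k₁` and `1 / k₂`. The bound `max 1 (1
/ k₁)` for the first part, instead of `1`, serves only to meet the requirement `1 / k ≤ b` of the
net. -/
theorem exists_decomposition_sparseFlat {w : ι → ℝ} (hw : ∑ i, w i ^ 2 ≤ 1) {k₁ k₂ : ℝ}
    (hk₁ : 0 < k₁) (hk : k₁ ≤ k₂) :
    ∃ w₁ ∈ sparseFlat ι k₁ (max 1 (1 / k₁)), ∃ w₂ ∈ sparseFlat ι k₂ (1 / k₁),
      ∃ w₃ ∈ sparseFlat ι (Fintype.card ι) (1 / k₂), w = w₁ + w₂ + w₃ := by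
  classical
  have hk₂ : 0 < k₂ := hk₁.trans_le hk
  refine ⟨_, restrict_mem_sparseFlat hw hk₁ (by positivity) (fun i => 1 / k₁ < w i ^ 2)
    (fun i hi => hi.le) fun i _ => ?_, _, restrict_mem_sparseFlat hw hk₂ (by positivity)
    (fun i => 1 / k₂ < w i ^ 2 ∧ w i ^ 2 ≤ 1 / k₁) (fun i hi => hi.1.le) (fun i hi => hi.2),
    fun i => if w i ^ 2 ≤ 1 / k₂ then w i else 0, ⟨?_, fun i => ?_, ?_⟩, ?_⟩
  · exact le_max_of_le_left
      ((Finset.single_le_sum (fun i _ => sq_nonneg (w i)) (Finset.mem_univ i)).trans hw)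
  · refine (Finset.sum_le_sum fun i _ => ?_).trans hw
    dsimp only
    split_ifs
    · exact le_rfl
    · simpa using sq_nonneg (w i)
  · dsimp only
    split_ifs with h
    · exact h
    · simp [hk₂.le]
  · exact_mod_cast Finset.card_le_univ _
  · have h12 : 1 / k₂ ≤ 1 / k₁ := one_div_le_one_div_of_le hk₁ hk
    ext i
    simp only [Pi.add_apply]
    by_cases h1 : 1 / k₁ < w i ^ 2
    · rw [if_pos h1, if_neg fun h => h1.not_ge h.2, if_neg (h12.trans_lt h1).not_ge]
      ring
    · by_cases h2 : 1 / k₂ < w i ^ 2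
      · rw [if_neg h1, if_pos ⟨h2, not_lt.1 h1⟩, if_neg h2.not_ge]
        ring
      · rw [if_neg h1, if_neg fun h => h2 h.1, if_pos (not_lt.1 h2)]
        ring

theorem log_inv_pow_le {r : ℝ} (hr : 0 < r) (a : ℕ) :
    Real.log (1 / r ^ a) ≤ a * (1 / r - 1) := by
  rw [one_div, ← inv_pow, Real.log_pow, one_div]
  exact mul_le_mul_of_nonneg_left (Real.log_le_sub_one_of_pos (inv_pos.2 hr)) (by positivity)

/-- Entropy times variance must be `O(Q)` in each range of coordinates. With `r² = p n / Q`,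
sparsity `r³ m` has entropy `O(r² m)`, which is `O(Q)` with the trivial variance `1`. At sparsity
`r² m` the entropy is `O(r m)`, and coordinates of square at most `1 / (r³ m)` give variance `D /
(r³ m)`. Full vectors have entropy `6 m` and variance `D / (r² m)`. As `D = 7 r² Q`, both products
are again `O(Q)`. -/
theorem measure_lightPart_le (ν : ι × κ → Measure Bool) [∀ t, IsProbabilityMeasure (ν t)]
    {p Q r y : ℝ} (hy : 0 ≤ y) (hp0 : 0 ≤ p) (hp : ∀ t, (ν t).real {true} ≤ p) (hQ : 0 < Q)
    (hm : 0 < Fintype.card ι) (hr : 0 < r) (hr1 : r ≤ 1)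
    (hrQ : r ^ 2 * Q = p * Fintype.card κ) (hrm : r ^ 2 * Fintype.card ι ≤ Q)
    (hD : 1 ≤ 7 * (p * Fintype.card κ)) :
    (maskGauss ν).real {z | ¬ ∀ w : ι → ℝ, ∑ i, w i ^ 2 ≤ 1 →
      ‖rowMul (lightPart (7 * (p * Fintype.card κ)) z.1 z.2) w‖ ≤
        6 * Real.sqrt (172 * Q + 4 * y)} ≤ 3 * Real.exp (-y) := by
  set m : ℝ := (Fintype.card ι : ℝ) with hmdef
  have hm0 : 0 < m := Nat.cast_pos.2 hm
  set D : ℝ := 7 * (p * Fintype.card κ) with hDdef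
  have hDQ : D = 7 * (r ^ 2 * Q) := by rw [hDdef, hrQ]
  have hpn : p * Fintype.card κ ≤ Q := by
    rw [← hrQ]; exact mul_le_of_le_one_left hQ.le (pow_le_one₀ hr.le hr1)
  have hk1 : r ^ 3 * m ≤ r ^ 2 * m :=
    mul_le_mul_of_nonneg_right (pow_le_pow_of_le_one hr.le hr1 (by norm_num)) hm0.le
  have hk2 : r ^ 2 * m ≤ m := mul_le_of_le_one_left hm0.le (pow_le_one₀ hr.le hr1)
  have H1 := measure_lightPart_sparseFlat_le ν (k := r ^ 3 * m) (b := max 1 (1 / (r ^ 3 * m)))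
    hy hp0 hp hD (by positivity) (hk1.trans hk2) (le_max_right _ _)
  have H2 := measure_lightPart_sparseFlat_le ν (k := r ^ 2 * m) (b := 1 / (r ^ 3 * m))
    hy hp0 hp hD (by positivity) hk2 (one_div_le_one_div_of_le (by positivity) hk1)
  have H3 := measure_lightPart_sparseFlat_le ν (k := m) (b := 1 / (r ^ 2 * m))
    hy hp0 hp hD hm0 le_rfl (one_div_le_one_div_of_le (by positivity) hk2)
  have hl : ∀ a : ℕ, m / (r ^ a * m) = 1 / r ^ a := fun a => by field_simp
  rw [← hmdef] at H1 H2 H3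
  rw [hl] at H1 H2
  have B1 : min 1 (D * max 1 (1 / (r ^ 3 * m))) * (r ^ 3 * m * (6 + Real.log (1 / r ^ 3))) ≤
      42 * Q := by
    have h0 : 0 ≤ Real.log (1 / r ^ 3) :=
      Real.log_nonneg ((one_le_div (by positivity)).2 (pow_le_one₀ hr.le hr1))
    have h1 := log_inv_pow_le hr 3
    calc _ ≤ 1 * (r ^ 3 * m * (6 + Real.log (1 / r ^ 3))) :=
          mul_le_mul_of_nonneg_right (min_le_left _ _) (by positivity)
      _ ≤ 1 * (r ^ 3 * m * (6 + (3 : ℕ) * (1 / r - 1))) := by gcongr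
      _ = (3 * r + 3) * (r ^ 2 * m) := by push_cast; field_simp; ring
      _ ≤ 6 * Q := by
          refine mul_le_mul (by linarith) hrm (by positivity) (by norm_num)
      _ ≤ 42 * Q := by linarith
  have B2 : min 1 (D * (1 / (r ^ 3 * m))) * (r ^ 2 * m * (6 + Real.log (1 / r ^ 2))) ≤
      42 * Q := by
    have h0 : 0 ≤ Real.log (1 / r ^ 2) :=
      Real.log_nonneg ((one_le_div (by positivity)).2 (pow_le_one₀ hr.le hr1))
    have h1 := log_inv_pow_le hr 2
    calc _ ≤ D * (1 / (r ^ 3 * m)) * (r ^ 2 * m * (6 + Real.log (1 / r ^ 2))) :=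
          mul_le_mul_of_nonneg_right (min_le_right _ _) (by positivity)
      _ ≤ D * (1 / (r ^ 3 * m)) * (r ^ 2 * m * (6 + (2 : ℕ) * (1 / r - 1))) := by
          have : 0 ≤ D := by linarith
          gcongr
      _ = 7 * Q * (4 * r + 2) := by rw [hDQ]; push_cast; field_simp; ring
      _ ≤ 7 * Q * 6 := mul_le_mul_of_nonneg_left (by linarith) (by positivity)
      _ = 42 * Q := by ring
  have B3 : min 1 (D * (1 / (r ^ 2 * m))) * (m * (6 + Real.log (m / m))) ≤ 42 * Q := by
    rw [div_self hm0.ne', Real.log_one, add_zero]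
    calc _ ≤ D * (1 / (r ^ 2 * m)) * (m * 6) :=
          mul_le_mul_of_nonneg_right (min_le_right _ _) (by positivity)
      _ = 42 * Q := by rw [hDQ]; field_simp; ring
  -- `172 = 4 + 4 * 42`, using `p n ≤ Q`. Three pieces, each with the factor `2` of its net, give
  -- the constant `6`.
  have hmono : ∀ {V : ℝ}, V ≤ 42 * Q → 2 * Real.sqrt (4 * (p * Fintype.card κ) + 4 * V + 4 * y) ≤
      2 * Real.sqrt (172 * Q + 4 * y) := fun {V} hV => by
    refine mul_le_mul_of_nonneg_left (Real.sqrt_le_sqrt ?_) two_pos.le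
    linarith
  refine le_trans (measureReal_mono ?_) (le_trans (measureReal_union_le _ _)
    (le_trans (add_le_add_left (measureReal_union_le _ _) _)
      (le_trans (add_le_add (add_le_add H1 H2) H3) (le_of_eq (by ring)))))
  intro z hz
  by_contra hcon
  simp only [Set.mem_union, Set.mem_ofPred_eq, not_or, not_not] at hcon
  obtain ⟨⟨h1, h2⟩, h3⟩ := hcon
  refine hz fun w hw => ?_
  obtain ⟨w₁, hw₁, w₂, hw₂, w₃, hw₃, rfl⟩ :=
    exists_decomposition_sparseFlat hw (k₁ := r ^ 3 * m) (by positivity) hk1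
  rw [map_add, map_add]
  have e1 := (h1 _ hw₁).trans (hmono B1)
  have e2 := (h2 _ hw₂).trans (hmono B2)
  have e3 := (h3 _ hw₃).trans (hmono B3)
  calc _ ≤ _ := norm_add₃_le
    _ ≤ _ := by linarith

end PrunedNet

namespace PrunedNet

/-! ### Second moments -/

theorem integral_sq_sum_pi {T : Type*} [Fintype T] {E : T → Type*} [∀ t, MeasurableSpace (E t)]
    (ν : ∀ t, Measure (E t)) [∀ t, IsProbabilityMeasure (ν t)] (f : ∀ t, E t → ℝ)
    (hf : ∀ t, MemLp (f t) 2 (ν t)) (h0 : ∀ t, ∫ x, f t x ∂ν t = 0) :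
    Integrable (fun x => (∑ t, f t (x t)) ^ 2) (Measure.pi ν) ∧
      ∫ x, (∑ t, f t (x t)) ^ 2 ∂Measure.pi ν = ∑ t, ∫ x, f t x ^ 2 ∂ν t := by
  have hm : ∀ t, MemLp (fun x : ∀ t, E t => f t (x t)) 2 (Measure.pi ν) := fun t =>
    (hf t).comp_measurePreserving (measurePreserving_eval ν t)
  have hs : MemLp (fun x : ∀ t, E t => ∑ t, f t (x t)) 2 (Measure.pi ν) :=
    memLp_finsetSum _ fun t _ => hm t
  refine ⟨hs.integrable_sq, ?_⟩
  have h1 : ∀ t, ∫ x, f t (x t) ∂Measure.pi ν = 0 := fun t => by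
    rw [← h0 t, integral_comp_eval (hf t).aestronglyMeasurable]
  have h2 : ∫ x, ∑ t, f t (x t) ∂Measure.pi ν = 0 := by
    rw [integral_finsetSum _ fun t _ => (hm t).integrable one_le_two]
    exact Finset.sum_eq_zero fun t _ => h1 t
  have h3 := variance_sum_pi hf
  have h4 : (∑ i, fun ω : ∀ t, E t => f i (ω i)) = fun x => ∑ t, f t (x t) := by
    ext x; simp
  rw [h4, variance_of_integral_eq_zero hs.aestronglyMeasurable.aemeasurable h2] at h3
  rw [h3]
  exact Finset.sum_congr rfl fun t _ =>
    variance_of_integral_eq_zero (hf t).aestronglyMeasurable.aemeasurable (h0 t)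

theorem integral_sq_gaussian : ∫ x, x ^ 2 ∂gaussianReal 0 1 = 1 := by
  have h := variance_of_integral_eq_zero (μ := gaussianReal 0 1) (X := fun x => x)
    aemeasurable_id (by simp)
  rw [← h, variance_fun_id_gaussianReal]; simp

theorem integrable_pow_gaussian (k : ℕ) : Integrable (fun x : ℝ => x ^ k) (gaussianReal 0 1) := by
  have h := (memLp_id_gaussianReal' (μ := 0) (v := 1) (k : ENNReal) (by simp)).integrable_norm_pow'
  rw [← integrable_norm_iff (by fun_prop)]
  simpa using h

/-- Only finiteness with an explicit constant matters. The quadratic term of the exponential series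
gives `x⁴ ≤ 32 exp (x² / 4)`, whose integral is already bounded. -/
theorem integral_pow_four_gaussian_le : ∫ x, x ^ 4 ∂gaussianReal 0 1 ≤ 64 := by
  have h1 : ∀ x : ℝ, x ^ 4 ≤ 32 * Real.exp (1 / 4 * x ^ 2) := fun x => by
    have := Real.quadratic_le_exp_of_nonneg (x := 1 / 4 * x ^ 2) (by positivity)
    nlinarith [sq_nonneg x]
  rw [integral_eq_lintegral_of_nonneg_ae (ae_of_all _ fun x => by positivity) (by fun_prop)]
  refine ENNReal.toReal_le_of_le_ofReal (by norm_num) ?_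
  calc ∫⁻ x, ENNReal.ofReal (x ^ 4) ∂gaussianReal 0 1
      ≤ ∫⁻ x, ENNReal.ofReal 32 * ENNReal.ofReal (Real.exp (1 / 4 * x ^ 2)) ∂gaussianReal 0 1 :=
        lintegral_mono fun x => by
          rw [← ENNReal.ofReal_mul (by norm_num)]; exact ENNReal.ofReal_le_ofReal (h1 x)
    _ ≤ ENNReal.ofReal 32 * ENNReal.ofReal (Real.exp (2 * (1 / 4))) := by
        rw [lintegral_const_mul _ (by fun_prop)]
        gcongr
        exact lintegral_exp_mul_sq_gaussian (by norm_num) le_rfl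
    _ ≤ ENNReal.ofReal 64 := by
        rw [← ENNReal.ofReal_mul (by norm_num)]
        refine ENNReal.ofReal_le_ofReal ?_
        have h2 : Real.exp (2 * (1 / 4)) ^ 2 = Real.exp 1 := by
          rw [← Real.exp_nat_mul]; norm_num
        have h3 := Real.exp_one_lt_d9
        nlinarith [Real.exp_pos (2 * (1 / 4))]

theorem integral_sq_sub_one_gaussian :
    MemLp (fun x : ℝ => x ^ 2 - 1) 2 (gaussianReal 0 1) ∧
      ∫ x, (x ^ 2 - 1) ∂gaussianReal 0 1 = 0 ∧ ∫ x, (x ^ 2 - 1) ^ 2 ∂gaussianReal 0 1 ≤ 63 := by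
  have h2 := integrable_pow_gaussian 2
  have h4 := integrable_pow_gaussian 4
  have he : ∀ x : ℝ, (x ^ 2 - 1) ^ 2 = x ^ 4 - (2 * x ^ 2 - 1) := fun x => by ring
  refine ⟨?_, ?_, ?_⟩
  · rw [memLp_two_iff_integrable_sq (by fun_prop)]
    simp_rw [he]
    exact h4.sub ((h2.const_mul 2).sub (integrable_const _))
  · rw [integral_sub h2 (integrable_const _), integral_sq_gaussian]; simp
  · simp_rw [he]
    have h5 : Integrable (fun x : ℝ => 2 * x ^ 2 - 1) (gaussianReal 0 1) :=
      (h2.const_mul 2).sub (integrable_const _)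
    rw [integral_sub h4 h5, integral_sub (h2.const_mul 2) (integrable_const _), integral_const_mul, integral_sq_gaussian]
    have := integral_pow_four_gaussian_le
    simp; linarith

variable {ι κ : Type*} [Fintype ι] [Fintype κ]

/-- Second moment of a bilinear form in two distinct rows of a Gaussian matrix. -/
theorem integral_sq_sum_mul_gaussian {i i' : ι} (hi : i ≠ i') (c : κ → ℝ) :
    Integrable (fun g : ι × κ → ℝ => (∑ j, c j * (g (i, j) * g (i', j))) ^ 2)
        (Measure.pi fun _ => gaussianReal 0 1) ∧
      ∫ g, (∑ j, c j * (g (i, j) * g (i', j))) ^ 2 ∂Measure.pi (fun _ : ι × κ => gaussianReal 0 1)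
        = ∑ j, c j ^ 2 := by
  set P := Measure.pi (fun _ : ι × κ => gaussianReal 0 1) with hP
  have hind : iIndepFun (fun (t : ι × κ) (g : ι × κ → ℝ) => g t) P :=
    iIndepFun_pi (X := fun _ x => x) fun t => aemeasurable_id
  have hint : ∀ (t : ι × κ) (k : ℕ), Integrable (fun g : ι × κ → ℝ => g t ^ k) P := fun t k =>
    (measurePreserving_eval _ t).integrable_comp_of_integrable (integrable_pow_gaussian k)
  have hmean : ∀ t : ι × κ, ∫ g, g t ∂P = 0 := fun t => by
    have h := integral_comp_eval (μ := fun _ : ι × κ => gaussianReal 0 1) (i := t)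
      (f := fun x => x) (by fun_prop)
    rw [hP, h]; simp
  have hsq : ∀ t : ι × κ, ∫ g, g t ^ 2 ∂P = 1 := fun t => by
    have h := integral_comp_eval (μ := fun _ : ι × κ => gaussianReal 0 1) (i := t)
      (f := fun x => x ^ 2) (by fun_prop)
    rw [hP, h, integral_sq_gaussian]
  have hij : ∀ j, IndepFun (fun g : ι × κ → ℝ => g (i, j)) (fun g => g (i', j)) P := fun j =>
    hind.indepFun (by simp [hi])
  have hij2 : ∀ j, IndepFun (fun g : ι × κ → ℝ => g (i, j) ^ 2) (fun g => g (i', j) ^ 2) P :=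
    fun j => (hij j).comp (φ := fun x : ℝ => x ^ 2) (ψ := fun x : ℝ => x ^ 2)
      (by fun_prop) (by fun_prop)
  have hae : ∀ (t : ι × κ), AEStronglyMeasurable (fun g : ι × κ → ℝ => g t) P := fun t =>
    (measurable_pi_apply t).aestronglyMeasurable
  have hsqint : ∀ j, Integrable (fun g : ι × κ → ℝ => g (i, j) ^ 2 * g (i', j) ^ 2) P := fun j =>
    (hij2 j).integrable_mul (hint _ 2) (hint _ 2)
  have hX : ∀ j, MemLp (fun g : ι × κ → ℝ => c j * (g (i, j) * g (i', j))) 2 P := fun j => by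
    refine MemLp.const_mul ?_ _
    rw [memLp_two_iff_integrable_sq (by fun_prop)]
    simp_rw [mul_pow]
    exact hsqint j
  have hX0 : ∀ j, ∫ g, c j * (g (i, j) * g (i', j)) ∂P = 0 := fun j => by
    rw [integral_const_mul, (hij j).integral_fun_mul_eq_mul_integral (hae _) (hae _),
      hmean, zero_mul, mul_zero]
  have hX2 : ∀ j, ∫ g, (c j * (g (i, j) * g (i', j))) ^ 2 ∂P = c j ^ 2 := fun j => by
    simp_rw [mul_pow]
    rw [integral_const_mul, (hij2 j).integral_fun_mul_eq_mul_integral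
      (hint _ 2).aestronglyMeasurable (hint _ 2).aestronglyMeasurable, hsq, hsq, mul_one, mul_one]
  have hS : MemLp (fun g : ι × κ → ℝ => ∑ j, c j * (g (i, j) * g (i', j))) 2 P :=
    memLp_finsetSum _ fun j _ => hX j
  refine ⟨hS.integrable_sq, ?_⟩
  -- Products taken in different columns involve four distinct Gaussian entries, hence are pairwise
  -- independent and their variances add.
  have hvar := IndepFun.variance_sum (μ := P) (s := Finset.univ) (fun j _ => hX j)
    (fun j _ j' _ hjj => by
      have h := hind.indepFun_mul_mul (fun t => measurable_pi_apply t) (i, j) (i', j) (i, j') (i', j')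
        (by simp [hjj]) (by simp [hjj]) (by simp [hjj]) (by simp [hjj])
      exact h.comp (measurable_const_mul (c j)) (measurable_const_mul (c j')))
  have h4 : (∑ j, fun g : ι × κ → ℝ => c j * (g (i, j) * g (i', j))) =
      fun g => ∑ j, c j * (g (i, j) * g (i', j)) := by
    ext x; simp
  rw [h4, variance_of_integral_eq_zero hS.aestronglyMeasurable.aemeasurable] at hvar
  · rw [hvar]
    refine Finset.sum_congr rfl fun j _ => ?_
    rw [variance_of_integral_eq_zero (hX j).aestronglyMeasurable.aemeasurable (hX0 j), hX2]
  · rw [integral_finsetSum _ fun j _ => (hX j).integrable one_le_two]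
    exact Finset.sum_eq_zero fun j _ => hX0 j

end PrunedNet

namespace PrunedNet

variable {ι κ : Type*} [Fintype ι] [Fintype κ]

/-! ### Columns with many entries -/

open Classical in
/-- The mask of the entries of rows `i` and `i'` that share a heavy column. -/
noncomputable def heavyPair (D : ℝ) (b : ι × κ → Bool) (i i' : ι) (j : κ) : ℝ :=
  if colDeg b j ≤ D then 0 else bit (b (i, j)) * bit (b (i', j))

open Classical in
/-- Fluctuation of the squared row norms and of the inner products of rows over heavy columns. -/
noncomputable def heavyStat (D : ℝ) (ν : ι × κ → Measure Bool) (b : ι × κ → Bool)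
    (g : ι × κ → ℝ) : ℝ :=
  ∑ i, (∑ j, bit (b (i, j)) * (g (i, j) ^ 2 - 1)) ^ 2 +
  ∑ i, (∑ j, (bit (b (i, j)) - (ν (i, j)).real {true})) ^ 2 +
  ∑ i, ∑ i', if i = i' then 0 else (∑ j, heavyPair D b i i' j * (g (i, j) * g (i', j))) ^ 2

/-- The squared norm is the quadratic form of the Gram matrix of the rows. The diagonal is at most
the squared norm of a row over all columns, that is, `p n` plus the fluctuations of the Gaussian
squares and of the mask. The off-diagonal part is bounded by its Hilbert–Schmidt norm through
Cauchy–Schwarz. -/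
theorem norm_rowMul_heavyPart_le (ν : ι × κ → Measure Bool) {p D : ℝ}
    (hp0 : 0 ≤ p) (hp : ∀ t, (ν t).real {true} ≤ p) (b : ι × κ → Bool) (g : ι × κ → ℝ) {w : ι → ℝ}
    (hw : ∑ i, w i ^ 2 ≤ 1) :
    ‖rowMul (heavyPart D b g) w‖ ^ 2 ≤
      p * Fintype.card κ + 3 * Real.sqrt (heavyStat D ν b g) := by
  classical
  set Y := heavyPart D b g with hY
  set S1 : ℝ := ∑ i, (∑ j, bit (b (i, j)) * (g (i, j) ^ 2 - 1)) ^ 2 with hS1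
  set S2 : ℝ := ∑ i, (∑ j, (bit (b (i, j)) - (ν (i, j)).real {true})) ^ 2 with hS2
  set G : ι → ι → ℝ := fun i i' =>
    if i = i' then 0 else ∑ j, heavyPair D b i i' j * (g (i, j) * g (i', j)) with hG
  set S3 : ℝ := ∑ i, ∑ i', G i i' ^ 2 with hS3
  have hS : heavyStat D ν b g = S1 + S2 + S3 := by
    rw [heavyStat, ← hS1, ← hS2, hS3]
    congr 1
    refine Finset.sum_congr rfl fun i _ => Finset.sum_congr rfl fun i' _ => ?_
    simp only [hG]; split_ifs <;> simp
  have h1 : 0 ≤ S1 := Finset.sum_nonneg fun i _ => sq_nonneg _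
  have h2 : 0 ≤ S2 := Finset.sum_nonneg fun i _ => sq_nonneg _
  have h3 : 0 ≤ S3 := Finset.sum_nonneg fun i _ => Finset.sum_nonneg fun i' _ => sq_nonneg _
  set R := Real.sqrt (heavyStat D ν b g) with hR
  have hrow : ∀ i, ∑ j, Y i j ^ 2 ≤ p * Fintype.card κ + 2 * R := by
    intro i
    have e1 : ∑ j, bit (b (i, j)) * (g (i, j) ^ 2 - 1) ≤ R := by
      refine Real.le_sqrt_of_sq_le ?_
      have := Finset.single_le_sum (f := fun i => (∑ j, bit (b (i, j)) * (g (i, j) ^ 2 - 1)) ^ 2)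
        (fun i _ => sq_nonneg _) (Finset.mem_univ i)
      rw [hS]; linarith
    have e2 : ∑ j, (bit (b (i, j)) - (ν (i, j)).real {true}) ≤ R := by
      refine Real.le_sqrt_of_sq_le ?_
      have := Finset.single_le_sum
        (f := fun i => (∑ j, (bit (b (i, j)) - (ν (i, j)).real {true})) ^ 2)
        (fun i _ => sq_nonneg _) (Finset.mem_univ i)
      rw [hS]; linarith
    have e3 : ∑ j, (ν (i, j)).real {true} ≤ p * Fintype.card κ := by
      refine (Finset.sum_le_card_nsmul _ _ p fun j _ => hp (i, j)).trans ?_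
      rw [nsmul_eq_mul, mul_comm, Finset.card_univ]
    have e4 : ∑ j, Y i j ^ 2 ≤ ∑ j, bit (b (i, j)) * g (i, j) ^ 2 := by
      refine Finset.sum_le_sum fun j _ => ?_
      simp only [hY, heavyPart, maskedOn, Matrix.of_apply]
      split_ifs
      · simpa using mul_nonneg (bit_nonneg _) (sq_nonneg _)
      · rw [mul_pow, bit_sq]
    have e5 : ∑ j, bit (b (i, j)) * g (i, j) ^ 2 =
        ∑ j, bit (b (i, j)) * (g (i, j) ^ 2 - 1) +
          ∑ j, (bit (b (i, j)) - (ν (i, j)).real {true}) + ∑ j, (ν (i, j)).real {true} := by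
      rw [← Finset.sum_add_distrib, ← Finset.sum_add_distrib]
      exact Finset.sum_congr rfl fun j _ => by ring
    linarith
  have hgram : ∀ i i', i ≠ i' → ∑ j, Y i j * Y i' j = G i i' := by
    intro i i' hii
    simp only [hG, if_neg hii]
    refine Finset.sum_congr rfl fun j _ => ?_
    simp only [hY, heavyPart, maskedOn, Matrix.of_apply, heavyPair]
    split_ifs <;> ring
  have hexp : ‖rowMul Y w‖ ^ 2 =
      ∑ i, w i ^ 2 * ∑ j, Y i j ^ 2 + ∑ t : ι × ι, (w t.1 * w t.2) * G t.1 t.2 := by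
    have a1 : ∀ i i', w i * w i' * ∑ j, Y i j * Y i' j =
        (if i = i' then w i ^ 2 * ∑ j, Y i j ^ 2 else 0) + (w i * w i') * G i i' := by
      intro i i'
      by_cases h : i = i'
      · subst h; simp [hG, sq]
      · rw [hgram i i' h, if_neg h, zero_add]
    rw [norm_rowMul_sq]
    calc ∑ j, (∑ i, Y i j * w i) ^ 2 = ∑ i, ∑ i', w i * w i' * ∑ j, Y i j * Y i' j := by
          simp_rw [sq, Finset.sum_mul_sum, Finset.mul_sum]
          rw [Finset.sum_comm]
          refine Finset.sum_congr rfl fun i _ => ?_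
          rw [Finset.sum_comm]
          refine Finset.sum_congr rfl fun i' _ => Finset.sum_congr rfl fun j _ => by ring
      _ = _ := by
          simp_rw [a1, Finset.sum_add_distrib]
          rw [Fintype.sum_prod_type]
          congr 1
          exact Finset.sum_congr rfl fun i _ => by simp
  have hoff : ∑ t : ι × ι, (w t.1 * w t.2) * G t.1 t.2 ≤ R := by
    refine (Real.sum_mul_le_sqrt_mul_sqrt _ _ _).trans ?_
    have b1 : ∑ t : ι × ι, (w t.1 * w t.2) ^ 2 ≤ 1 := by
      simp_rw [mul_pow]
      rw [Fintype.sum_prod_type]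
      dsimp only
      rw [← Finset.sum_mul_sum]
      exact mul_le_one₀ hw (Finset.sum_nonneg fun i _ => sq_nonneg _) hw
    have b2 : Real.sqrt (∑ t : ι × ι, (w t.1 * w t.2) ^ 2) ≤ 1 := Real.sqrt_le_one.2 b1
    have b3 : Real.sqrt (∑ t : ι × ι, G t.1 t.2 ^ 2) ≤ R := by
      refine Real.sqrt_le_sqrt ?_
      rw [Fintype.sum_prod_type, hS]; linarith
    calc _ ≤ 1 * Real.sqrt (∑ t : ι × ι, G t.1 t.2 ^ 2) :=
          mul_le_mul_of_nonneg_right b2 (Real.sqrt_nonneg _)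
      _ ≤ R := by rw [one_mul]; exact b3
  have hdiag : ∑ i, w i ^ 2 * ∑ j, Y i j ^ 2 ≤ p * Fintype.card κ + 2 * R := by
    have hpos : 0 ≤ p * Fintype.card κ + 2 * R := by positivity
    calc _ ≤ ∑ i, w i ^ 2 * (p * Fintype.card κ + 2 * R) :=
          Finset.sum_le_sum fun i _ => mul_le_mul_of_nonneg_left (hrow i) (sq_nonneg _)
      _ = (∑ i, w i ^ 2) * (p * Fintype.card κ + 2 * R) := by rw [Finset.sum_mul]
      _ ≤ _ := mul_le_of_le_one_left hpos hw
  rw [hexp]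
  linarith

theorem integral_bit (ν : Measure Bool) [IsProbabilityMeasure ν] (F : Bool → ℝ) :
    ∫ y, F y ∂ν = ν.real {true} * F true + (1 - ν.real {true}) * F false := by
  have h1 : ν.real {false} = 1 - ν.real {true} := by
    rw [← probReal_compl_eq_one_sub (measurableSet_singleton _)]
    congr 1; ext b; cases b <;> simp
  rw [integral_fintype (Integrable.of_finite), Fintype.sum_bool, ← h1]
  simp

/-- The expected number of pairs of entries in a heavy column. -/
theorem integral_bit_mul_exp_colDeg_le (ν : ι × κ → Measure Bool)
    [∀ t, IsProbabilityMeasure (ν t)] {p : ℝ} (hp : ∀ t, (ν t).real {true} ≤ p) (i : ι) (j : κ) :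
    ∫ b, bit (b (i, j)) * Real.exp (2 * colDeg b j) ∂Measure.pi ν ≤
      8 * p * Real.exp (7 * (p * Fintype.card ι)) := by
  classical
  have hp0 : 0 ≤ p := measureReal_nonneg.trans (hp (i, j))
  have he1 : Real.exp 2 ≤ 8 := by
    have h2 : Real.exp 1 ^ 2 = Real.exp 2 := by rw [← Real.exp_nat_mul]; norm_num
    have h3 := Real.exp_one_lt_d9
    nlinarith [Real.exp_pos 1]
  -- The integrand is a product over entries. The entry `(i, j)` contributes at most `p e² ≤ 8 p`,
  -- and each other entry of column `j` at most `1 + p (e² - 1) ≤ e^(7p)`. This is the origin of the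
  -- `7` in `D`.
  set f : ι × κ → Bool → ℝ := fun t y =>
    (if t = (i, j) then bit y else 1) * (if t.2 = j then Real.exp (2 * bit y) else 1) with hf
  have h1 : ∀ b : ι × κ → Bool,
      bit (b (i, j)) * Real.exp (2 * colDeg b j) = ∏ t, f t (b t) := by
    intro b
    simp only [hf, Finset.prod_mul_distrib]
    congr 1
    · simp
    · rw [Fintype.prod_prod_type_right, Finset.prod_eq_single j]
      · simp [colDeg, Finset.mul_sum, Real.exp_sum]
      · intro j' _ hj'; simp [hj']
      · simp
  simp_rw [h1]
  rw [integral_fintype_prod_eq_prod]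
  have h2 : ∀ t, ∫ y, f t y ∂ν t ≤
      (if t = (i, j) then 8 * p else 1) * (if t.2 = j then Real.exp (7 * p) else 1) := by
    intro t
    have hr0 : 0 ≤ (ν t).real {true} := measureReal_nonneg
    have hE : 1 ≤ Real.exp (7 * p) := Real.one_le_exp (by positivity)
    rw [integral_bit]
    simp only [hf, bit, if_true, Bool.false_eq_true, if_false, mul_one, mul_zero, Real.exp_zero]
    by_cases ht : t = (i, j)
    · subst ht
      simp only [if_true, zero_mul, mul_zero, add_zero]
      nlinarith [hp (i, j), Real.exp_pos 2, mul_le_mul (hp (i, j)) he1 (Real.exp_pos 2).le hp0]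
    · simp only [if_neg ht, one_mul]
      split_ifs with hj
      · have h3 := Real.add_one_le_exp (7 * p)
        nlinarith [hp t, Real.exp_pos 2]
      · linarith
  calc _ ≤ ∏ t : ι × κ,
        (if t = (i, j) then 8 * p else 1) * (if t.2 = j then Real.exp (7 * p) else 1) := by
        refine Finset.prod_le_prod (fun t _ => integral_nonneg fun y => ?_) fun t _ => h2 t
        have : 0 ≤ bit y := bit_nonneg y
        simp only [hf]
        split_ifs <;> positivity
    _ = 8 * p * Real.exp (7 * (p * Fintype.card ι)) := by
        rw [Finset.prod_mul_distrib]
        congr 1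
        · simp
        · rw [Fintype.prod_prod_type_right, Finset.prod_eq_single j]
          · simp only [if_true, Finset.prod_const, Finset.card_univ]
            rw [← Real.exp_nat_mul]; congr 1; ring
          · intro j' _ hj'; simp [hj']
          · simp

end PrunedNet

/-! ### Expected fluctuation of the Gram matrix on heavy columns -/

namespace PrunedNet

variable {ι κ : Type*} [Fintype ι] [Fintype κ]

theorem integral_rowNorm_fluctuation_le (b : ι × κ → Bool) (i : ι) :
    Integrable (fun g : ι × κ → ℝ => (∑ j, bit (b (i, j)) * (g (i, j) ^ 2 - 1)) ^ 2)
        (Measure.pi fun _ => gaussianReal 0 1) ∧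
      ∫ g, (∑ j, bit (b (i, j)) * (g (i, j) ^ 2 - 1)) ^ 2
        ∂Measure.pi (fun _ : ι × κ => gaussianReal 0 1) ≤ ∑ j, 63 * bit (b (i, j)) := by
  classical
  obtain ⟨h1, h2, h3⟩ := integral_sq_sub_one_gaussian
  have h := integral_sq_sum_pi (fun _ : ι × κ => gaussianReal 0 1)
    (fun t x => (if t.1 = i then bit (b t) else 0) * (x ^ 2 - 1))
    (fun t => h1.const_mul _) (fun t => by rw [integral_const_mul, h2, mul_zero])
  have hsum : ∀ g : ι × κ → ℝ, ∑ t, (if t.1 = i then bit (b t) else 0) * (g t ^ 2 - 1) =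
      ∑ j, bit (b (i, j)) * (g (i, j) ^ 2 - 1) := fun g => by
    rw [Fintype.sum_prod_type, Finset.sum_eq_single i]
    · simp
    · intro i' _ hi; simp [hi]
    · simp
  simp_rw [hsum] at h
  refine ⟨h.1, h.2.le.trans ?_⟩
  rw [Fintype.sum_prod_type, Finset.sum_eq_single i]
  · refine Finset.sum_le_sum fun j _ => ?_
    simp only [if_true, mul_pow, bit_sq]
    rw [integral_const_mul, mul_comm]
    exact mul_le_mul_of_nonneg_right h3 (bit_nonneg _)
  · intro i' _ hi; simp [hi]
  · simp

theorem integral_rowDeg_fluctuation_le (ν : ι × κ → Measure Bool)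
    [∀ t, IsProbabilityMeasure (ν t)] {p : ℝ} (hp : ∀ t, (ν t).real {true} ≤ p) (i : ι) :
    ∫ b, (∑ j, (bit (b (i, j)) - (ν (i, j)).real {true})) ^ 2 ∂Measure.pi ν ≤
      Fintype.card κ * p := by
  classical
  have h := (integral_sq_sum_pi ν
    (fun t y => if t.1 = i then bit y - (ν t).real {true} else 0)
    (fun t => MemLp.of_discrete) (fun t => by
      rw [integral_bit]; split_ifs <;> simp [bit]; ring)).2
  have hsum : ∀ b : ι × κ → Bool, ∑ t, (if t.1 = i then bit (b t) - (ν t).real {true} else 0) =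
      ∑ j, (bit (b (i, j)) - (ν (i, j)).real {true}) := fun b => by
    rw [Fintype.sum_prod_type, Finset.sum_eq_single i]
    · simp
    · intro i' _ hi; simp [hi]
    · simp
  simp_rw [hsum] at h
  rw [h, Fintype.sum_prod_type, Finset.sum_eq_single i]
  · refine (Finset.sum_le_card_nsmul _ _ p fun j _ => ?_).trans (by simp)
    refine le_trans ?_ (hp (i, j))
    have h0 : 0 ≤ (ν (i, j)).real {true} := measureReal_nonneg
    rw [integral_bit]
    simp [bit]
    nlinarith
  · intro i' _ hi; simp [hi]
  · simp

/-- A Chernoff weight replaces the indicator of a heavy column: if the degree exceeds `D`, it is at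
most `exp (degree) ≤ exp (2 * degree - D)`. -/
theorem sum_heavyPair_sq_le {κ : Type*} (D : ℝ) (b : ι × κ → Bool) (j : κ) (i : ι) [DecidableEq ι] :
    ∑ i', (if i = i' then 0 else heavyPair D b i i' j ^ 2) ≤
      bit (b (i, j)) * Real.exp (2 * colDeg b j) * Real.exp (-D) := by
  by_cases hD : colDeg b j ≤ D
  · simp only [heavyPair, if_pos hD]
    have := bit_nonneg (b (i, j))
    simp only [ne_eq, OfNat.ofNat_ne_zero, not_false_eq_true, zero_pow, ite_self,
      Finset.sum_const_zero]
    positivity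
  · simp only [heavyPair, if_neg hD, mul_pow, bit_sq]
    have h1 : ∑ i', (if i = i' then 0 else bit (b (i, j)) * bit (b (i', j))) ≤
        bit (b (i, j)) * colDeg b j := by
      rw [colDeg, Finset.mul_sum]
      refine Finset.sum_le_sum fun i' _ => ?_
      split_ifs
      · exact mul_nonneg (bit_nonneg _) (bit_nonneg _)
      · exact le_rfl
    refine h1.trans ?_
    rw [mul_assoc, ← Real.exp_add]
    refine mul_le_mul_of_nonneg_left ?_ (bit_nonneg _)
    calc colDeg b j ≤ Real.exp (colDeg b j) := by linarith [Real.add_one_le_exp (colDeg b j)]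
      _ ≤ _ := Real.exp_le_exp.2 (by linarith [not_le.1 hD])

theorem heavyStat_nonneg (D : ℝ) (ν : ι × κ → Measure Bool) (b : ι × κ → Bool)
    (g : ι × κ → ℝ) : 0 ≤ heavyStat D ν b g := by
  unfold heavyStat
  refine add_nonneg (add_nonneg (Finset.sum_nonneg fun i _ => sq_nonneg _)
    (Finset.sum_nonneg fun i _ => sq_nonneg _)) (Finset.sum_nonneg fun i _ =>
      Finset.sum_nonneg fun i' _ => ?_)
  split_ifs
  · exact le_rfl
  · exact sq_nonneg _

theorem measurable_heavyStat (D : ℝ) (ν : ι × κ → Measure Bool) :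
    Measurable fun z : (ι × κ → Bool) × (ι × κ → ℝ) => heavyStat D ν z.1 z.2 := by
  classical
  refine measurable_maskGauss fun b => ?_
  unfold heavyStat
  refine Measurable.add (by fun_prop) (Finset.measurable_sum _ fun i _ =>
    Finset.measurable_sum _ fun i' _ => ?_)
  split_ifs <;> fun_prop

/-- With the mask fixed, the Gaussian second moments are explicit, and averaging over the mask then
gives `72 = 63 + 1 + 8` for the three sums. Having at least as many columns as rows ensures that
`e^(-D)` absorbs the factor `e^(7 p m)` of `integral_bit_mul_exp_colDeg_le`. -/
theorem lintegral_heavyStat_le (ν : ι × κ → Measure Bool) [∀ t, IsProbabilityMeasure (ν t)]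
    {p : ℝ} (hp0 : 0 ≤ p) (hp : ∀ t, (ν t).real {true} ≤ p)
    (hmn : Fintype.card ι ≤ Fintype.card κ) :
    ∫⁻ z, ENNReal.ofReal (heavyStat (7 * (p * Fintype.card κ)) ν z.1 z.2) ∂maskGauss ν ≤
      ENNReal.ofReal (72 * (Fintype.card ι * (Fintype.card κ * p))) := by
  classical
  set D : ℝ := 7 * (p * Fintype.card κ) with hD
  set Φ : (ι × κ → Bool) → ℝ := fun b =>
    ∑ i, (∑ j, 63 * bit (b (i, j)) + (∑ j, (bit (b (i, j)) - (ν (i, j)).real {true})) ^ 2 +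
      ∑ j, bit (b (i, j)) * Real.exp (2 * colDeg b j) * Real.exp (-D)) with hΦ
  have hΦ0 : ∀ b, 0 ≤ Φ b := fun b => Finset.sum_nonneg fun i _ => add_nonneg (add_nonneg
    (Finset.sum_nonneg fun j _ => mul_nonneg (by norm_num) (bit_nonneg _)) (sq_nonneg _))
    (Finset.sum_nonneg fun j _ => mul_nonneg (mul_nonneg (bit_nonneg _) (Real.exp_pos _).le)
      (Real.exp_pos _).le)
  rw [maskGauss, lintegral_prod _ (measurable_heavyStat D ν).ennreal_ofReal.aemeasurable]
  have hinner : ∀ b : ι × κ → Bool, ∫⁻ g, ENNReal.ofReal (heavyStat D ν b g)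
      ∂Measure.pi (fun _ : ι × κ => gaussianReal 0 1) ≤ ENNReal.ofReal (Φ b) := by
    intro b
    set P := Measure.pi (fun _ : ι × κ => gaussianReal 0 1) with hP
    have i1 : Integrable (fun g : ι × κ → ℝ =>
        ∑ i, (∑ j, bit (b (i, j)) * (g (i, j) ^ 2 - 1)) ^ 2) P :=
      integrable_finsetSum _ fun i _ => (integral_rowNorm_fluctuation_le b i).1
    have i3' : ∀ i i', Integrable (fun g : ι × κ → ℝ => if i = i' then 0 else
        (∑ j, heavyPair D b i i' j * (g (i, j) * g (i', j))) ^ 2) P := fun i i' => by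
      by_cases h : i = i'
      · simp [h]
      · simp only [if_neg h]
        exact (integral_sq_sum_mul_gaussian h _).1
    have i3 : Integrable (fun g : ι × κ → ℝ => ∑ i, ∑ i', if i = i' then 0 else
        (∑ j, heavyPair D b i i' j * (g (i, j) * g (i', j))) ^ 2) P :=
      integrable_finsetSum _ fun i _ => integrable_finsetSum _ fun i' _ => i3' i i'
    have i2 : Integrable (fun _ : ι × κ → ℝ =>
        ∑ i, (∑ j, (bit (b (i, j)) - (ν (i, j)).real {true})) ^ 2) P := integrable_const _
    have i12 : Integrable (fun g : ι × κ → ℝ =>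
        ∑ i, (∑ j, bit (b (i, j)) * (g (i, j) ^ 2 - 1)) ^ 2 +
        ∑ i, (∑ j, (bit (b (i, j)) - (ν (i, j)).real {true})) ^ 2) P := i1.add i2
    have iall : Integrable (fun g => heavyStat D ν b g) P := i12.add i3
    rw [← ofReal_integral_eq_lintegral_ofReal iall (ae_of_all _ fun g => heavyStat_nonneg _ _ _ _)]
    refine ENNReal.ofReal_le_ofReal ?_
    simp only [heavyStat]
    rw [integral_add i12 i3, integral_add i1 i2,
      integral_finsetSum _ fun i _ => (integral_rowNorm_fluctuation_le b i).1,
      integral_finsetSum _ fun i _ => integrable_finsetSum _ fun i' _ => i3' i i', hΦ]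
    simp only [Finset.sum_add_distrib]
    refine add_le_add (add_le_add ?_ ?_) ?_
    · exact Finset.sum_le_sum fun i _ => (integral_rowNorm_fluctuation_le b i).2
    · simp
    · refine Finset.sum_le_sum fun i _ => ?_
      rw [integral_finsetSum _ fun i' _ => i3' i i']
      have hval : ∀ i', ∫ g, (if i = i' then 0 else
          (∑ j, heavyPair D b i i' j * (g (i, j) * g (i', j))) ^ 2) ∂P =
          ∑ j, if i = i' then 0 else heavyPair D b i i' j ^ 2 := fun i' => by
        by_cases h : i = i'
        · simp [h]
        · simp only [if_neg h]
          exact (integral_sq_sum_mul_gaussian h _).2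
      simp_rw [hval]
      rw [Finset.sum_comm]
      exact Finset.sum_le_sum fun j _ => sum_heavyPair_sq_le D b j i
  refine (lintegral_mono hinner).trans ?_
  rw [← ofReal_integral_eq_lintegral_ofReal Integrable.of_finite (ae_of_all _ hΦ0)]
  refine ENNReal.ofReal_le_ofReal ?_
  have hbit : ∀ t, ∫ b, bit (b t) ∂Measure.pi ν ≤ p := fun t => by
    have h := integral_comp_eval (μ := ν) (i := t) (f := fun y => bit y)
      Measurable.of_discrete.aestronglyMeasurable
    rw [h, integral_bit]
    simpa [bit] using hp t
  rw [hΦ, integral_finsetSum _ fun i _ => Integrable.of_finite]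
  refine (Finset.sum_le_card_nsmul _ _ (72 * (Fintype.card κ * p)) fun i _ => ?_).trans
    (le_of_eq ?_)
  · rw [integral_add Integrable.of_finite Integrable.of_finite,
      integral_add Integrable.of_finite Integrable.of_finite,
      integral_finsetSum _ fun j _ => Integrable.of_finite,
      integral_finsetSum _ fun j _ => Integrable.of_finite]
    have a1 : ∑ j, ∫ b, 63 * bit (b (i, j)) ∂Measure.pi ν ≤ Fintype.card κ * (63 * p) := by
      refine (Finset.sum_le_card_nsmul _ _ (63 * p) fun j _ => ?_).trans (by simp)
      rw [integral_const_mul]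
      exact mul_le_mul_of_nonneg_left (hbit _) (by norm_num)
    have a2 := integral_rowDeg_fluctuation_le ν hp i
    have a3 : ∑ j, ∫ b, bit (b (i, j)) * Real.exp (2 * colDeg b j) * Real.exp (-D)
        ∂Measure.pi ν ≤ Fintype.card κ * (8 * p) := by
      refine (Finset.sum_le_card_nsmul _ _ (8 * p) fun j _ => ?_).trans (by simp)
      rw [integral_mul_const]
      calc _ ≤ 8 * p * Real.exp (7 * (p * Fintype.card ι)) * Real.exp (-D) :=
            mul_le_mul_of_nonneg_right (integral_bit_mul_exp_colDeg_le ν hp i j) (Real.exp_pos _).le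
        _ ≤ 8 * p := by
            rw [mul_assoc, ← Real.exp_add]
            refine mul_le_of_le_one_right (by positivity) (Real.exp_le_one_iff.2 ?_)
            have : p * (Fintype.card ι : ℝ) ≤ p * Fintype.card κ :=
              mul_le_mul_of_nonneg_left (by exact_mod_cast hmn) hp0
            linarith
    linarith
  · rw [nsmul_eq_mul, Finset.card_univ]; ring

end PrunedNet

/-! ### Norm of a masked Gaussian matrix -/

namespace PrunedNet

theorem measureReal_ge_le_of_lintegral_le {α : Type*} [MeasurableSpace α] {μ : Measure α}
    {F : α → ℝ} (hF : Measurable F) {c a : ℝ} (hc : 0 ≤ c) (ha : 0 < a)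
    (h : ∫⁻ x, ENNReal.ofReal (F x) ∂μ ≤ ENNReal.ofReal c) : μ.real {x | a ≤ F x} ≤ c / a := by
  refine ENNReal.toReal_le_of_le_ofReal (by positivity) ?_
  have h1 := mul_meas_ge_le_lintegral₀ (μ := μ) hF.ennreal_ofReal.aemeasurable (ENNReal.ofReal a)
  have h2 : {x | a ≤ F x} ⊆ {x | ENNReal.ofReal a ≤ ENNReal.ofReal (F x)} := fun x hx =>
    ENNReal.ofReal_le_ofReal hx
  refine (measure_mono h2).trans ?_
  rw [ENNReal.ofReal_div_of_pos ha, ENNReal.le_div_iff_mul_le (Or.inl (by simpa using ha))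
    (Or.inl (by simp)), mul_comm]
  exact h1.trans h

variable {ι κ : Type*} [Fintype ι] [Fintype κ]

/-- The masked Gaussian matrix. -/
noncomputable def masked (b : ι × κ → Bool) (g : ι × κ → ℝ) : Matrix ι κ ℝ :=
  Matrix.of fun i j => bit (b (i, j)) * g (i, j)

theorem masked_eq_add {κ : Type*} (D : ℝ) (b : ι × κ → Bool) (g : ι × κ → ℝ) :
    masked b g = lightPart D b g + heavyPart D b g := by
  ext i j
  simp only [masked, lightPart, heavyPart, maskedOn, Matrix.of_apply, Matrix.add_apply]
  split_ifs <;> simp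

/-- The degree of a column is an integer, so a light column is empty when `D < 1`. This covers the
case excluded from `measure_lightPart_le`. -/
theorem lightPart_eq_zero {κ : Type*} {D : ℝ} (hD : D < 1) (b : ι × κ → Bool) (g : ι × κ → ℝ) :
    lightPart D b g = 0 := by
  ext i j
  simp only [lightPart, maskedOn, Matrix.of_apply, Matrix.zero_apply, ite_eq_right_iff]
  intro h
  have h1 : bit (b (i, j)) ≤ colDeg b j :=
    Finset.single_le_sum (f := fun i => bit (b (i, j))) (fun i _ => bit_nonneg _)
      (Finset.mem_univ i)
  cases hb : b (i, j)
  · simp [bit]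
  · rw [hb] at h1
    simp only [bit, if_true] at h1
    linarith

theorem norm_rowMul_masked_sq_le (b : ι × κ → Bool) (g : ι × κ → ℝ) {w : ι → ℝ}
    (hw : ∑ i, w i ^ 2 ≤ 1) :
    ‖rowMul (masked b g) w‖ ^ 2 ≤ ∑ t, bit (b t) * g t ^ 2 := by
  rw [norm_rowMul_sq, Fintype.sum_prod_type_right]
  refine Finset.sum_le_sum fun j _ => ?_
  refine (Finset.sum_mul_sq_le_sq_mul_sq _ _ _).trans ?_
  have h : ∑ i, masked b g i j ^ 2 = ∑ i, bit (b (i, j)) * g (i, j) ^ 2 :=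
    Finset.sum_congr rfl fun i _ => by
      simp only [masked, Matrix.of_apply, mul_pow, bit_sq]
  rw [h]
  exact mul_le_of_le_one_right
    (Finset.sum_nonneg fun i _ => mul_nonneg (bit_nonneg _) (sq_nonneg _)) hw

theorem measurable_sum_bit_mul_sq : Measurable fun z : (ι × κ → Bool) × (ι × κ → ℝ) =>
    ∑ t, bit (z.1 t) * z.2 t ^ 2 :=
  measurable_maskGauss fun b => by fun_prop

theorem lintegral_sum_bit_mul_sq_le (ν : ι × κ → Measure Bool) [∀ t, IsProbabilityMeasure (ν t)]
    {p : ℝ} (hp : ∀ t, (ν t).real {true} ≤ p) :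
    ∫⁻ z, ENNReal.ofReal (∑ t, bit (z.1 t) * z.2 t ^ 2) ∂maskGauss ν ≤
      ENNReal.ofReal (Fintype.card ι * Fintype.card κ * p) := by
  rw [maskGauss, lintegral_prod _ measurable_sum_bit_mul_sq.ennreal_ofReal.aemeasurable]
  have hsq : ∀ t : ι × κ, Integrable (fun g : ι × κ → ℝ => g t ^ 2)
      (Measure.pi fun _ => gaussianReal 0 1) := fun t =>
    (measurePreserving_eval (fun _ : ι × κ => gaussianReal 0 1) t).integrable_comp_of_integrable
      (integrable_pow_gaussian 2)
  have hinner : ∀ b : ι × κ → Bool, ∫⁻ g, ENNReal.ofReal (∑ t, bit (b t) * g t ^ 2)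
      ∂Measure.pi (fun _ : ι × κ => gaussianReal 0 1) = ENNReal.ofReal (∑ t, bit (b t)) := by
    intro b
    rw [← ofReal_integral_eq_lintegral_ofReal
      (integrable_finsetSum _ fun t _ => (hsq t).const_mul _) (ae_of_all _ fun g =>
        Finset.sum_nonneg fun t _ => mul_nonneg (bit_nonneg _) (sq_nonneg _)),
      integral_finsetSum _ fun t _ => (hsq t).const_mul _]
    congr 1
    refine Finset.sum_congr rfl fun t _ => ?_
    have h := integral_comp_eval (μ := fun _ : ι × κ => gaussianReal 0 1) (i := t)
      (f := fun x => x ^ 2) (by fun_prop)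
    rw [integral_const_mul, h, integral_sq_gaussian, mul_one]
  simp_rw [hinner]
  rw [← ofReal_integral_eq_lintegral_ofReal Integrable.of_finite (ae_of_all _ fun b =>
    Finset.sum_nonneg fun t _ => bit_nonneg _), integral_finsetSum _ fun t _ => Integrable.of_finite]
  refine ENNReal.ofReal_le_ofReal ((Finset.sum_le_card_nsmul _ _ p fun t _ => ?_).trans
    (by simp))
  have h := integral_comp_eval (μ := ν) (i := t) (f := fun y => bit y)
    Measurable.of_discrete.aestronglyMeasurable
  rw [h, integral_bit]
  simpa [bit] using hp t

/-- Tail bound for the operator norm of a sparse Gaussian matrix with at least as many columns as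
rows. -/
theorem measure_masked_le (ν : ι × κ → Measure Bool) [∀ t, IsProbabilityMeasure (ν t)]
    {p Q ε : ℝ} (hp0 : 0 < p) (hp : ∀ t, (ν t).real {true} ≤ p) (hε : 1 ≤ ε)
    (hm : 0 < Fintype.card ι) (hmn : Fintype.card ι ≤ Fintype.card κ)
    (hQ : Q = p * Fintype.card κ + Real.sqrt (Fintype.card ι * Fintype.card κ * p)) :
    (maskGauss ν).real {z | ¬ ∀ w : ι → ℝ, ∑ i, w i ^ 2 ≤ 1 →
      ‖rowMul (masked z.1 z.2) w‖ ≤ 98 * ε * Real.sqrt Q} ≤ 1 / ε := by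
  have hm0 : (0 : ℝ) < Fintype.card ι := Nat.cast_pos.2 hm
  have hn0 : (0 : ℝ) < Fintype.card κ := Nat.cast_pos.2 (hm.trans_le hmn)
  have hε0 : 0 < ε := by linarith
  set N : ℝ := Fintype.card ι * Fintype.card κ * p with hN
  have hN0 : 0 < N := by positivity
  have hpn0 : 0 < p * Fintype.card κ := by positivity
  have hQ0 : 0 < Q := by rw [hQ]; positivity
  have hpnQ : p * Fintype.card κ ≤ Q := by rw [hQ]; linarith [Real.sqrt_nonneg N]
  have hsN : Real.sqrt N ≤ Q := by rw [hQ]; linarith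
  have hNQ : N ≤ Q ^ 2 := (Real.sqrt_le_left hQ0.le).1 hsN
  have hsQ : Real.sqrt Q ^ 2 = Q := Real.sq_sqrt hQ0.le
  -- `N` is the bound for the expected squared Frobenius norm. If `N ≤ 1` then `N ≤ √N ≤ Q`, and
  -- Markov suffices. Otherwise `1 ≤ Q`, so the additive `y` of the net bound is absorbed into a
  -- multiple of `ε Q`.
  rcases le_total N 1 with hN1 | hN1
  · have hNQ' : N ≤ Q := (Real.le_sqrt_of_sq_le (by nlinarith)).trans hsN
    have h := measureReal_ge_le_of_lintegral_le (a := (98 * ε) ^ 2 * Q)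
      (measurable_sum_bit_mul_sq (ι := ι) (κ := κ)) hN0.le (by positivity)
      (lintegral_sum_bit_mul_sq_le ν hp)
    refine le_trans (measureReal_mono fun z hz => ?_) (h.trans ?_)
    · by_contra hcon
      simp only [Set.mem_ofPred_eq, not_le] at hcon
      refine hz fun w hw => ?_
      refine abs_le_of_sq_le_sq' ?_ (by positivity) |>.2
      rw [mul_pow, hsQ]
      exact (norm_rowMul_masked_sq_le z.1 z.2 hw).trans hcon.le
    · rw [div_le_div_iff₀ (by positivity) hε0]
      nlinarith [mul_pos hε0 hQ0, mul_le_mul_of_nonneg_right hε (mul_pos hε0 hQ0).le]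
  · have hQ1 : 1 ≤ Q := (Real.one_le_sqrt.2 hN1).trans hsN
    -- Chosen to make the failure probability `3 e^(-y)` of the light part equal to `1 / (4 ε)`. The
    -- threshold `288 = 4 * 72` below does the same for the heavy part.
    set y : ℝ := Real.log (12 * ε) with hy
    have hy0 : 0 ≤ y := Real.log_nonneg (by linarith)
    have hexp : 3 * Real.exp (-y) = 1 / (4 * ε) := by
      rw [hy, Real.exp_neg, Real.exp_log (by positivity)]; field_simp; norm_num
    set D : ℝ := 7 * (p * Fintype.card κ) with hD
    have hlight : (maskGauss ν).real {z | ¬ ∀ w : ι → ℝ, ∑ i, w i ^ 2 ≤ 1 →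
        ‖rowMul (lightPart D z.1 z.2) w‖ ≤ 6 * Real.sqrt (172 * Q + 4 * y)} ≤ 1 / (4 * ε) := by
      rw [← hexp]
      rcases le_or_gt 1 D with hD1 | hD1
      · set r : ℝ := Real.sqrt (p * Fintype.card κ / Q) with hr
        have hr2 : r ^ 2 * Q = p * Fintype.card κ := by
          rw [hr, Real.sq_sqrt (by positivity)]; field_simp
        refine measure_lightPart_le ν hy0 hp0.le hp hQ0 hm (r := r)
          (Real.sqrt_pos.2 (by positivity)) (Real.sqrt_le_one.2 ((div_le_one hQ0).2 hpnQ)) hr2 ?_ hD1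
        rw [hr, Real.sq_sqrt (by positivity), div_mul_eq_mul_div, div_le_iff₀ hQ0]
        calc _ = N := by rw [hN]; ring
          _ ≤ Q * Q := by rw [← sq]; exact hNQ
      · have hemp : {z : (ι × κ → Bool) × (ι × κ → ℝ) | ¬ ∀ w : ι → ℝ, ∑ i, w i ^ 2 ≤ 1 →
            ‖rowMul (lightPart D z.1 z.2) w‖ ≤ 6 * Real.sqrt (172 * Q + 4 * y)} = ∅ := by
          ext z
          simp only [Set.mem_ofPred_eq, Set.mem_empty_iff_false, iff_false, not_not]
          intro w _
          rw [lightPart_eq_zero hD1]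
          have : rowMul (0 : Matrix ι κ ℝ) w = 0 := by simp [rowMul]
          rw [this, norm_zero]; positivity
        rw [hemp, measureReal_empty]; positivity
    have hheavy := measureReal_ge_le_of_lintegral_le (a := 288 * ε * Q ^ 2)
      (measurable_heavyStat D ν) (by positivity) (by positivity)
      (lintegral_heavyStat_le ν hp0.le hp hmn)
    have hheavy' : (maskGauss ν).real {z | 288 * ε * Q ^ 2 ≤ heavyStat D ν z.1 z.2} ≤
        1 / (4 * ε) := by
      refine hheavy.trans ?_
      have e : (Fintype.card ι : ℝ) * (Fintype.card κ * p) = N := by rw [hN]; ring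
      rw [e, div_le_div_iff₀ (by positivity) (by positivity)]
      nlinarith [mul_le_mul_of_nonneg_left hNQ hε0.le]
    have key : ∀ z : (ι × κ → Bool) × (ι × κ → ℝ), (∀ w : ι → ℝ, ∑ i, w i ^ 2 ≤ 1 →
        ‖rowMul (lightPart D z.1 z.2) w‖ ≤ 6 * Real.sqrt (172 * Q + 4 * y)) →
        heavyStat D ν z.1 z.2 < 288 * ε * Q ^ 2 → ∀ w : ι → ℝ, ∑ i, w i ^ 2 ≤ 1 →
        ‖rowMul (masked z.1 z.2) w‖ ≤ 98 * ε * Real.sqrt Q := by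
      intro z h1 h2 w hw
      have hεQ : 0 < ε * Q := by positivity
      have hQε : Q ≤ ε * Q := le_mul_of_one_le_left hQ0.le hε
      have hε2 : ε * Q ≤ ε ^ 2 * Q := by nlinarith
      -- The numerical constants close up through `172 + 48 ≤ 15²`, `288 ≤ 17²`, `1 + 3 * 17 ≤ 8²`
      -- and `6 * 15 + 8 = 98`.
      have b1 : Real.sqrt (172 * Q + 4 * y) ≤ 15 * ε * Real.sqrt Q := by
        rw [Real.sqrt_le_left (by positivity), mul_pow, hsQ]
        have h3 : y ≤ 12 * ε := by
          have := Real.log_le_sub_one_of_pos (x := 12 * ε) (by positivity)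
          linarith
        nlinarith
      have b2 : Real.sqrt (heavyStat D ν z.1 z.2) ≤ 17 * (ε * Q) := by
        rw [Real.sqrt_le_left (by positivity)]
        refine h2.le.trans ?_
        have : ε * Q ^ 2 ≤ ε ^ 2 * Q ^ 2 :=
          mul_le_mul_of_nonneg_right (by nlinarith) (sq_nonneg _)
        nlinarith
      have b3 : ‖rowMul (heavyPart D z.1 z.2) w‖ ≤ 8 * ε * Real.sqrt Q := by
        refine abs_le_of_sq_le_sq' ?_ (by positivity) |>.2
        rw [mul_pow, hsQ]
        refine (norm_rowMul_heavyPart_le ν hp0.le hp z.1 z.2 hw).trans ?_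
        nlinarith
      rw [masked_eq_add D, rowMul_add]
      calc _ ≤ _ := norm_add_le _ _
        _ ≤ 6 * (15 * ε * Real.sqrt Q) + 8 * ε * Real.sqrt Q := by
            have := h1 w hw
            linarith
        _ = _ := by ring
    have hsub : {z : (ι × κ → Bool) × (ι × κ → ℝ) | ¬ ∀ w : ι → ℝ, ∑ i, w i ^ 2 ≤ 1 →
        ‖rowMul (masked z.1 z.2) w‖ ≤ 98 * ε * Real.sqrt Q} ⊆
        {z | ¬ ∀ w : ι → ℝ, ∑ i, w i ^ 2 ≤ 1 →
          ‖rowMul (lightPart D z.1 z.2) w‖ ≤ 6 * Real.sqrt (172 * Q + 4 * y)} ∪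
        {z | 288 * ε * Q ^ 2 ≤ heavyStat D ν z.1 z.2} := by
      intro z hz
      rw [Set.mem_union]
      by_contra hcon
      rw [not_or] at hcon
      exact hz (key z (not_not.1 hcon.1) (not_le.1 hcon.2))
    have hsum : 1 / (4 * ε) + 1 / (4 * ε) = 1 / (2 * ε) := by field_simp; norm_num
    calc _ ≤ _ := measureReal_mono hsub (measure_ne_top _ _)
      _ ≤ _ := measureReal_union_le _ _
      _ ≤ 1 / (4 * ε) + 1 / (4 * ε) := add_le_add hlight hheavy'
      _ = 1 / (2 * ε) := hsum
      _ ≤ 1 / ε := one_div_le_one_div_of_le hε0 (by linarith)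

end PrunedNet

namespace PrunedNet

/-! ### The law of the pruning error -/

theorem map_prod_pi {T α β γ : Type*} [Fintype T] [MeasurableSpace α] [MeasurableSpace β]
    [MeasurableSpace γ] (a : T → Measure α) (b : T → Measure β) [∀ t, IsProbabilityMeasure (a t)]
    [∀ t, IsProbabilityMeasure (b t)] {f : T → α × β → γ} (hf : ∀ t, Measurable (f t)) :
    ((Measure.pi a).prod (Measure.pi b)).map (fun z t => f t (z.1 t, z.2 t)) =
      Measure.pi fun t => ((a t).prod (b t)).map (f t) := by
  rw [← (measurePreserving_arrowProdEquivProdArrow α β T a b).map_eq,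
    Measure.map_map (by fun_prop) (MeasurableEquiv.measurable _)]
  have (t : T) : IsProbabilityMeasure (((a t).prod (b t)).map (f t)) :=
    Measure.isProbabilityMeasure_map (hf t).aemeasurable
  rw [← Measure.pi_map_pi fun t => (hf t).aemeasurable]
  rfl

/-- The Bernoulli law of parameter `p`. -/
noncomputable def coin (p : ℝ) : Measure Bool :=
  ENNReal.ofReal p • Measure.dirac true + ENNReal.ofReal (1 - p) • Measure.dirac false

theorem isProbabilityMeasure_coin {p : ℝ} (h0 : 0 ≤ p) (h1 : p ≤ 1) :
    IsProbabilityMeasure (coin p) := ⟨by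
  simp only [coin, Measure.coe_add, Measure.coe_smul, Pi.add_apply, Pi.smul_apply, measure_univ,
    smul_eq_mul, mul_one]
  rw [← ENNReal.ofReal_add h0 (by linarith)]
  simp⟩

theorem coin_true {p : ℝ} (h0 : 0 ≤ p) : (coin p).real {true} = p := by
  simp [coin, measureReal_def, h0]

theorem lintegral_coin (p : ℝ) (F : Bool → ENNReal) :
    ∫⁻ y, F y ∂coin p = ENNReal.ofReal p * F true + ENNReal.ofReal (1 - p) * F false := by
  simp [coin]

/-- One entry of the pruning error. -/
noncomputable def pruneGap (d Ψ : ℝ) (x : ℝ × ℝ) : ℝ :=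
  if x.2 ≤ Real.exp (-x.1 ^ 2 / (d * Ψ)) then x.1 else 0

theorem measurable_pruneGap (d Ψ : ℝ) : Measurable (pruneGap d Ψ) :=
  Measurable.ite (measurableSet_le (by fun_prop) (by fun_prop)) measurable_fst measurable_const

theorem lintegral_threshold_uniform {e : ℝ} (h0 : 0 ≤ e) (h1 : e ≤ 1) (c₁ c₂ : ENNReal) :
    ∫⁻ v, (if v ≤ e then c₁ else c₂) ∂(volume.restrict (Set.Icc (0 : ℝ) 1)) =
      ENNReal.ofReal e * c₁ + ENNReal.ofReal (1 - e) * c₂ := by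
  have hf : ∀ v : ℝ, (if v ≤ e then c₁ else c₂) =
      (Set.Iic e).indicator (fun _ => c₁) v + (Set.Ioi e).indicator (fun _ => c₂) v := by
    intro v
    by_cases h : v ≤ e
    · simp [h, h.not_gt]
    · simp [h, not_le.1 h]
  simp_rw [hf]
  rw [lintegral_add_left (measurable_const.indicator measurableSet_Iic),
    lintegral_indicator_const measurableSet_Iic, lintegral_indicator_const measurableSet_Ioi,
    Measure.restrict_apply measurableSet_Iic, Measure.restrict_apply measurableSet_Ioi]
  have e1 : Set.Iic e ∩ Set.Icc 0 1 = Set.Icc 0 e := by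
    ext x; simp only [Set.mem_inter_iff, Set.mem_Iic, Set.mem_Icc]
    constructor
    · rintro ⟨h, h', -⟩; exact ⟨h', h⟩
    · rintro ⟨h, h'⟩; exact ⟨h', h, h'.trans h1⟩
  have e2 : Set.Ioi e ∩ Set.Icc 0 1 = Set.Ioc e 1 := by
    ext x; simp only [Set.mem_inter_iff, Set.mem_Ioi, Set.mem_Icc, Set.mem_Ioc]
    constructor
    · rintro ⟨h, -, h'⟩; exact ⟨h, h'⟩
    · rintro ⟨h, h'⟩; exact ⟨h, h0.trans h.le, h'⟩
  rw [e1, e2, Real.volume_Icc, Real.volume_Ioc, sub_zero, mul_comm, mul_comm c₂]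

/-- A pruned Gaussian entry has the law of a rescaled Gaussian times an independent coin. -/
theorem map_pruneGap {d : ℝ} {Ψ : NNReal} (hd : 0 < d) (hΨ : 0 < Ψ) :
    ((gaussianReal 0 Ψ).prod (volume.restrict (Set.Icc (0 : ℝ) 1))).map (pruneGap d Ψ) =
      ((coin (Real.sqrt (d / (d + 2)))).prod (gaussianReal 0 1)).map
        (fun x => Real.sqrt (Ψ * (d / (d + 2))) * (bit x.1 * x.2)) := by
  set p : ℝ := Real.sqrt (d / (d + 2)) with hp
  have hq0 : 0 < d / (d + 2) := by positivity
  have hp1 : p ≤ 1 := Real.sqrt_le_one.2 ((div_le_one (by linarith)).2 (by linarith))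
  have hp0 : 0 ≤ p := Real.sqrt_nonneg _
  have hΨ0 : (0 : ℝ) < Ψ := hΨ
  have := isProbabilityMeasure_coin hp0 hp1
  have hmk : Measurable fun x : Bool × ℝ => Real.sqrt (Ψ * (d / (d + 2))) * (bit x.1 * x.2) :=
    measurable_from_prod_countable_right fun b => by fun_prop
  obtain ⟨τ, hτv⟩ : ∃ τ : NNReal, (τ : ℝ) = Ψ * (d / (d + 2)) :=
    ⟨⟨_, (mul_pos hΨ0 hq0).le⟩, rfl⟩
  have hτ0 : τ ≠ 0 := by
    intro h
    rw [h, NNReal.coe_zero] at hτv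
    exact (mul_pos hΨ0 hq0).ne hτv
  -- The tilted variance `τ` satisfies `1/τ = 1/Ψ + 2/(d Ψ)`, and the tilted mass is `√(τ / Ψ) = p`.
  -- The complementary mass `1 - p` sits at zero.
  have htilt : ∀ f : ℝ → ENNReal, Measurable f →
      ∫⁻ a, ENNReal.ofReal (Real.exp (-a ^ 2 / (d * Ψ))) * f a ∂gaussianReal 0 Ψ =
        ENNReal.ofReal p * ∫⁻ a, f a ∂gaussianReal 0 τ := by
    intro f hf
    have h := lintegral_gaussianReal_tilt hΨ.ne' hτ0 (c := 1 / (d * Ψ))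
      (by rw [hτv]; field_simp) hf
    have e1 : Real.sqrt ((τ : ℝ) / Ψ) = p := by rw [hτv, hp]; congr 1; field_simp
    rw [e1] at h
    rw [← h]
    refine lintegral_congr fun a => ?_
    congr 3
    ring
  refine Measure.ext_of_lintegral _ fun f hf => ?_
  rw [lintegral_map hf (measurable_pruneGap _ _), lintegral_map hf hmk,
    lintegral_prod (fun x => f (pruneGap d Ψ x))
      (hf.comp (measurable_pruneGap _ _)).aemeasurable,
    lintegral_prod (fun x : Bool × ℝ => f (Real.sqrt (Ψ * (d / (d + 2))) * (bit x.1 * x.2)))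
      (hf.comp hmk).aemeasurable, lintegral_coin]
  have hin : ∀ a : ℝ, ∫⁻ v, f (pruneGap d Ψ (a, v)) ∂(volume.restrict (Set.Icc (0 : ℝ) 1)) =
      ENNReal.ofReal (Real.exp (-a ^ 2 / (d * Ψ))) * f a +
        ENNReal.ofReal (1 - Real.exp (-a ^ 2 / (d * Ψ))) * f 0 := by
    intro a
    rw [← lintegral_threshold_uniform (Real.exp_pos _).le
      (Real.exp_le_one_iff.2 (div_nonpos_of_nonpos_of_nonneg
        (neg_nonpos.2 (sq_nonneg a)) (by positivity)))]
    refine lintegral_congr fun v => ?_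
    simp only [pruneGap]
    split_ifs <;> rfl
  simp_rw [hin]
  have hrest : ∫⁻ a, ENNReal.ofReal (1 - Real.exp (-a ^ 2 / (d * Ψ))) ∂gaussianReal 0 Ψ =
      ENNReal.ofReal (1 - p) := by
    have h1 := htilt (fun _ => 1) measurable_const
    simp only [mul_one, lintegral_const, measure_univ] at h1
    have h2 : ∫⁻ a, ENNReal.ofReal (1 - Real.exp (-a ^ 2 / (d * Ψ))) ∂gaussianReal 0 Ψ +
        ∫⁻ a, ENNReal.ofReal (Real.exp (-a ^ 2 / (d * Ψ))) ∂gaussianReal 0 Ψ = 1 := by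
      rw [← lintegral_add_left (by fun_prop)]
      calc _ = ∫⁻ _, 1 ∂gaussianReal 0 Ψ := by
            refine lintegral_congr fun a => ?_
            rw [← ENNReal.ofReal_add _ (Real.exp_pos _).le]
            · simp
            · exact sub_nonneg.2 (Real.exp_le_one_iff.2 (div_nonpos_of_nonpos_of_nonneg
                (neg_nonpos.2 (sq_nonneg a)) (by positivity)))
        _ = 1 := by simp
    rw [h1] at h2
    rw [ENNReal.eq_sub_of_add_eq ENNReal.ofReal_ne_top h2, ENNReal.ofReal_sub _ hp0,
      ENNReal.ofReal_one]
  rw [lintegral_add_left (by fun_prop), htilt f hf, lintegral_mul_const _ (by fun_prop), hrest]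
  simp only [bit, if_true, one_mul, Bool.false_eq_true, if_false, zero_mul,
    mul_zero, lintegral_const, measure_univ, mul_one]
  congr 2
  have hg := gaussianReal_map_const_mul (μ := 0) (v := 1) (Real.sqrt (Ψ * (d / (d + 2))))
  have hτ : NNReal.mk (Real.sqrt (Ψ * (d / (d + 2))) ^ 2) (sq_nonneg _) * 1 = τ := by
    rw [mul_one]
    refine NNReal.eq ?_
    rw [hτv]
    exact Real.sq_sqrt (mul_pos hΨ0 hq0).le
  rw [mul_zero, hτ] at hg
  rw [← hg, lintegral_map hf (by fun_prop)]

/-- A matrix and its transpose have the same operator norm, so bounds for row vectors in the unit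
ball suffice. -/
theorem l2_opNorm_le_of_rowMul {m n : ℕ} (X : Matrix (Fin m) (Fin n) ℝ) {c : ℝ} (hc : 0 ≤ c)
    (h : ∀ w : Fin m → ℝ, ∑ i, w i ^ 2 ≤ 1 → ‖rowMul X w‖ ≤ c) : ‖X‖ ≤ c := by
  rw [← Matrix.l2_opNorm_conjTranspose, Matrix.l2_opNorm_def]
  refine ContinuousLinearMap.opNorm_le_bound _ hc fun w => ?_
  have key : ∀ v : EuclideanSpace ℝ (Fin m), ‖v‖ ≤ 1 →
      ‖Matrix.toEuclideanLin X.conjTranspose v‖ ≤ c := by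
    intro v hv
    have h1 : ∑ i, v i ^ 2 ≤ 1 := by
      rw [← EuclideanSpace.real_norm_sq_eq]; exact pow_le_one₀ (norm_nonneg _) hv
    have h2 : Matrix.toEuclideanLin X.conjTranspose v = rowMul X v.ofLp := by
      ext j
      simp [rowMul, Matrix.toLpLin_apply, Matrix.mulVec, Matrix.vecMul, dotProduct, mul_comm]
    rw [h2]; exact h _ h1
  change ‖Matrix.toEuclideanLin X.conjTranspose w‖ ≤ c * ‖w‖
  rcases eq_or_ne w 0 with rfl | hw
  · simp
  · have hn : 0 < ‖w‖ := norm_pos_iff.2 hw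
    have h3 := key (‖w‖⁻¹ • w) (by rw [norm_smul, norm_inv, norm_norm, inv_mul_cancel₀ hn.ne'])
    rw [map_smul, norm_smul, norm_inv, norm_norm, inv_mul_le_iff₀ hn] at h3
    rwa [mul_comm]

end PrunedNet

/-! ### The pruning error of one layer -/

namespace PrunedNet

/-- The law of one entry of the pruning error, for entries on and off the diagonal. -/
theorem map_entry_pruneGap {d : ℝ} {Ψ : NNReal} (hd : 0 < d) (hΨ : 0 < Ψ) (off : Prop)
    [Decidable off] :
    ((gaussianReal 0 Ψ).prod (volume.restrict (Set.Icc (0 : ℝ) 1))).map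
        (fun x => if off then pruneGap d Ψ x else 0) =
      ((coin (if off then Real.sqrt (d / (d + 2)) else 0)).prod (gaussianReal 0 1)).map
        (fun x => Real.sqrt (Ψ * (d / (d + 2))) * (bit x.1 * x.2)) := by
  by_cases h : off
  · simp only [if_pos h]
    exact map_pruneGap hd hΨ
  · simp only [if_neg h]
    have := isProbabilityMeasure_coin le_rfl zero_le_one
    have hU : IsProbabilityMeasure (volume.restrict (Set.Icc (0 : ℝ) 1)) := ⟨by simp⟩
    have hmk : Measurable fun x : Bool × ℝ => Real.sqrt (Ψ * (d / (d + 2))) * (bit x.1 * x.2) :=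
      measurable_from_prod_countable_right fun b => by fun_prop
    refine Measure.ext_of_lintegral _ fun f hf => ?_
    rw [lintegral_map hf measurable_const, lintegral_map hf hmk,
      lintegral_prod (fun x : Bool × ℝ => f (Real.sqrt (Ψ * (d / (d + 2))) * (bit x.1 * x.2)))
        (hf.comp hmk).aemeasurable, lintegral_coin]
    simp [bit]

theorem sub_prune_apply {m n : ℕ} (d Ψ : ℝ) (u A : Matrix (Fin m) (Fin n) ℝ) (i : Fin m)
    (j : Fin n) : (A - prune d Ψ u A) i j =
      if (i : ℕ) ≠ (j : ℕ) then pruneGap d Ψ (A i j, u i j) else 0 := by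
  rw [Matrix.sub_apply]
  simp only [prune, Matrix.of_apply, pruneGap]
  by_cases h1 : (i : ℕ) ≠ (j : ℕ)
  · by_cases h2 : u i j ≤ Real.exp (-(A i j) ^ 2 / (d * Ψ))
    · rw [if_pos ⟨h1, h2⟩, if_pos h1, if_pos h2, sub_zero]
    · rw [if_neg fun h => h2 h.2, if_pos h1, if_neg h2, sub_self]
  · rw [if_neg fun h => h1 h.1, if_neg h1, sub_self]

/-- The hypotheses on one layer: i.i.d. Gaussian weights, i.i.d. uniform coins independent of the
weights. -/
structure LayerModel {Ω : Type*} [MeasurableSpace Ω] (μ : Measure Ω) {m n : ℕ} (Ψ : NNReal)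
    (A u : Ω → Matrix (Fin m) (Fin n) ℝ) : Prop where
  measurable_weight : ∀ i j, Measurable fun ω => A ω i j
  measurable_coin : ∀ i j, Measurable fun ω => u ω i j
  map_weight : ∀ i j, μ.map (fun ω => A ω i j) = gaussianReal 0 Ψ
  map_coin : ∀ i j, μ.map (fun ω => u ω i j) = volume.restrict (Set.Icc (0 : ℝ) 1)
  indep_weight : iIndepFun (fun (q : Fin m × Fin n) ω => A ω q.1 q.2) μ
  indep_coin : iIndepFun (fun (q : Fin m × Fin n) ω => u ω q.1 q.2) μ
  indep : IndepFun (fun ω (q : Fin m × Fin n) => A ω q.1 q.2)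
    (fun ω (q : Fin m × Fin n) => u ω q.1 q.2) μ

namespace LayerModel

variable {Ω : Type*} [MeasurableSpace Ω] {μ : Measure Ω} {m n : ℕ} {Ψ : NNReal}
  {A u : Ω → Matrix (Fin m) (Fin n) ℝ}

theorem transpose (h : LayerModel μ Ψ A u) :
    LayerModel μ Ψ (fun ω => (A ω).transpose) (fun ω => (u ω).transpose) where
  measurable_weight i j := h.measurable_weight j i
  measurable_coin i j := h.measurable_coin j i
  map_weight i j := h.map_weight j i
  map_coin i j := h.map_coin j i
  indep_weight := h.indep_weight.precomp (Equiv.prodComm (Fin n) (Fin m)).injective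
  indep_coin := h.indep_coin.precomp (Equiv.prodComm (Fin n) (Fin m)).injective
  indep := by
    have hs : Measurable fun (x : Fin m × Fin n → ℝ) (q : Fin n × Fin m) => x q.swap :=
      measurable_pi_lambda _ fun q => measurable_pi_apply _
    exact h.indep.comp hs hs

theorem map_eq_prod [IsProbabilityMeasure μ] (h : LayerModel μ Ψ A u) :
    μ.map (fun ω => ((fun q : Fin m × Fin n => A ω q.1 q.2),
        (fun q : Fin m × Fin n => u ω q.1 q.2))) =
      (Measure.pi fun _ : Fin m × Fin n => gaussianReal 0 Ψ).prod
        (Measure.pi fun _ => volume.restrict (Set.Icc (0 : ℝ) 1)) := by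
  have hA : ∀ q : Fin m × Fin n, Measurable fun ω => A ω q.1 q.2 := fun q =>
    h.measurable_weight _ _
  have hu : ∀ q : Fin m × Fin n, Measurable fun ω => u ω q.1 q.2 := fun q =>
    h.measurable_coin _ _
  rw [(indepFun_iff_map_prod_eq_prod_map_map (measurable_pi_lambda _ hA).aemeasurable
    (measurable_pi_lambda _ hu).aemeasurable).1 h.indep,
    (iIndepFun_iff_map_fun_eq_pi_map fun q => (hA q).aemeasurable).1 h.indep_weight,
    (iIndepFun_iff_map_fun_eq_pi_map fun q => (hu q).aemeasurable).1 h.indep_coin]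
  simp_rw [h.map_weight, h.map_coin]

/-- All entries of the error are functions of independent (weight, coin) pairs, so agreement of the
one-entry laws gives agreement of the laws of the whole matrices, and `measure_masked_le` carries
over. The mask parameter is `p` off the diagonal and `0` on it; only the upper bound `p` is needed.
-/
theorem measure_pruning_error_wide_le [IsProbabilityMeasure μ] (h : LayerModel μ Ψ A u)
    (hm : 0 < m) (hmn : m ≤ n) {d ε : ℝ} (hd : 0 < d) (hΨ : 0 < Ψ) (hε : 1 ≤ ε) :
    μ.real {ω | ¬ ‖A ω - prune d Ψ (u ω) (A ω)‖ ≤ Real.sqrt (Ψ * (d / (d + 2))) *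
      (98 * ε * Real.sqrt (Real.sqrt (d / (d + 2)) * n +
        Real.sqrt (m * n * Real.sqrt (d / (d + 2)))))} ≤ 1 / ε := by
  classical
  set p : ℝ := Real.sqrt (d / (d + 2)) with hp
  set c : ℝ := 98 * ε * Real.sqrt (p * n + Real.sqrt (m * n * p)) with hc
  set s : ℝ := Real.sqrt (Ψ * (d / (d + 2))) with hs
  have hp0 : 0 < p := Real.sqrt_pos.2 (by positivity)
  have hp1 : p ≤ 1 := Real.sqrt_le_one.2 ((div_le_one (by linarith)).2 (by linarith))
  have hs0 : 0 ≤ s := Real.sqrt_nonneg _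
  have hU : IsProbabilityMeasure (volume.restrict (Set.Icc (0 : ℝ) 1)) := ⟨by simp⟩
  set pt : Fin m × Fin n → ℝ := fun t => if (t.1 : ℕ) ≠ (t.2 : ℕ) then p else 0 with hpt
  have hpt0 : ∀ t, 0 ≤ pt t := fun t => by simp only [hpt]; split_ifs <;> linarith
  have hptp : ∀ t, pt t ≤ p := fun t => by simp only [hpt]; split_ifs <;> linarith
  have hcoin : ∀ t, IsProbabilityMeasure (coin (pt t)) := fun t =>
    isProbabilityMeasure_coin (hpt0 t) ((hptp t).trans hp1)
  set E : Set (Fin m × Fin n → ℝ) := {z | ¬ ‖Matrix.of fun i j => z (i, j)‖ ≤ s * c} with hE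
  have hEm : MeasurableSet E := by
    have hcont : Continuous fun z : Fin m × Fin n → ℝ =>
        ‖(Matrix.of fun i j => z (i, j) : Matrix (Fin m) (Fin n) ℝ)‖ :=
      continuous_norm.comp (continuous_matrix fun i j => continuous_apply _)
    exact (isClosed_le hcont continuous_const).measurableSet.compl
  set f : Fin m × Fin n → ℝ × ℝ → ℝ := fun t x =>
    if (t.1 : ℕ) ≠ (t.2 : ℕ) then pruneGap d Ψ x else 0 with hf
  set k : Fin m × Fin n → Bool × ℝ → ℝ := fun _ x => s * (bit x.1 * x.2) with hk
  have hfm : ∀ t, Measurable (f t) := fun t => by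
    simp only [hf]
    split_ifs
    · exact measurable_pruneGap _ _
    · exact measurable_const
  have hkm : ∀ t, Measurable (k t) := fun t =>
    measurable_from_prod_countable_right fun b => by simp only [hk]; fun_prop
  have hlaw : μ.map (fun ω t => f t (A ω t.1 t.2, u ω t.1 t.2)) =
      (maskGauss fun t => coin (pt t)).map (fun z t => k t (z.1 t, z.2 t)) := by
    have h1 := map_prod_pi (fun _ : Fin m × Fin n => gaussianReal 0 Ψ)
      (fun _ => volume.restrict (Set.Icc (0 : ℝ) 1)) hfm
    rw [← h.map_eq_prod, Measure.map_map (by fun_prop)] at h1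
    · rw [maskGauss, map_prod_pi _ _ hkm]
      refine h1.trans ?_
      congr 1
      funext t
      exact map_entry_pruneGap hd hΨ _
    · exact (measurable_pi_lambda _ fun q => h.measurable_weight _ _).prodMk
        (measurable_pi_lambda _ fun q => h.measurable_coin _ _)
  have hZ : Measurable fun ω (t : Fin m × Fin n) => f t (A ω t.1 t.2, u ω t.1 t.2) :=
    measurable_pi_lambda _ fun t =>
      (hfm t).comp ((h.measurable_weight _ _).prodMk (h.measurable_coin _ _))
  have hK : Measurable fun (z : (Fin m × Fin n → Bool) × (Fin m × Fin n → ℝ)) t =>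
      k t (z.1 t, z.2 t) := by fun_prop
  have hpre : {ω | ¬ ‖A ω - prune d Ψ (u ω) (A ω)‖ ≤ s * c} =
      (fun ω (t : Fin m × Fin n) => f t (A ω t.1 t.2, u ω t.1 t.2)) ⁻¹' E := by
    ext ω
    have : A ω - prune d Ψ (u ω) (A ω) =
        Matrix.of fun i j => f (i, j) (A ω i j, u ω i j) := by
      ext i j
      exact sub_prune_apply d Ψ (u ω) (A ω) i j
    simp only [hE, this, Set.mem_ofPred_eq, Set.mem_preimage]
  rw [hpre, measureReal_def, ← Measure.map_apply hZ hEm, hlaw, Measure.map_apply hK hEm,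
    ← measureReal_def]
  refine le_trans (measureReal_mono ?_ (measure_ne_top _ _)) (measure_masked_le
    (fun t => coin (pt t)) (Q := p * n + Real.sqrt (m * n * p)) hp0
    (fun t => (coin_true (hpt0 t)).le.trans (hptp t)) hε (by simpa using hm)
    (by simpa using hmn) (by simp))
  intro z hz hcon
  refine hz ?_
  have hmat : (Matrix.of fun i j => k (i, j) (z.1 (i, j), z.2 (i, j)) :
      Matrix (Fin m) (Fin n) ℝ) = s • masked z.1 z.2 := by
    ext i j; simp [hk, masked]
  change ‖(Matrix.of fun i j => k (i, j) (z.1 (i, j), z.2 (i, j)) :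
    Matrix (Fin m) (Fin n) ℝ)‖ ≤ s * c
  rw [hmat, norm_smul, Real.norm_of_nonneg hs0]
  exact mul_le_mul_of_nonneg_left (l2_opNorm_le_of_rowMul _ (by positivity) hcon) hs0

end LayerModel

theorem pruneScale_comm (C d Ψ : ℝ) (m n : ℕ) : pruneScale C d Ψ m n = pruneScale C d Ψ n m := by
  unfold pruneScale
  rw [add_comm (Real.sqrt m), mul_right_comm (3 : ℝ)]

theorem pruneScale_nonneg {C d Ψ : ℝ} (hC : 0 ≤ C) (hd : 0 < d) (m n : ℕ) :
    0 ≤ pruneScale C d Ψ m n := by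
  unfold pruneScale
  positivity

theorem sqrt_add_le {a b : ℝ} (ha : 0 ≤ a) (hb : 0 ≤ b) :
    Real.sqrt (a + b) ≤ Real.sqrt a + Real.sqrt b := by
  rw [Real.sqrt_le_left (by positivity), add_sq, Real.sq_sqrt ha, Real.sq_sqrt hb]
  have : 0 ≤ 2 * Real.sqrt a * Real.sqrt b := by positivity
  linarith

/-- In terms of `p` the two terms of the scale are `√(Ψ p³) (√m + √n)` and `(3 m n p⁵ Ψ²)^(1/4)`.
Subadditivity of the square root splits the left side into matching terms, and `98 ≤ 200 / 2`. -/
theorem sqrt_mul_le_pruneScale {d Ψ : ℝ} (hd : 0 < d) (hΨ : 0 ≤ Ψ) (m n : ℕ) :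
    Real.sqrt (Ψ * (d / (d + 2))) * (98 * Real.sqrt (Real.sqrt (d / (d + 2)) * n +
        Real.sqrt (m * n * Real.sqrt (d / (d + 2))))) ≤ pruneScale 200 d Ψ m n / 2 := by
  set q : ℝ := d / (d + 2) with hq
  have hq0 : 0 < q := by positivity
  set p : ℝ := Real.sqrt q with hp
  have hp0 : 0 < p := Real.sqrt_pos.2 hq0
  have hqp : q = p ^ 2 := (Real.sq_sqrt hq0.le).symm
  have hpow : ∀ k : ℕ, q ^ ((k : ℝ) / 2) = p ^ k := fun k => by
    rw [hp, Real.sqrt_eq_rpow, ← Real.rpow_natCast, ← Real.rpow_mul hq0.le]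
    congr 1; ring
  have h3 : d ^ (3 / 2 : ℝ) * Ψ / (d + 2) ^ (3 / 2 : ℝ) = Ψ * p ^ 3 := by
    rw [← hpow 3, hq, Real.div_rpow hd.le (by positivity)]; push_cast; ring
  have h5 : 3 * m * n * d ^ (5 / 2 : ℝ) * Ψ ^ 2 / (d + 2) ^ (5 / 2 : ℝ) =
      3 * (m * n) * p ^ 5 * Ψ ^ 2 := by
    rw [← hpow 5, hq, Real.div_rpow hd.le (by positivity)]; push_cast; ring
  have h4 : ∀ x : ℝ, 0 ≤ x → x ^ (1 / 4 : ℝ) = Real.sqrt (Real.sqrt x) := fun x hx => by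
    rw [Real.sqrt_eq_rpow, Real.sqrt_eq_rpow, ← Real.rpow_mul hx]; norm_num
  unfold pruneScale
  rw [h3, h5, h4 _ (by positivity), hqp]
  set N : ℝ := m * n * p with hN
  have hN0 : 0 ≤ N := by positivity
  have e1 : Real.sqrt (Ψ * p ^ 2) * Real.sqrt (p * n + Real.sqrt N) ≤
      Real.sqrt (Ψ * p ^ 3) * Real.sqrt n + Real.sqrt (Ψ * p ^ 2 * Real.sqrt N) := by
    rw [← Real.sqrt_mul (by positivity), ← Real.sqrt_mul (by positivity)]
    have : Ψ * p ^ 2 * (p * n + Real.sqrt N) = Ψ * p ^ 3 * n + Ψ * p ^ 2 * Real.sqrt N := by ring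
    rw [this]
    exact sqrt_add_le (by positivity) (by positivity)
  have e2 : Ψ * p ^ 2 * Real.sqrt N ≤ Real.sqrt (3 * (m * n) * p ^ 5 * Ψ ^ 2) := by
    refine Real.le_sqrt_of_sq_le ?_
    rw [mul_pow, Real.sq_sqrt hN0, hN]
    have : (0 : ℝ) ≤ m * n * p ^ 5 * Ψ ^ 2 := by positivity
    nlinarith
  have e3 := Real.sqrt_le_sqrt e2
  have e4 : 0 ≤ Real.sqrt (Ψ * p ^ 3) * Real.sqrt m := by positivity
  have e5 : 0 ≤ Real.sqrt (Ψ * p ^ 3) * Real.sqrt n := by positivity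
  have e6 : 0 ≤ Real.sqrt (Real.sqrt (3 * (m * n) * p ^ 5 * Ψ ^ 2)) := Real.sqrt_nonneg _
  nlinarith

theorem prune_transpose {m n : ℕ} (d Ψ : ℝ) (u A : Matrix (Fin m) (Fin n) ℝ) :
    prune d Ψ u.transpose A.transpose = (prune d Ψ u A).transpose := by
  ext i j
  simp only [prune, Matrix.transpose_apply, Matrix.of_apply]
  exact if_congr (and_congr_left' ne_comm) rfl rfl

/-- The pruning error of a layer exceeds half of `ε Γ` with probability at most `1 / ε`. -/
theorem LayerModel.measure_pruning_error_le {Ω : Type*} [MeasurableSpace Ω] {μ : Measure Ω}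
    [IsProbabilityMeasure μ] {m n : ℕ} {Ψ : NNReal} {A u : Ω → Matrix (Fin m) (Fin n) ℝ}
    (h : LayerModel μ Ψ A u) {d ε : ℝ} (hd : 0 < d) (hΨ : 0 < Ψ) (hε : 0 < ε) :
    μ.real {ω | ¬ ‖A ω - prune d Ψ (u ω) (A ω)‖ ≤ ε * pruneScale 200 d Ψ m n / 2} ≤ 1 / ε := by
  -- For `ε < 1` the claimed probability bound exceeds `1`.
  rcases lt_or_ge ε 1 with hε1 | hε1
  · exact measureReal_le_one.trans ((one_le_div hε).2 hε1.le)
  have wide : ∀ {m n : ℕ} {A u : Ω → Matrix (Fin m) (Fin n) ℝ}, LayerModel μ Ψ A u → m ≤ n →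
      μ.real {ω | ¬ ‖A ω - prune d Ψ (u ω) (A ω)‖ ≤ ε * pruneScale 200 d Ψ m n / 2} ≤ 1 / ε := by
    intro m n A u h hmn
    rcases Nat.eq_zero_or_pos m with rfl | hm
    · have hemp : {ω | ¬ ‖A ω - prune d Ψ (u ω) (A ω)‖ ≤ ε * pruneScale 200 d Ψ 0 n / 2} = ∅ := by
        ext ω
        simp only [Set.mem_ofPred_eq, Set.mem_empty_iff_false, iff_false, not_not]
        rw [Subsingleton.elim (A ω - prune d Ψ (u ω) (A ω)) 0, norm_zero]
        have := pruneScale_nonneg (C := 200) (Ψ := Ψ) (by norm_num) hd 0 n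
        positivity
      rw [hemp, measureReal_empty]; positivity
    · refine le_trans (measureReal_mono ?_ (measure_ne_top _ _))
        (h.measure_pruning_error_wide_le hm hmn hd hΨ hε1)
      intro ω hω hcon
      refine hω (hcon.trans ?_)
      have := mul_le_mul_of_nonneg_left (sqrt_mul_le_pruneScale hd Ψ.coe_nonneg m n) hε.le
      linarith
  rcases le_total m n with hmn | hmn
  · exact wide h hmn
  -- Pruning commutes with transposition because the diagonal is preserved, and the scale is
  -- symmetric in the two dimensions.
  · have := wide h.transpose hmn
    rw [pruneScale_comm] at this
    convert this using 6 with ω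
    rw [prune_transpose, ← Matrix.transpose_sub, ← Matrix.conjTranspose_eq_transpose_of_trivial,
      Matrix.l2_opNorm_conjTranspose]

end PrunedNet

namespace PrunedNet

/-! ### Perturbation of the network -/

theorem norm_toEuclideanLin_le {m n : ℕ} (M : Matrix (Fin m) (Fin n) ℝ)
    (x : EuclideanSpace ℝ (Fin n)) : ‖Matrix.toEuclideanLin M x‖ ≤ ‖M‖ * ‖x‖ :=
  Matrix.l2_opNorm_mulVec M x

/-- Zero entries are not changed by rounding, so the Frobenius norm of the error is at most `√J * ρ
/ 2`, where `J` is the number of nonzero entries. As `J` is an integer, `√J ≤ J`. -/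
theorem norm_sub_discretize_le {m n : ℕ} {ρ : ℝ} (hρ : 0 < ρ) (X : Matrix (Fin m) (Fin n) ℝ) :
    ‖X - discretize ρ X‖ ≤ ρ * numNonzero X / 2 := by
  refine l2_opNorm_le_of_rowMul _ (by positivity) fun w hw => ?_
  refine abs_le_of_sq_le_sq' ?_ (by positivity) |>.2
  have hentry : ∀ t : Fin m × Fin n, (X - discretize ρ X) t.1 t.2 ^ 2 ≤
      if X t.1 t.2 ≠ 0 then (ρ / 2) ^ 2 else 0 := by
    intro t
    simp only [discretize, Matrix.sub_apply, Matrix.of_apply]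
    split_ifs with h
    · have h1 : X t.1 t.2 - ρ * (round (X t.1 t.2 / ρ) : ℝ) =
          ρ * (X t.1 t.2 / ρ - round (X t.1 t.2 / ρ)) := by field_simp
      rw [h1, mul_pow, div_pow, ← sq_abs (_ - _ : ℝ)]
      have h2 := abs_sub_round (X t.1 t.2 / ρ)
      have h3 := pow_le_pow_left₀ (abs_nonneg _) h2 2
      calc _ ≤ ρ ^ 2 * (1 / 2) ^ 2 := mul_le_mul_of_nonneg_left h3 (sq_nonneg _)
        _ = _ := by ring
    · rw [not_not.1 h]; simp
  calc ‖rowMul (X - discretize ρ X) w‖ ^ 2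
      ≤ ∑ j, ∑ i, (X - discretize ρ X) i j ^ 2 := by
        rw [norm_rowMul_sq]
        refine Finset.sum_le_sum fun j _ => (Finset.sum_mul_sq_le_sq_mul_sq _ _ _).trans ?_
        exact mul_le_of_le_one_right (Finset.sum_nonneg fun i _ => sq_nonneg _) hw
    _ = ∑ t : Fin m × Fin n, (X - discretize ρ X) t.1 t.2 ^ 2 := by
        rw [Fintype.sum_prod_type_right]
    _ ≤ ∑ t : Fin m × Fin n, if X t.1 t.2 ≠ 0 then (ρ / 2) ^ 2 else 0 :=
        Finset.sum_le_sum fun t _ => hentry t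
    _ = numNonzero X * (ρ / 2) ^ 2 := by
        rw [← Finset.sum_filter, Finset.sum_const, nsmul_eq_mul, numNonzero]
    _ ≤ (numNonzero X : ℝ) ^ 2 * (ρ / 2) ^ 2 := by
        refine mul_le_mul_of_nonneg_right ?_ (sq_nonneg _)
        exact_mod_cast Nat.le_self_pow two_ne_zero _
    _ = _ := by ring

/-- The error after a layer splits into the propagated old error and the new matrix error applied to
the perturbed activations. Each perturbed layer has norm at most `(1 + 1/L) ‖A l‖`, so both
estimates go through one induction and relative errors add. -/
theorem norm_forward_le {w : ℕ → ℕ} {φ : Activations w} {lip : ℕ → NNReal} {L : ℕ}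
    (hφ : ∀ l, 1 ≤ l → l < L → LipschitzWith (lip l) (φ l) ∧ φ l 0 = 0)
    {A A' : Weights w} {e : ℕ → ℝ} (he : ∀ l < L, ‖A l - A' l‖ ≤ e l)
    (heA : ∀ l < L, e l ≤ ‖A l‖ / L) (x : EuclideanSpace ℝ (Fin (w 0))) (l : ℕ) (hl : l ≤ L) :
    ‖forward φ A' l x‖ ≤ (1 + 1 / (L : ℝ)) ^ l *
        ((∏ k ∈ Finset.Ico 1 l, (lip k : ℝ)) * ∏ k ∈ Finset.range l, ‖A k‖) * ‖x‖ ∧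
      ‖forward φ A l x - forward φ A' l x‖ ≤ (1 + 1 / (L : ℝ)) ^ l *
        ((∏ k ∈ Finset.Ico 1 l, (lip k : ℝ)) * ∏ k ∈ Finset.range l, ‖A k‖) *
        (∑ k ∈ Finset.range l, e k / ‖A k‖) * ‖x‖ := by
  set c : ℝ := 1 + 1 / (L : ℝ) with hc
  have hc1 : 1 ≤ c := by rw [hc]; linarith [show (0 : ℝ) ≤ 1 / L by positivity]
  have he0 : ∀ l < L, 0 ≤ e l := fun l hl => (norm_nonneg _).trans (he l hl)
  have hA' : ∀ l < L, ‖A' l‖ ≤ c * ‖A l‖ := fun l hl => by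
    have h1 : A' l = A l - (A l - A' l) := by abel
    have h2 := norm_sub_le (A l) (A l - A' l)
    rw [← h1] at h2
    have h3 := (he l hl).trans (heA l hl)
    rw [hc, add_mul, one_mul, one_div_mul_eq_div]
    linarith
  -- This remains true when `‖A l‖ = 0`: division by zero gives zero, and `heA` then forces `e l =
  -- 0`.
  have hdiv : ∀ l < L, e l = e l / ‖A l‖ * ‖A l‖ := fun l hl => by
    rcases eq_or_ne ‖A l‖ 0 with h | h
    · have := heA l hl
      rw [h, zero_div] at this
      rw [h, mul_zero]; exact le_antisymm this (he0 l hl)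
    · field_simp
  induction l with
  | zero => simp [forward]
  | succ l ih =>
    cases l with
    | zero =>
      have h0 : 0 < L := hl
      simp only [forward, zero_add, pow_one, Finset.Ico_self, Finset.prod_empty, one_mul,
        Finset.prod_range_one, Finset.sum_range_one]
      refine ⟨(norm_toEuclideanLin_le _ _).trans
        (mul_le_mul_of_nonneg_right (hA' 0 h0) (norm_nonneg _)), ?_⟩
      rw [← LinearMap.sub_apply, ← map_sub]
      refine (norm_toEuclideanLin_le _ _).trans (mul_le_mul_of_nonneg_right ?_ (norm_nonneg _))
      refine (he 0 h0).trans ?_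
      rw [mul_assoc, mul_comm ‖A 0‖, ← hdiv 0 h0]
      exact le_mul_of_one_le_left (he0 0 h0) hc1
    | succ l =>
      obtain ⟨ih1, ih2⟩ := ih (by omega)
      have hlL : l + 1 < L := hl
      obtain ⟨hlip, hzero⟩ := hφ (l + 1) (by omega) hlL
      set y := forward φ A (l + 1) x with hy
      set z := forward φ A' (l + 1) x with hz
      set P : ℝ := (∏ k ∈ Finset.Ico 1 (l + 1), (lip k : ℝ)) *
        ∏ k ∈ Finset.range (l + 1), ‖A k‖ with hP
      set s : ℝ := ∑ k ∈ Finset.range (l + 1), e k / ‖A k‖ with hs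
      have hP0 : 0 ≤ P := mul_nonneg (Finset.prod_nonneg fun k _ => NNReal.coe_nonneg _)
        (Finset.prod_nonneg fun k _ => norm_nonneg _)
      have hs0 : 0 ≤ s := Finset.sum_nonneg fun k hk =>
        div_nonneg (he0 k (by have := Finset.mem_range.1 hk; omega)) (norm_nonneg _)
      have hr0 : 0 ≤ e (l + 1) / ‖A (l + 1)‖ := div_nonneg (he0 _ hlL) (norm_nonneg _)
      have hprod : (∏ k ∈ Finset.Ico 1 (l + 1 + 1), (lip k : ℝ)) *
          ∏ k ∈ Finset.range (l + 1 + 1), ‖A k‖ = P * (lip (l + 1) * ‖A (l + 1)‖) := by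
        rw [Finset.prod_Ico_succ_top (by omega), Finset.prod_range_succ, hP]; ring
      rw [hprod, Finset.sum_range_succ, ← hs]
      have hz1 : ‖φ (l + 1) z‖ ≤ lip (l + 1) * ‖z‖ := by
        have := hlip.norm_sub_le z 0
        rwa [hzero, sub_zero, sub_zero] at this
      have hyz : ‖φ (l + 1) y - φ (l + 1) z‖ ≤ lip (l + 1) * ‖y - z‖ := hlip.norm_sub_le y z
      have hz2 : ‖φ (l + 1) z‖ ≤ lip (l + 1) * (c ^ (l + 1) * P * ‖x‖) :=
        hz1.trans (mul_le_mul_of_nonneg_left ih1 (NNReal.coe_nonneg _))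
      refine ⟨?_, ?_⟩
      · change ‖Matrix.toEuclideanLin (A' (l + 1)) (φ (l + 1) z)‖ ≤ _
        calc _ ≤ ‖A' (l + 1)‖ * ‖φ (l + 1) z‖ := norm_toEuclideanLin_le _ _
          _ ≤ (c * ‖A (l + 1)‖) * (lip (l + 1) * (c ^ (l + 1) * P * ‖x‖)) :=
              mul_le_mul (hA' _ hlL) hz2 (norm_nonneg _) (by positivity)
          _ = _ := by ring
      · change ‖Matrix.toEuclideanLin (A (l + 1)) (φ (l + 1) y) -
          Matrix.toEuclideanLin (A' (l + 1)) (φ (l + 1) z)‖ ≤ _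
        have hsplit : Matrix.toEuclideanLin (A (l + 1)) (φ (l + 1) y) -
            Matrix.toEuclideanLin (A' (l + 1)) (φ (l + 1) z) =
            Matrix.toEuclideanLin (A (l + 1)) (φ (l + 1) y - φ (l + 1) z) +
            Matrix.toEuclideanLin (A (l + 1) - A' (l + 1)) (φ (l + 1) z) := by
          rw [map_sub, map_sub, LinearMap.sub_apply]; abel
        rw [hsplit]
        have t1 : ‖Matrix.toEuclideanLin (A (l + 1)) (φ (l + 1) y - φ (l + 1) z)‖ ≤
            ‖A (l + 1)‖ * (lip (l + 1) * (c ^ (l + 1) * P * s * ‖x‖)) :=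
          (norm_toEuclideanLin_le _ _).trans (mul_le_mul_of_nonneg_left
            (hyz.trans (mul_le_mul_of_nonneg_left ih2 (NNReal.coe_nonneg _))) (norm_nonneg _))
        have t2 : ‖Matrix.toEuclideanLin (A (l + 1) - A' (l + 1)) (φ (l + 1) z)‖ ≤
            (e (l + 1) / ‖A (l + 1)‖ * ‖A (l + 1)‖) *
              (lip (l + 1) * (c ^ (l + 1) * P * ‖x‖)) := by
          rw [← hdiv _ hlL]
          exact (norm_toEuclideanLin_le _ _).trans
            (mul_le_mul (he _ hlL) hz2 (norm_nonneg _) (he0 _ hlL))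
        have hcpow : c ^ (l + 1) ≤ c ^ (l + 1 + 1) := pow_le_pow_right₀ hc1 (by omega)
        calc _ ≤ _ := norm_add_le _ _
          _ ≤ _ := add_le_add t1 t2
          _ = c ^ (l + 1) * (P * (lip (l + 1) * ‖A (l + 1)‖) *
              (s + e (l + 1) / ‖A (l + 1)‖) * ‖x‖) := by ring
          _ ≤ c ^ (l + 1 + 1) * (P * (lip (l + 1) * ‖A (l + 1)‖) *
              (s + e (l + 1) / ‖A (l + 1)‖) * ‖x‖) :=
              mul_le_mul_of_nonneg_right hcpow (by positivity)
          _ = _ := by ring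

theorem one_add_inv_pow_le_exp (L : ℕ) : (1 + 1 / (L : ℝ)) ^ L ≤ Real.exp 1 := by
  rcases Nat.eq_zero_or_pos L with rfl | hL
  · simp
  · have hL0 : (0 : ℝ) < L := Nat.cast_pos.2 hL
    calc (1 + 1 / (L : ℝ)) ^ L ≤ Real.exp (1 / L) ^ L :=
          pow_le_pow_left₀ (by positivity) (by linarith [Real.add_one_le_exp (1 / (L : ℝ))]) _
      _ = Real.exp 1 := by rw [← Real.exp_nat_mul]; congr 1; field_simp

/-- If the pruning errors are small, the outputs of the two networks differ by at most half of the
margin threshold. -/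
theorem norm_forward_sub_compressed_le {w : ℕ → ℕ} {φ : Activations w} {lip : ℕ → NNReal} {L : ℕ}
    (hφ : ∀ l, 1 ≤ l → l < L → LipschitzWith (lip l) (φ l) ∧ φ l 0 = 0)
    {C₀ d Ψ : ℝ} {ε ρ : ℕ → ℝ} {u A : Weights w} (hρ : ∀ l < L, 0 < ρ l)
    (hprune : ∀ l < L, ‖A l - prune d Ψ (u l) (A l)‖ ≤
      ε l * pruneScale C₀ d Ψ (w (l + 1)) (w l) / 2)
    (hfine : ∀ l < L, layerError C₀ d Ψ ε ρ u A l ≤ ‖A l‖ / L)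
    {x : EuclideanSpace ℝ (Fin (w 0))} (hx : ‖x‖ ≤ w 0) :
    ‖forward φ A L x - forward φ (compressed d Ψ ρ u A) L x‖ ≤
      marginThreshold C₀ d Ψ L lip ε ρ u A / 2 := by
  -- Pruning and rounding each use half of their share of `layerError`. The saved factor `1/2`
  -- becomes the `γ / 2` per output coordinate needed for the margin.
  have he : ∀ l < L, ‖A l - compressed d Ψ ρ u A l‖ ≤ layerError C₀ d Ψ ε ρ u A l / 2 := by
    intro l hl
    have h1 : A l - compressed d Ψ ρ u A l =
        (A l - prune d Ψ (u l) (A l)) + (pruned d Ψ u A l - discretize (ρ l) (pruned d Ψ u A l)) := by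
      simp only [compressed, pruned]; abel
    rw [h1]
    refine (norm_add_le _ _).trans ((add_le_add (hprune l hl)
      (norm_sub_discretize_le (hρ l hl) _)).trans (le_of_eq ?_))
    rw [layerError]; ring
  have he0 : ∀ l < L, 0 ≤ layerError C₀ d Ψ ε ρ u A l := fun l hl => by
    have := (norm_nonneg _).trans (he l hl)
    linarith
  have h := (norm_forward_le hφ he (fun l hl => by
    have := hfine l hl
    have := he0 l hl
    linarith) x L le_rfl).2
  refine h.trans ?_
  have hsum : ∑ k ∈ Finset.range L, layerError C₀ d Ψ ε ρ u A k / 2 / ‖A k‖ =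
      (∑ k ∈ Finset.range L, layerError C₀ d Ψ ε ρ u A k / ‖A k‖) / 2 := by
    rw [Finset.sum_div]
    exact Finset.sum_congr rfl fun k _ => by ring
  have hs0 : 0 ≤ ∑ k ∈ Finset.range L, layerError C₀ d Ψ ε ρ u A k / ‖A k‖ :=
    Finset.sum_nonneg fun k hk => div_nonneg (he0 k (Finset.mem_range.1 hk)) (norm_nonneg _)
  rw [hsum, marginThreshold]
  set s := ∑ k ∈ Finset.range L, layerError C₀ d Ψ ε ρ u A k / ‖A k‖
  set P : ℝ := (∏ k ∈ Finset.Ico 1 L, (lip k : ℝ)) * ∏ k ∈ Finset.range L, ‖A k‖ with hP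
  have hP0 : 0 ≤ P := mul_nonneg (Finset.prod_nonneg fun k _ => NNReal.coe_nonneg _)
        (Finset.prod_nonneg fun k _ => norm_nonneg _)
  calc (1 + 1 / (L : ℝ)) ^ L * P * (s / 2) * ‖x‖ ≤ Real.exp 1 * P * (s / 2) * w 0 := by
        refine mul_le_mul ?_ hx (norm_nonneg _) (by positivity)
        gcongr
        exact one_add_inv_pow_le_exp L
    _ = _ := by ring

/-- A margin compares two coordinates, each of which moves by at most `γ / 2`. -/
theorem MarginError.of_norm_sub_le {p k : ℕ} {f g : EuclideanSpace ℝ (Fin p) → EuclideanSpace ℝ (Fin k)}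
    {γ : ℝ} {z : EuclideanSpace ℝ (Fin p) × Fin k} (h : ‖f z.1 - g z.1‖ ≤ γ / 2)
    (hg : MarginError 0 g z) : MarginError γ f z := by
  obtain ⟨j, hj, hle⟩ := hg
  have hcoord : ∀ i, |f z.1 i - g z.1 i| ≤ γ / 2 := fun i => by
    have := (PiLp.norm_apply_le (f z.1 - g z.1) i).trans h
    simpa [Real.norm_eq_abs] using this
  refine ⟨j, hj, ?_⟩
  have h1 := (abs_le.1 (hcoord z.2)).2
  have h2 := (abs_le.1 (hcoord j)).1
  linarith

theorem empRisk_mono {p k n : ℕ} {s : Fin n → EuclideanSpace ℝ (Fin p) × Fin k} {γ γ' : ℝ}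
    {f g : EuclideanSpace ℝ (Fin p) → EuclideanSpace ℝ (Fin k)}
    (h : ∀ i, MarginError γ g (s i) → MarginError γ' f (s i)) :
    empRisk s γ g ≤ empRisk s γ' f := by
  classical
  refine mul_le_mul_of_nonneg_left (Finset.sum_le_sum fun i _ => ?_) (by positivity)
  simp only [Set.indicator_apply, Set.mem_ofPred_eq]
  by_cases h1 : MarginError γ g (s i)
  · rw [if_pos h1, if_pos (h i h1)]
  · rw [if_neg h1]
    split_ifs <;> norm_num

end PrunedNet

namespace PrunedNet

/-! ### Generalization for a finite class of networks -/

theorem continuous_toEuclideanLin {m n : ℕ} (M : Matrix (Fin m) (Fin n) ℝ) :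
    Continuous (Matrix.toEuclideanLin M) :=
  AddMonoidHomClass.continuous_of_bound _ ‖M‖ (norm_toEuclideanLin_le M)

theorem continuous_forward {w : ℕ → ℕ} {φ : Activations w} {L : ℕ}
    (hφ : ∀ l, 1 ≤ l → l < L → Continuous (φ l)) (W : Weights w) (l : ℕ) (hl : l ≤ L) :
    Continuous (forward φ W l) := by
  induction l with
  | zero => exact continuous_id
  | succ l ih =>
    cases l with
    | zero => exact continuous_toEuclideanLin (W 0)
    | succ l =>
      exact (continuous_toEuclideanLin (W (l + 1))).comp
        ((hφ (l + 1) (by omega) (by omega)).comp (ih (by omega)))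

theorem forward_congr {w : ℕ → ℕ} {φ : Activations w} {W W' : Weights w} {L : ℕ}
    (h : ∀ l < L, W l = W' l) (l : ℕ) (hl : l ≤ L) : forward φ W l = forward φ W' l := by
  induction l with
  | zero => rfl
  | succ l ih =>
    funext x
    cases l with
    | zero => simp only [forward, h 0 (by omega)]
    | succ l => simp only [forward, h (l + 1) (by omega), ih (by omega)]

theorem measurableSet_marginError {p k : ℕ} (γ : ℝ)
    {f : EuclideanSpace ℝ (Fin p) → EuclideanSpace ℝ (Fin k)} (hf : Continuous f) :
    MeasurableSet {z | MarginError γ f z} := by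
  have h : {z : EuclideanSpace ℝ (Fin p) × Fin k | MarginError γ f z} =
      ⋃ (j : Fin k) (y : Fin k), if j ≠ y then
        Prod.snd ⁻¹' {y} ∩ {z | f z.1 y ≤ γ + f z.1 j} else ∅ := by
    ext z
    simp only [MarginError, Set.mem_ofPred_eq, Set.mem_iUnion]
    constructor
    · rintro ⟨j, hj, hle⟩
      exact ⟨j, z.2, by rw [if_pos hj]; exact ⟨rfl, hle⟩⟩
    · rintro ⟨j, y, hz⟩
      split_ifs at hz with hj
      · obtain ⟨rfl, hle⟩ := hz
        exact ⟨j, hj, hle⟩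
      · exact hz.elim
  rw [h]
  have hcoord : ∀ j, Measurable fun z : EuclideanSpace ℝ (Fin p) × Fin k => f z.1 j := fun j =>
    (((EuclideanSpace.proj (𝕜 := ℝ) j).continuous.comp hf).measurable).comp measurable_fst
  refine MeasurableSet.iUnion fun j => MeasurableSet.iUnion fun y => ?_
  split_ifs
  · exact (measurable_snd (measurableSet_singleton y)).inter
      (measurableSet_le (hcoord y) (measurable_const.add (hcoord j)))
  · exact MeasurableSet.empty

/-- Hoeffding's inequality for the frequency of an event in an i.i.d. sample. -/
theorem measure_frequency_lt_le {Ω Z : Type*} [MeasurableSpace Ω] [MeasurableSpace Z]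
    {μ : Measure Ω} [IsProbabilityMeasure μ] {D : Measure Z} {n : ℕ} (hn : 1 ≤ n)
    {S : Fin n → Ω → Z} (hS : ∀ i, Measurable (S i)) (hD : ∀ i, μ.map (S i) = D)
    (hind : iIndepFun S μ) {E : Set Z} (hE : MeasurableSet E) {t : ℝ} (ht : 0 ≤ t) :
    μ.real {ω | (1 / (n : ℝ)) * ∑ i, E.indicator (fun _ => (1 : ℝ)) (S i ω) + t < D.real E} ≤
      Real.exp (-(2 * n * t ^ 2)) := by
  have hn0 : (0 : ℝ) < n := by exact_mod_cast hn
  set φ : Z → ℝ := E.indicator fun _ => (1 : ℝ)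
  have hφ : Measurable φ := measurable_const.indicator hE
  have hmean : ∀ i, ∫ ω, -φ (S i ω) ∂μ = -D.real E := fun i => by
    rw [integral_neg, ← integral_map (hS i).aemeasurable hφ.aestronglyMeasurable, hD i,
      integral_indicator_const _ hE, smul_eq_mul, mul_one]
  -- The sign is reversed to reach the lower tail. Values in `[-1, 0]` give variance proxy `1/4`,
  -- hence the exponent `2 n t²`.
  have hsub : ∀ i ∈ Finset.univ,
      HasSubgaussianMGF (fun ω => -φ (S i ω) - ∫ ω, -φ (S i ω) ∂μ)
        ((‖(0 : ℝ) - (-1)‖₊ / 2) ^ 2) μ := fun i _ =>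
    hasSubgaussianMGF_of_mem_Icc (hφ.comp (hS i)).neg.aemeasurable
      (Filter.Eventually.of_forall fun ω => by
        by_cases h : S i ω ∈ E <;> simp [φ, h])
  have hind' : iIndepFun (fun i ω => -φ (S i ω) - ∫ ω, -φ (S i ω) ∂μ) μ :=
    hind.comp (fun i z => -φ z - ∫ ω, -φ (S i ω) ∂μ) fun i => hφ.neg.sub_const _
  have h := HasSubgaussianMGF.measure_sum_ge_le_of_iIndepFun hind' hsub
    (ε := n * t) (by positivity)
  refine (measureReal_mono (fun ω hω => ?_)).trans (h.trans (le_of_eq ?_))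
  · rw [Set.mem_ofPred_eq] at hω ⊢
    simp only [hmean, sub_neg_eq_add, Finset.sum_add_distrib, Finset.sum_neg_distrib,
      Finset.sum_const, Finset.card_univ, Fintype.card_fin, nsmul_eq_mul]
    have h2 := mul_lt_mul_of_pos_left hω hn0
    rw [mul_add, ← mul_assoc, mul_one_div_cancel hn0.ne', one_mul] at h2
    linarith
  · congr 1
    simp only [Finset.sum_const, Finset.card_univ, Fintype.card_fin, nsmul_eq_mul,
      zero_sub, neg_neg, nnnorm_one]
    push_cast
    field_simp

/-- Integer vectors with at most `a` nonzero entries, all in `[-K, K]`. -/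
theorem exists_finset_sparse_int {T : Type*} [Fintype T] {K a : ℕ} (ha : a ≤ Fintype.card T) :
    ∃ G : Finset (T → ℤ), G.Nonempty ∧
      G.card ≤ (Fintype.card T).choose a * (2 * K + 1) ^ a ∧
      ∀ c : T → ℤ, (∀ t, |c t| ≤ K) → (Finset.univ.filter fun t => c t ≠ 0).card ≤ a → c ∈ G := by
  classical
  -- Supports are enlarged to exactly `a` positions, so one binomial coefficient suffices; zero
  -- remains an allowed value on them.
  set G : Finset (T → ℤ) := (Finset.powersetCard a Finset.univ).biUnion fun s =>
    Fintype.piFinset fun t => if t ∈ s then Finset.Icc (-(K : ℤ)) K else {0} with hG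
  have hmem : ∀ c : T → ℤ, (∀ t, |c t| ≤ K) →
      (Finset.univ.filter fun t => c t ≠ 0).card ≤ a → c ∈ G := by
    intro c hc hcard
    obtain ⟨s, hs1, hs2⟩ := Finset.exists_superset_card_eq hcard (by simpa using ha)
    refine Finset.mem_biUnion.2 ⟨s, Finset.mem_powersetCard.2 ⟨Finset.subset_univ _, hs2⟩, ?_⟩
    refine Fintype.mem_piFinset.2 fun t => ?_
    split_ifs with h
    · exact Finset.mem_Icc.2 (abs_le.1 (hc t))
    · by_contra h0
      exact h (hs1 (by simpa using h0))
  refine ⟨G, ⟨0, hmem 0 (by simp) (by simp)⟩, ?_, hmem⟩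
  refine (Finset.card_biUnion_le_card_mul _ _ ((2 * K + 1) ^ a) fun s hs => ?_).trans
    (by rw [Finset.card_powersetCard, Finset.card_univ])
  rw [Fintype.card_piFinset, ← (Finset.mem_powersetCard.1 hs).2]
  have : ∀ t, (if t ∈ s then Finset.Icc (-(K : ℤ)) K else {0}).card =
      if t ∈ s then 2 * K + 1 else 1 := fun t => by
    split_ifs
    · rw [Int.card_Icc]; omega
    · simp
  simp only [this, Finset.prod_ite_mem, Finset.univ_inter, Finset.prod_const, le_refl]

theorem abs_round_div_le {a B ρ : ℝ} (hρ : 0 < ρ) (ha : |a| ≤ B) :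
    |round (a / ρ)| ≤ ((⌊B / ρ + 1 / 2⌋₊ : ℕ) : ℤ) := by
  have h1 : |(round (a / ρ) : ℝ)| ≤ B / ρ + 1 / 2 := by
    have h2 := abs_sub_round (a / ρ)
    rw [abs_sub_comm] at h2
    have h3 := abs_sub_abs_le_abs_sub (round (a / ρ) : ℝ) (a / ρ)
    have h4 : |a / ρ| ≤ B / ρ := by
      rw [abs_div, abs_of_pos hρ]
      exact div_le_div_of_nonneg_right ha hρ.le
    linarith
  rw [Int.abs_eq_natAbs]
  refine Int.ofNat_le.2 (Nat.le_floor ?_)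
  rwa [Nat.cast_natAbs, Int.cast_abs]

/-- Each nonzero weight takes at most `2K + 1 ≤ (2B + 2) / ρ` values. Because `ρ ≤ ρ₀ < 1`, the
constant `log (2B + 2)` is a bounded multiple of `log (1 / ρ)`. -/
theorem log_card_layer_le {B ρ₀ ρ : ℝ} (hB : 0 < B) (hρ₀1 : ρ₀ < 1) (hρ : 0 < ρ)
    (hρ0 : ρ ≤ ρ₀) {N a : ℕ} (ha : a ≤ N) :
    Real.log ((N.choose a * (2 * ⌊B / ρ + 1 / 2⌋₊ + 1) ^ a : ℕ) : ℝ) ≤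
      (1 + Real.log (2 * B + 2) / Real.log (1 / ρ₀)) *
        (Real.log (N.choose a : ℝ) + a * Real.log (1 / ρ)) := by
  have hρ₀ : 0 < ρ₀ := hρ.trans_le hρ0
  have hlog0 : 0 < Real.log (1 / ρ₀) := Real.log_pos (one_lt_one_div hρ₀ hρ₀1)
  have hlog : Real.log (1 / ρ₀) ≤ Real.log (1 / ρ) :=
    Real.log_le_log (by positivity) (one_div_le_one_div_of_le hρ hρ0)
  have hB2 : 0 ≤ Real.log (2 * B + 2) := Real.log_nonneg (by linarith)
  have hch : (1 : ℝ) ≤ N.choose a := by exact_mod_cast Nat.choose_pos ha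
  have hlc : 0 ≤ Real.log (N.choose a : ℝ) := Real.log_nonneg hch
  have hK : (2 * (⌊B / ρ + 1 / 2⌋₊ : ℝ) + 1) ≤ (2 * B + 2) * (1 / ρ) := by
    have h1 := Nat.floor_le (show 0 ≤ B / ρ + 1 / 2 by positivity)
    have h2 : 1 ≤ 1 / ρ := (one_le_div hρ).2 (by linarith)
    have h3 : (2 * B + 2) * (1 / ρ) = 2 * (B / ρ) + 2 * (1 / ρ) := by ring
    linarith
  have hlK : Real.log (2 * (⌊B / ρ + 1 / 2⌋₊ : ℝ) + 1) ≤
      (1 + Real.log (2 * B + 2) / Real.log (1 / ρ₀)) * Real.log (1 / ρ) := by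
    refine (Real.log_le_log (by positivity) hK).trans ?_
    rw [Real.log_mul (by positivity) (by positivity), add_mul, one_mul, add_comm]
    refine add_le_add_right ?_ _
    rw [div_mul_eq_mul_div, le_div_iff₀ hlog0]
    exact mul_le_mul_of_nonneg_left hlog hB2
  push_cast
  rw [Real.log_mul (by positivity) (by positivity), Real.log_pow, mul_add]
  refine add_le_add ?_ ?_
  · exact le_mul_of_one_le_left hlc (by have := div_nonneg hB2 hlog0.le; linarith)
  · refine (mul_le_mul_of_nonneg_left hlK (Nat.cast_nonneg _)).trans (le_of_eq (by ring))

/-- A network with `L` layers as an infinite sequence of matrices. -/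
noncomputable def extendByZero {w : ℕ → ℕ} {L : ℕ}
    (M : (l : Fin L) → Matrix (Fin (w (l + 1))) (Fin (w l)) ℝ) : Weights w :=
  fun l => if hl : l < L then M ⟨l, hl⟩ else 0

theorem extendByZero_apply {w : ℕ → ℕ} {L : ℕ}
    (M : (l : Fin L) → Matrix (Fin (w (l + 1))) (Fin (w l)) ℝ) (l : ℕ) (hl : l < L) :
    extendByZero M l = M ⟨l, hl⟩ :=
  dif_pos hl

/-- The networks with at most `α l` nonzero weights in layer `l`, all of them multiples of `ρ l` that
come from rounding numbers in `[-B, B]`, form a finite class whose logarithmic cardinality is at most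
a constant times the complexity. -/
theorem exists_finite_class {B ρ₀ : ℝ} (hB : 0 < B) (hρ₀1 : ρ₀ < 1) {w : ℕ → ℕ} {L : ℕ}
    {α : ℕ → ℕ} {ρ : ℕ → ℝ} (h : ∀ l < L, 0 < ρ l ∧ ρ l ≤ ρ₀ ∧ α l ≤ w (l + 1) * w l) :
    ∃ (I : Type) (_ : Fintype I) (_ : Nonempty I) (W : I → Weights w),
      Real.log (Fintype.card I) ≤
        (1 + Real.log (2 * B + 2) / Real.log (1 / ρ₀)) * complexity w L α ρ ∧
      ∀ X : Weights w, (∀ l < L, ∀ i j, |X l i j| ≤ B) → (∀ l < L, numNonzero (X l) ≤ α l) →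
        ∃ c, ∀ l < L, discretize (ρ l) (X l) = W c l := by
  choose G hGne hGcard hGmem using fun l : Fin L =>
    exists_finset_sparse_int (T := Fin (w (l + 1)) × Fin (w l)) (K := ⌊B / ρ l + 1 / 2⌋₊)
      (a := α l) (by simpa using (h l l.2).2.2)
  have hne : ∀ l, Nonempty (G l) := fun l => (hGne l).to_subtype
  refine ⟨(l : Fin L) → G l, inferInstance, inferInstance,
    fun c => extendByZero fun l => Matrix.of fun i j => ρ l * ((c l).1 (i, j) : ℝ),
    ?_, fun X hX hnum => ?_⟩
  · rw [Fintype.card_pi, Nat.cast_prod, Real.log_prod (fun l _ => by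
      rw [Fintype.card_coe]; exact_mod_cast (hGne l).card_pos.ne')]
    rw [complexity, Finset.sum_range, Finset.mul_sum]
    refine Finset.sum_le_sum fun l _ => ?_
    obtain ⟨h1, h2, h3⟩ := h l l.2
    refine le_trans (Real.log_le_log ?_ ?_) (log_card_layer_le hB hρ₀1 h1 h2 h3)
    · rw [Fintype.card_coe]; exact_mod_cast (hGne l).card_pos
    · rw [Fintype.card_coe]
      exact_mod_cast by simpa using hGcard l
  · refine ⟨fun l => ⟨fun q => round (X l q.1 q.2 / ρ l), hGmem l _
      (fun q => abs_round_div_le (h l l.2).1 (hX l l.2 q.1 q.2)) ?_⟩, fun l hl => ?_⟩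
    · refine (Finset.card_le_card fun q hq => ?_).trans (hnum l l.2)
      simp only [Finset.mem_filter, Finset.mem_univ, true_and] at hq ⊢
      rintro h0
      exact hq (by rw [h0]; simp)
    · dsimp only
      rw [extendByZero_apply _ l hl]
      rfl

/-- Uniform generalization bound for a finite class. -/
theorem measure_exists_risk_gt_le {Ω I : Type*} [MeasurableSpace Ω] {μ : Measure Ω}
    [IsProbabilityMeasure μ] [Fintype I] [Nonempty I] {p k n : ℕ} (hn : 1 ≤ n)
    {D : Measure (EuclideanSpace ℝ (Fin p) × Fin k)}
    {S : Fin n → Ω → EuclideanSpace ℝ (Fin p) × Fin k} (hS : ∀ i, Measurable (S i))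
    (hD : ∀ i, μ.map (S i) = D) (hind : iIndepFun S μ)
    {g : I → EuclideanSpace ℝ (Fin p) → EuclideanSpace ℝ (Fin k)} (hg : ∀ c, Continuous (g c))
    {M δ : ℝ} (hM : Real.log (Fintype.card I) ≤ M) (hδ : 0 < δ) (hδ1 : δ < 1) :
    μ.real {ω | ∃ c, empRisk (fun i => S i ω) 0 (g c) + Real.sqrt (M / n)
      + Real.sqrt (Real.log (1 / δ) / (2 * n)) < risk D 0 (g c)} ≤ δ := by
  have hn0 : (0 : ℝ) < n := by exact_mod_cast hn
  have hI : (0 : ℝ) < Fintype.card I := by exact_mod_cast Fintype.card_pos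
  have hM0 : 0 ≤ M := (Real.log_natCast_nonneg _).trans hM
  have hlog : 0 < Real.log (1 / δ) := Real.log_pos (one_lt_one_div hδ hδ1)
  set t := Real.sqrt (M / n) + Real.sqrt (Real.log (1 / δ) / (2 * n)) with ht
  -- The square of a sum of nonnegative roots dominates the sum of the squares, so the exponent pays
  -- for both the class size and `δ`.
  have ht2 : M + Real.log (1 / δ) ≤ 2 * n * t ^ 2 := by
    have h1 : M / n + Real.log (1 / δ) / (2 * n) ≤ t ^ 2 := by
      rw [ht, add_sq, Real.sq_sqrt (by positivity), Real.sq_sqrt (by positivity)]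
      have : 0 ≤ 2 * Real.sqrt (M / n) * Real.sqrt (Real.log (1 / δ) / (2 * n)) := by positivity
      linarith
    calc M + Real.log (1 / δ) ≤ 2 * M + Real.log (1 / δ) := by linarith
      _ = 2 * n * (M / n + Real.log (1 / δ) / (2 * n)) := by field_simp
      _ ≤ _ := mul_le_mul_of_nonneg_left h1 (by positivity)
  calc _ ≤ μ.real (⋃ c, {ω | (1 / (n : ℝ)) * ∑ i, Set.indicator {z | MarginError 0 (g c) z}
        (fun _ => (1 : ℝ)) (S i ω) + t < D.real {z | MarginError 0 (g c) z}}) := by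
        refine measureReal_mono fun ω hω => ?_
        obtain ⟨c, hc⟩ := hω
        refine Set.mem_iUnion.2 ⟨c, ?_⟩
        rw [add_assoc] at hc
        exact hc
    _ ≤ ∑ _c : I, Real.exp (-(2 * n * t ^ 2)) := (measureReal_iUnion_fintype_le _).trans
        (Finset.sum_le_sum fun c _ => measure_frequency_lt_le hn hS hD hind
          (measurableSet_marginError 0 (hg c)) (by positivity))
    _ = Fintype.card I * Real.exp (-(2 * n * t ^ 2)) := by simp
    _ ≤ Fintype.card I * Real.exp (-(Real.log (Fintype.card I) + Real.log (1 / δ))) := by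
        refine mul_le_mul_of_nonneg_left (Real.exp_le_exp.2 ?_) hI.le
        linarith
    _ = δ := by
        rw [neg_add, Real.exp_add, Real.exp_neg, Real.exp_log hI, one_div, Real.log_inv, neg_neg,
          Real.exp_log hδ]
        field_simp

end PrunedNet

/-! ### The good event and the final union bound -/

namespace PrunedNet

/-- Chernoff's bound with the optimal parameter `B / Ψ`, applied to `X` and to `-X`. -/
theorem measure_abs_gaussian_gt_le {Ω : Type*} [MeasurableSpace Ω] {μ : Measure Ω}
    [IsProbabilityMeasure μ] {X : Ω → ℝ} (hX : Measurable X) {Ψ : NNReal} (hΨ : 0 < Ψ)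
    (h : μ.map X = gaussianReal 0 Ψ) {B : ℝ} (hB : 0 < B) :
    μ.real {ω | B < |X ω|} ≤ 2 * Real.exp (-B ^ 2 / (2 * Ψ)) := by
  have hΨ0 : (0 : ℝ) < Ψ := NNReal.coe_pos.2 hΨ
  have key : ∀ Y : Ω → ℝ, Measurable Y → μ.map Y = gaussianReal 0 Ψ →
      μ.real {ω | B ≤ Y ω} ≤ Real.exp (-B ^ 2 / (2 * Ψ)) := by
    intro Y hY hmap
    have hint : Integrable (fun ω => Real.exp (B / Ψ * Y ω)) μ := by
      have h1 := integrable_exp_mul_gaussianReal (μ := 0) (v := Ψ) (B / Ψ)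
      rw [← hmap] at h1
      exact h1.comp_measurable hY
    refine (measure_ge_le_exp_mul_mgf B (by positivity) hint).trans (le_of_eq ?_)
    rw [mgf_gaussianReal hmap, ← Real.exp_add]
    congr 1
    field_simp
    ring
  have hneg : μ.map (fun ω => -X ω) = gaussianReal 0 Ψ := by
    have h1 := gaussianReal_map_neg (μ := 0) (v := Ψ)
    rw [neg_zero, ← h, Measure.map_map measurable_neg hX, h] at h1
    exact h1
  calc μ.real {ω | B < |X ω|} ≤ μ.real ({ω | B ≤ X ω} ∪ {ω | B ≤ -X ω}) := by
        refine measureReal_mono fun ω hω => ?_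
        rcases lt_abs.1 (show B < |X ω| from hω) with h1 | h1
        · exact Or.inl h1.le
        · exact Or.inr h1.le
    _ ≤ _ := measureReal_union_le _ _
    _ ≤ _ := add_le_add (key X hX h) (key _ hX.neg hneg)
    _ = _ := by ring

theorem abs_prune_le {m n : ℕ} {d Ψ B : ℝ} (hB : 0 ≤ B) {u A : Matrix (Fin m) (Fin n) ℝ}
    (h : ∀ i j, |A i j| ≤ B) (i : Fin m) (j : Fin n) : |prune d Ψ u A i j| ≤ B := by
  simp only [prune, Matrix.of_apply]
  split_ifs
  · simpa using hB
  · exact h i j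

/-- The deterministic part of the generalization bound. -/
theorem risk_le_of_good_event {w : ℕ → ℕ} {φ : Activations w} {lip : ℕ → NNReal} {L n : ℕ}
    (hφ : ∀ l, 1 ≤ l → l < L → LipschitzWith (lip l) (φ l) ∧ φ l 0 = 0)
    {C₀ d Ψ B : ℝ} (hB : 0 ≤ B) {ε ρ : ℕ → ℝ} {α : ℕ → ℕ} {u A : Weights w}
    (hρ : ∀ l < L, 0 < ρ l) {D : Measure (EuclideanSpace ℝ (Fin (w 0)) × Fin (w L))}
    {S : Fin n → EuclideanSpace ℝ (Fin (w 0)) × Fin (w L)} {I : Type*} {W : I → Weights w} {r : ℝ}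
    (hcover : ∀ X : Weights w, (∀ l < L, ∀ i j, |X l i j| ≤ B) →
      (∀ l < L, numNonzero (X l) ≤ α l) → ∃ c, ∀ l < L, discretize (ρ l) (X l) = W c l)
    (hrisk : ∀ c, risk D 0 (forward φ (W c) L) ≤ empRisk S 0 (forward φ (W c) L) + r)
    (hprune : ∀ l < L, ‖A l - prune d Ψ (u l) (A l)‖ ≤
      ε l * pruneScale C₀ d Ψ (w (l + 1)) (w l) / 2)
    (hA : ∀ l < L, ∀ i j, |A l i j| ≤ B) (hS : ∀ i, ‖(S i).1‖ ≤ w 0)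
    (hnum : ∀ l < L, numNonzero (pruned d Ψ u A l) ≤ α l)
    (hfine : ∀ l < L, layerError C₀ d Ψ ε ρ u A l ≤ ‖A l‖ / L)
    {γ : ℝ} (hγ : marginThreshold C₀ d Ψ L lip ε ρ u A ≤ γ) :
    risk D 0 (forward φ (compressed d Ψ ρ u A) L) ≤ empRisk S γ (forward φ A L) + r := by
  obtain ⟨c, hc⟩ := hcover (pruned d Ψ u A) (fun l hl => abs_prune_le hB (hA l hl)) hnum
  have hforward : forward φ (compressed d Ψ ρ u A) L = forward φ (W c) L :=
    forward_congr (L := L) hc L le_rfl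
  have hemp : empRisk S 0 (forward φ (compressed d Ψ ρ u A) L) ≤ empRisk S γ (forward φ A L) := by
    refine empRisk_mono fun i hi => MarginError.of_norm_sub_le ?_ hi
    have := norm_forward_sub_compressed_le hφ hρ hprune hfine (hS i)
    linarith
  have := hrisk c
  rw [← hforward] at this
  linarith

theorem measure_exists_norm_gt_eq_zero {Ω E Y : Type*} [MeasurableSpace Ω] {μ : Measure Ω}
    [NormedAddCommGroup E] [MeasurableSpace E] [OpensMeasurableSpace E] [MeasurableSpace Y] {n : ℕ}
    {D : Measure (E × Y)} {S : Fin n → Ω → E × Y} (hS : ∀ i, Measurable (S i))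
    (hD : ∀ i, μ.map (S i) = D) {R : ℝ} (h : ∀ᵐ z ∂D, ‖z.1‖ ≤ R) :
    μ.real {ω | ¬ ∀ i, ‖(S i ω).1‖ ≤ R} = 0 := by
  have h1 : ∀ᵐ ω ∂μ, ∀ i, ‖(S i ω).1‖ ≤ R := by
    refine ae_all_iff.2 fun i => ?_
    rw [← hD i] at h
    exact ae_of_ae_map (hS i).aemeasurable h
  rw [measureReal_def, ae_iff.1 h1, ENNReal.toReal_zero]

end PrunedNet
theorem mainTheorem8 :
    -- `C₀` is the universal constant in the scale of the pruning error
    ∃ C₀ : ℝ, 0 < C₀ ∧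
    -- `C` is the constant of the generalization bound
    ∀ B ρ₀ : ℝ, 0 < B → 0 < ρ₀ → ρ₀ < 1 → ∃ C : ℝ, 0 < C ∧
    ∀ (L : ℕ) (w : ℕ → ℕ) (φ : Activations w) (lip : ℕ → NNReal)
      (n : ℕ) (d : ℝ) (Ψ : NNReal) (ε ρ : ℕ → ℝ) (α : ℕ → ℕ) (δ : ℝ)
      (D : Measure (EuclideanSpace ℝ (Fin (w 0)) × Fin (w L)))
      (Ω : Type*) (_ : MeasurableSpace Ω) (μ : Measure Ω)
      (S : Fin n → Ω → EuclideanSpace ℝ (Fin (w 0)) × Fin (w L))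
      (A u : Ω → Weights w),
    1 ≤ L → 1 ≤ n → 0 < d → 0 < Ψ → 0 < δ → δ < 1 →
    (∀ l, 1 ≤ l → l < L → LipschitzWith (lip l) (φ l) ∧ φ l 0 = 0) →
    (∀ l < L, 0 < ε l ∧ 0 < ρ l ∧ ρ l ≤ ρ₀ ∧ α l ≤ w (l + 1) * w l) →
    IsProbabilityMeasure D → IsProbabilityMeasure μ →
    -- the inputs have Euclidean norm at most the input dimension
    (∀ᵐ z ∂D, ‖z.1‖ ≤ (w 0 : ℝ)) →
    -- `S` is an i.i.d. sample from `D`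
    (∀ i, Measurable (S i)) → (∀ i, μ.map (S i) = D) → iIndepFun S μ →
    -- the trained weights: within each layer, i.i.d. centred Gaussian entries of variance `Ψ`
    (∀ l < L, ∀ i j, Measurable (fun ω => A ω l i j)) →
    (∀ l < L, ∀ i j, μ.map (fun ω => A ω l i j) = gaussianReal 0 Ψ) →
    (∀ l < L, iIndepFun
      (fun (q : Fin (w (l + 1)) × Fin (w l)) (ω : Ω) => A ω l q.1 q.2) μ) →
    -- the coins of the pruning algorithm: independent uniform variables, independent of all else
    (∀ l < L, ∀ i j, Measurable (fun ω => u ω l i j)) →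
    (∀ l < L, ∀ i j, μ.map (fun ω => u ω l i j) = volume.restrict (Set.Icc (0 : ℝ) 1)) →
    iIndepFun (fun (q : Σ l : Fin L, Fin (w (l + 1)) × Fin (w l)) (ω : Ω) =>
      u ω q.1 q.2.1 q.2.2) μ →
    IndepFun
      (fun ω => ((fun i => S i ω),
        (fun q : Σ l : Fin L, Fin (w (l + 1)) × Fin (w l) => A ω q.1 q.2.1 q.2.2)))
      (fun ω => (fun q : Σ l : Fin L, Fin (w (l + 1)) × Fin (w l) => u ω q.1 q.2.1 q.2.2)) μ →
    -- the probability that the bound fails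
    μ.real {ω | ¬ (
        -- if at most `α l` entries of each layer survive the pruning
        (∀ l < L, numNonzero (pruned d Ψ (u ω) (A ω) l) ≤ α l) →
        -- and pruning and discretization are fine enough
        (∀ l < L, layerError C₀ d Ψ ε ρ (u ω) (A ω) l ≤ ‖A ω l‖ / L) →
        -- then for every margin above the threshold
        ∀ γ : ℝ, marginThreshold C₀ d Ψ L lip ε ρ (u ω) (A ω) ≤ γ →
          risk D 0 (forward φ (compressed d Ψ ρ (u ω) (A ω)) L) ≤
            empRisk (fun i => S i ω) γ (forward φ (A ω) L)
              + C * Real.sqrt (complexity w L α ρ / n)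
              + Real.sqrt (Real.log (1 / δ) / (2 * n)))}
      ≤ δ + ∑ l ∈ Finset.range L, 1 / ε l
          + 2 * (∑ l ∈ Finset.range L, (w (l + 1) * w l : ℝ)) * Real.exp (-B ^ 2 / (2 * Ψ)) := by
  refine ⟨200, by norm_num, fun B ρ₀ hB hρ₀ hρ₀1 => ?_⟩
  have hlog0 : 0 < Real.log (1 / ρ₀) := Real.log_pos (one_lt_one_div hρ₀ hρ₀1)
  have hB2 : 0 ≤ Real.log (2 * B + 2) := Real.log_nonneg (by linarith)
  -- Ratio between the logarithmic size of the class and `complexity`; it stands under the root in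
  -- the generalization bound, so its square root is the required constant.
  set c : ℝ := 1 + Real.log (2 * B + 2) / Real.log (1 / ρ₀)
  have hc : 0 < c := by positivity
  refine ⟨Real.sqrt c, Real.sqrt_pos.2 hc, ?_⟩
  intro L w φ lip n d Ψ ε ρ α δ D Ω _ μ S A u hL hn hd hΨ hδ hδ1 hφ hpar hDp hμp hx hSm hSD hSi
    hAm hAmap hAi hum humap hui hind
  have hmodel : ∀ l : Fin L, LayerModel μ Ψ (fun ω => A ω l) (fun ω => u ω l) := fun l =>
    { measurable_weight := hAm l l.2
      measurable_coin := hum l l.2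
      map_weight := hAmap l l.2
      map_coin := humap l l.2
      indep_weight := hAi l l.2
      indep_coin := hui.precomp
        (sigma_mk_injective (β := fun l : Fin L => Fin (w (l + 1)) × Fin (w l)) (i := l))
      indep := hind.comp
        (φ := fun (z : (Fin n → EuclideanSpace ℝ (Fin (w 0)) × Fin (w L)) ×
          ((Σ l : Fin L, Fin (w (l + 1)) × Fin (w l)) → ℝ)) q => z.2 ⟨l, q⟩)
        (ψ := fun (z : (Σ l : Fin L, Fin (w (l + 1)) × Fin (w l)) → ℝ) q => z ⟨l, q⟩)
        (by fun_prop) (by fun_prop) }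
  obtain ⟨I, _, _, W, hcard, hcover⟩ := exists_finite_class hB hρ₀1 (w := w) (L := L) (α := α)
    (ρ := ρ) fun l hl => (hpar l hl).2
  -- Four bad events: a class member generalizes badly, a pruning error is large, a weight exceeds
  -- `B`, a sample input is too long. Their probabilities are the three terms of the bound and zero.
  -- Only monotonicity and subadditivity are used, so the failure event need not be measurable.
  set E₁ : Set Ω := {ω | ∃ a, empRisk (fun i => S i ω) 0 (forward φ (W a) L)
    + Real.sqrt (c * complexity w L α ρ / n) + Real.sqrt (Real.log (1 / δ) / (2 * n)) <
      risk D 0 (forward φ (W a) L)} with hE₁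
  set E₂ : Set Ω := ⋃ l : Fin L, {ω | ¬ ‖A ω l - prune d Ψ (u ω l) (A ω l)‖ ≤
    ε l * pruneScale 200 d Ψ (w (l + 1)) (w l) / 2} with hE₂
  set E₃ : Set Ω := ⋃ q : Σ l : Fin L, Fin (w (l + 1)) × Fin (w l),
    {ω | B < |A ω q.1 q.2.1 q.2.2|} with hE₃
  set E₄ : Set Ω := {ω | ¬ ∀ i, ‖(S i ω).1‖ ≤ w 0} with hE₄
  have h₁ : μ.real E₁ ≤ δ := measure_exists_risk_gt_le hn hSm hSD hSi
    (fun a => continuous_forward (fun l h1 h2 => (hφ l h1 h2).1.continuous) (W a) L le_rfl)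
    hcard hδ hδ1
  have h₂ : μ.real E₂ ≤ ∑ l ∈ Finset.range L, 1 / ε l := by
    rw [Finset.sum_range]
    exact (measureReal_iUnion_fintype_le _).trans (Finset.sum_le_sum fun l _ =>
      (hmodel l).measure_pruning_error_le hd hΨ (hpar l l.2).1)
  have h₃ : μ.real E₃ ≤ 2 * (∑ l ∈ Finset.range L, (w (l + 1) * w l : ℝ)) *
      Real.exp (-B ^ 2 / (2 * Ψ)) := by
    refine (measureReal_iUnion_fintype_le _).trans ((Finset.sum_le_sum fun q _ =>
      measure_abs_gaussian_gt_le (hAm q.1 q.1.2 q.2.1 q.2.2) hΨ (hAmap q.1 q.1.2 q.2.1 q.2.2)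
        hB).trans (le_of_eq ?_))
    rw [Finset.sum_const, Finset.card_univ, Fintype.card_sigma, Finset.sum_range]
    simp only [Fintype.card_prod, Fintype.card_fin, nsmul_eq_mul, Nat.cast_sum, Nat.cast_mul]
    ring
  have h₄ : μ.real E₄ = 0 := measure_exists_norm_gt_eq_zero hSm hSD hx
  refine (measureReal_mono (s₂ := E₁ ∪ (E₂ ∪ (E₃ ∪ E₄))) fun ω hω => ?_).trans ?_
  · by_contra hgood
    simp only [Set.mem_union, not_or] at hgood
    obtain ⟨g₁, g₂, g₃, g₄⟩ := hgood
    refine hω fun hnum hfine γ hγ => ?_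
    simp only [hE₁, Set.mem_ofPred_eq, not_exists, not_lt] at g₁
    simp only [hE₂, Set.mem_iUnion, Set.mem_ofPred_eq, not_exists, not_not] at g₂
    simp only [hE₃, Set.mem_iUnion, Set.mem_ofPred_eq, not_exists, not_lt] at g₃
    simp only [hE₄, Set.mem_ofPred_eq, not_not] at g₄
    have h := risk_le_of_good_event hφ hB.le (fun l hl => (hpar l hl).2.1) (D := D) hcover
      (r := Real.sqrt (c * complexity w L α ρ / n) + Real.sqrt (Real.log (1 / δ) / (2 * n)))
      (fun a => by rw [← add_assoc]; exact g₁ a) (fun l hl => g₂ ⟨l, hl⟩)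
      (fun l hl i j => g₃ ⟨⟨l, hl⟩, i, j⟩) g₄ hnum hfine hγ
    rwa [← add_assoc, mul_div_assoc, Real.sqrt_mul hc.le] at h
  · have u₁ := measureReal_union_le (μ := μ) E₁ (E₂ ∪ (E₃ ∪ E₄))
    have u₂ := measureReal_union_le (μ := μ) E₂ (E₃ ∪ E₄)
    have u₃ := measureReal_union_le (μ := μ) E₃ E₄
    linarith
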